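/- **Setting.** Let $\rho\ne0$ and $\mu$ be real, $\nu=\mu/\rho$. Space-time points are $(t,x,y,z)\in\mathbb R^4$; the components of the velocity $U$ and of the body acceleration $g$ in the directions $x,y,z$ are numbered $1,0,2$. The incompressible Navier–Stokes equations are $$\nabla\cdot U=0,\qquad \rho(\partial_tU+U\cdot\nabla U)=-\nabla P+\mu\nabla^2U+\rho g.\tag{NS}$$ Let $g^\alpha=\sum g^\alpha_{\omega,p,q,r}t^\omega x^py^qz^r$. *Data* are real numbers $c^\alpha_{\omega,p,q,r}$ ($\alpha\in\{0,1,2\}$; $\omega,p,q,r\ge0$; only those with $\omega=0$ or $p\le1$ or $q\le1$ or $r\le1$ matter) and $\pi_{\omega,q,r}$. Families $(u^\alpha_{\omega,p,q,r})$, $(P_{\omega,p,q,r})$ *have these data* if $u^\alpha_{\omega,p,q,r}=c^\alpha_{\omega,p,q,r}$ whenever $\omega=0$ or $\min(p,q,r)\le1$, and $P_{\omega,0,q,r}=\pi_{\omega,q,r}$. The domain of convergence of a power series is the interior of its set of absolute convergence in $\mathbb R^4$. $(u,P)$ is a *power series solution* of (NS) if either (a) the series $U^\alpha=\sum u^\alpha_{\omega,p,q,r}t^\omega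 x^py^qz^r$, $P=\sum P_{\omega,p,q,r}t^\omega x^py^qz^r$ and $g^\alpha$ have a non-empty common domain of convergence and their sums satisfy (NS) there, or (b) these series satisfy (NS) as formal power series. **Theorem.** Let $\mathcal V^\alpha_{\omega,p,q,r}(c)$ be the explicit expression defined below. (1) If $(u,P)$ is a power series solution with data $(c,\pi)$, then for all $\alpha\in\{0,1,2\}$ and $\omega,p,q,r\ge0$ $$u^\alpha_{\omega,p,q,r}=\mathcal V^\alpha_{\omega,p,q,r}(c)=\sum_{i=0}^{\eta_{\omega-1}(s)}\Big[\prod_{j=1}^{\omega}\prod_{k=1}^{2^{j-1}}\Gamma\big(\rho(i,1,k,j,s),\,\Theta(k-2+2^{j-1},i,s,0)\big)\Big]\Big[\prod_{k=1}^{2^\omega}c_{\aleph(i,1,k,s)}\Big],\quad s=(\omega,p,q,r,\alpha),$$ and, for $\omega,p,q,r\ge0$, $P_{\omega,0,q,r}=\pi_{\omega,q,r}$ and $$\begin{aligned}-\tfrac1\rho P_{\omega,p+1,q,r}=\tfrac1{p+1}\Big\{&(\omega+1)u^1_{\omega+1,p,q,r}+\sum_{k=0}^{\omega}\sum_{i=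0}^{p}\sum_{j=0}^{q}\sum_{l=0}^{r}\big[(i+1)u^1_{\omega-k,p-i,q-j,r-l}u^1_{k,i+1,j,l}\\&+(j+1)u^0_{\omega-k,p-i,q-j,r-l}u^1_{k,i,j+1,l}+(l+1)u^2_{\omega-k,p-i,q-j,r-l}u^1_{k,i,j,l+1}\big]\\&-\nu\big[(p+1)(p+2)u^1_{\omega,p+2,q,r}+(q+1)(q+2)u^1_{\omega,p,q+2,r}+(r+1)(r+2)u^1_{\omega,p,q,r+2}\big]-g^1_{\omega,p,q,r}\Big\}.\end{aligned}\tag{Pr}$$ (2) If there is a power series solution with data $(c,\pi)$, then with the coefficients $u^\alpha_{\omega,p,q,r}:=\mathcal V^\alpha_{\omega,p,q,r}(c)$, and $P$ given by (Pr) and $P_{\omega,0,q,r}:=\pi_{\omega,q,r}$, the sums of the series $U^0,U^1,U^2,P$ are smooth and satisfy (NS) on the whole common domain of convergence of these four series. **The functions in the formula.** An index $s=(\omega,p,q,r,\alpha)$ has integer entries. $c_s:=1$ if one of $\omega,p,q,r$ is negative, and $c_s:=c^\alpha_{\omega,p,q,r}$ otherwise. $E$ is the floor, $E_+=\max(0,E)$,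 $\mathcal H$ is the Heaviside function with $\mathcal H(0)=1$, $x\bmod y=x-yE(x/y)$, $e=E(q/2)$, $X_1=p$, $X_2=r$, $A=X_\alpha$, $B=X_{3-\alpha}$, $\varepsilon=(-1)^\alpha$, $E_2(m)=E(\log_2(m+1))$, $Ip(x)=2$ for even $x$ and $1$ for odd $x$. Propositions: $P_1$: $\omega>0$ and $p,q,r>1$; $P_2$: one of $\omega,p,q,r$ is $<0$; $P_3$: $\omega=0$ or one of $p,q,r$ is in $\{0,1\}$. Until "Indices" below, $\alpha\in\{1,2\}$. *Viscous terms.* For $z=0,1,\dots,8$ the values $(\kappa_z;\xi_z,\Delta_z,\epsilon_z)$ (the latter three also depending on $n$) are: $z=0$: $(-1;-1,-1,-1)$; $z=1$: $(\alpha;\,p+2(\alpha-1),q,r+2(2-\alpha))$; $z=2$: $(\alpha;\,p,q+2,r)$; $z=3$: $(0;\,p+2-\alpha,q+1,r+\alpha-1)$; $z=4$: $(3-\alpha;\,p+1,q,r+1)$; $z=5$: $(0;\,p+(2-\alpha)(2e+1),q-2e+1,r+(\alpha-1)(2e+1))$; $z=6$: $(0;\,p-2\varepsilon n+3\alpha-4+2(\alpha-1)e,\;q-2e+1,\;r+2\varepsilon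 n-3\alpha+5+2(2-\alpha)e)$; $z=7$: $(\alpha;\,p-2\varepsilon n+2(\alpha-1)e,\;q-2e+2,\;r+2\varepsilon n+2(2-\alpha)e)$; $z=8$: $(3-\alpha;\,p-\varepsilon(2n-1)+2(\alpha-1)e,\;q-2e+2,\;r+\varepsilon(2n-1)+2(2-\alpha)e)$. *Convective terms.* With $a\in\{0,1,2\}$, $b\in\{0,1\}$: $s_1=p+(2-\alpha)(2e+1-b-2n)$, $\;p+\varepsilon(2m-b)+(2-\alpha)(2n+1-b)$, $\;p+2\varepsilon m+(2-\alpha)(2n+3-b)$ for $a=0,1,2$ respectively; $s_2=q-(2e+1-b-2n)$, $\;q-1-2n+b$, $\;q-2n-3+b$; $s_3=r+(\alpha-1)(2e+1-b-2n)$, $\;r-\varepsilon(2m-b)+(\alpha-1)(2n+1-b)$, $\;r-2\varepsilon m+(\alpha-1)(2n+3-b)$; $Y_0=b-1+q-2e+2n$, $\;b-1+q-2n$, $\;b+q-2n-3$; $Y_1=p+(2-\alpha)(1-b)+(2-\alpha)(2e-2n)$, $\;p+(\alpha-1)(1-b)+\varepsilon(2m-1)+2n(2-\alpha)$, $\;p+(2-\alpha)(1-b)+2\varepsilon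 m+(2n+2)(2-\alpha)$; $Y_2=r+(\alpha-1)(1-b)+(\alpha-1)(2e-2n)$, $\;r+(2-\alpha)(1-b)-\varepsilon(2m-1)+2n(\alpha-1)$, $\;r+(\alpha-1)(1-b)-2\varepsilon m+(2n+2)(\alpha-1)$; $H=\delta_{n,m}(-1)^{n+b+e}$ for $a=0$ and $H=(-1)^{n+b+\frac12a(a-1)+\frac12(a-1)(a-2)e}\frac{(n-2+a)!}{(m-2+a)!(n-m)!}$ for $a>0$. For an integer $d\ge0$ put $K=\frac32e^2-\frac32e+1$, $D_0=E(d/K)$, $b=E(\frac14(1+D_0))$, $\varphi=D_0-3b$; $a=0$ if $d\bmod K<\frac12e(e+1)$, $a=1$ if $\frac12e(e+1)\le d\bmod K<e^2$, $a=2$ otherwise; $\gamma=d+1-KD_0-\frac12(ae^2+a(2-a)e)$, $n=E(\frac12(1+\sqrt{8\gamma-7}))$, $m=\gamma-\frac12((n-1)^2+n-1)$. From here on $s_1,s_2,s_3,Y_0,Y_1,Y_2,H$ are taken at these $a,b,n,m$, $S(s,d)=(s_1+1)(s_2+1)(s_3+1)$, and for an integer $i'$: $L_0=E\big(\frac{i'-1}{s_3+1}\big)$,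 $L_1=E\big(\frac{i'-1}{(s_3+1)(s_2+1)}\big)$, $L_2=(i'-1)\bmod(s_3+1)$, $e_0=\frac12(\varphi-1)(\varphi-2)$, $e_1=\varphi(2-\varphi)$, $e_2=\frac12\varphi(\varphi-1)$, $$G(s,d,i')=H\,\{e_0[L_0-(s_2+1)L_1]+e_1L_1+e_2L_2+1\}\frac{Y_0!\,Y_1!\,Y_2!}{p!\,q!\,r!},$$ $W_0=e_0+L_0-(s_2+1)L_1$, $W_1=e_1+L_1$, $W_2=e_2+L_2$, $V_0=Y_0-L_0+(s_2+1)L_1$, $V_1=Y_1-L_1$, $V_2=Y_2-L_2$. *Numbering.* With $\Sigma_j=\sum_{k=0}^{j-1}S(s,k)$ and $h_j=\mathcal H(\frac{\tau-1}{\Sigma_j}-1)$, put $D(s,\tau)=\sum_{j=1}^{9e^2-9e+6}h_j$, $\mathcal I(s,\tau)=\tau-\sum_{j=1}^{9e^2-9e+6}S(s,j-1)h_j$; $$\begin{aligned}\sigma(s)={}&\big[2e^4+(4A+6B+8)e^3+(9AB+1.5A+3B-8)e^2-(9AB+5.5A+9B+2)e+6AB+6A+9B+9\big]q\\&-3.2e^5-(6A+8B+8)e^4+(6B+6A-10AB+24)e^3+(14B+9A+22.5AB-7)e^2\\&-(9A+12B+12.5AB-2.2)e+3(A+1)(B+1)-8e;\end{aligned}$$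 $\mathcal T(s,i)=i+1-\sigma E(i/\sigma)$, $\chi(s,i)=i-\sigma\omega$, $z(s,i)=\chi-8E_+(\frac{\chi-1}8)$, $\mathcal N(s,i)=E(\frac{\chi-1}8)+1$; below $d=D(s,\mathcal T(s,i))$, $i'=\mathcal I(s,\mathcal T(s,i))$. *Coefficients.* $$\begin{aligned}F_0=\sum_{n=1}^{e}(-1)^{e}\tbinom{e-1}{n-1}\Big(&\tfrac{(A+2n)!(B+2e-2n)!}{p!q!r!}c^\alpha_{\omega,\,p-2\varepsilon n+2(\alpha-1)e,\,q-2e,\,r+2\varepsilon n+2(2-\alpha)e}\\&+\tfrac{(A+2n-1)!(B+2e-2n+1)!}{p!q!r!}c^{3-\alpha}_{\omega,\,p-\varepsilon(2n-1)+2(\alpha-1)e,\,q-2e,\,r+\varepsilon(2n-1)+2(2-\alpha)e}\Big),\end{aligned}$$ $$\begin{aligned}\widetilde F_0={}&\frac1\omega\sum_{n=1}^{e}(-1)^{n+1}\Big(\tfrac{(q-2n+2)!(A+2n-2)!}{A!\,q!}g^\alpha_{\omega-1,\,p+(2-\alpha)(2n-2),\,q-2n+2,\,r+(\alpha-1)(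2n-2)}\\&\qquad-\tfrac{(q-2n+1)!(A+2n-1)!}{A!\,q!}g^0_{\omega-1,\,p+(2-\alpha)(2n-1),\,q-2n+1,\,r+(\alpha-1)(2n-1)}\Big)\\&+\frac1\omega\sum_{n=1}^{e-1}\sum_{m=1}^n(-1)^n\Big(\tbinom{n-1}{m-1}\tfrac{(B+2m-1)!(q-2n)!(A-2m+2n+1)!}{p!q!r!}g^{3-\alpha}_{\omega-1,\,p+\varepsilon(2m-1)+2n(2-\alpha),\,q-2n,\,r-\varepsilon(2m-1)+2(\alpha-1)n}\\&\qquad-\tbinom nm\tfrac{(B+2m)!(q-1-2n)!(A-2m+2n+1)!}{p!q!r!}g^0_{\omega-1,\,p+2m\varepsilon+(2-\alpha)(2n+1),\,q-1-2n,\,r-2m\varepsilon+(\alpha-1)(2n+1)}\Big)\\&+\frac1\omega\sum_{n=1}^{e-2}\sum_{m=1}^n(-1)^{n+1}\tbinom nm\tfrac{(B+2m)!(q-2-2n)!(A-2m+2n+2)!}{p!q!r!}g^\alpha_{\omega-1,\,p+2m\varepsilon+(2-\alpha)(2n+2),\,q-2-2n,\,r-2m\varepsilon+(\alpha-1)(2n+2)}.\end{aligned}$$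 $F(z,s,n)$ is: for $z=0$, $F_0+\widetilde F_0$ if $P_1$ and $c_s$ otherwise; for $n=1$ and $z=1,\dots,5$ respectively: $\frac\nu\omega(B+1)(B+2)$; $\frac\nu\omega(q+1)(q+2)$; $-\frac\nu\omega(q+1)(A+1)$; $-\frac\nu\omega(p+1)(r+1)\mathcal H(q-4)$; $\frac\nu\omega(-1)^e\frac{(A+2e+1)!(q-2e+1)}{A!\,q!}$; for $z=6$: $\frac\nu\omega(-1)^e\binom e{n-1}\frac{(A+2n-1)!(B+2e-2n+2)!(1+q-2e)}{p!q!r!}$; for $z=7$: $2\frac\nu\omega(-1)^{e+1}\binom{e-1}{n-1}\frac{(A+2n)!(B+2e-2n)!(1+2q-4e)}{p!q!r!}$; for $z=8$: $2\mathcal H(q-4)\frac\nu\omega(-1)^{e+1}\binom{e-1}{n-1}\frac{(A+2n-1)!(B+2e-2n+1)!(1+2q-4e)}{p!q!r!}$; and $0$ otherwise. *Indices.* Put $s'=(\omega,p+1,q-1,r,1)$, $s''=(\omega,p,q-1,r+1,2)$ and let $\mathcal F(s)=0$ if $p<2$, $q<2$, $r<2$ or $\omega\le0$; else $1$ if $\alpha=0$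 and $q=2$; else $\sigma(s)\omega+8e$ if $\alpha\ne0$; else $\sigma(s')\omega+\sigma(s'')\omega+16E(\frac{q-1}2)+1$. For $s$ and an integer $i$ define two indices $T(s,i)$, $Z(s,i)$ and a number $\Gamma(s,i)$: - if $P_2$ holds: $T=Z=(-1,-1,-1,-1,\alpha)$, $\Gamma=1$; else if $P_3$ holds: $T=s$, $Z=(-1,-1,-1,-1,\alpha)$, $\Gamma=1$; - else if $\alpha\in\{1,2\}$: $Z=(\omega-1-E(\frac i\sigma),V_1,V_0,V_2,\varphi)$ at $(s,d,i')$; if $i<\sigma\omega$ then $T=(E(\frac i\sigma),W_1,W_0,W_2,b(\alpha+a(a-2)(2\alpha-3)))$ at $(s,d,i')$ and $\Gamma=\frac1\omega G(s,d,i')$; if $i\ge\sigma\omega$ then $T=(\omega-1,\xi_z,\Delta_z,\epsilon_z,\kappa_z)$ with $z=z(s,i)$, $n=\mathcal N(s,i)$, and $\Gamma=F(z(s,i),s,\mathcal N(s,i))$; - else ($\alpha=0$): if $i\le\mathcal F(s')$, $T(s,i)=T(s',i)$, $Z(s,i)=Z(s',i)$, $\Gamma(s,i)=-\frac{p+1}q\Gamma(s',i)$;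 otherwise, with $i''=i-\mathcal F(s')-1$, $T(s,i)=T(s'',i'')$, $Z(s,i)=Z(s'',i'')$, $\Gamma(s,i)=-\frac{r+1}q\Gamma(s'',i'')$. *Recursive functions.* $\eta_{h}(s)=0$ if $P_2\vee P_3$; else $1$ if $\alpha=0$ and $q=2$; else $\mathcal F(s)$ if $h=0$; else $\sum_{k=0}^{\mathcal F(s)}(\eta_{h-1}(T(s,k))+1)(\eta_{h-1}(Z(s,k))+1)-1$ (and $\eta_{-1}(s)=0$ for $\omega=0$). Let $\tilde\eta_{1,h}(s,k)=\mathcal F(T(s,k))$ if $h=0$, $\eta_h(T(s,k))$ if $h>0$; $\tilde\eta_{2,h}$ likewise with $Z$; $\mathcal S_h(j,s)=\sum_{k=0}^{j-1}(\tilde\eta_{1,h}(s,k)+1)(\tilde\eta_{2,h}(s,k)+1)$. $\theta(i,s,n,h)$ is $0$ if $P_2\vee P_3$; else $i$ if $h=0$; else, with $j$ the integer such that $\mathcal S_{h-1}(j,s)\le i<\mathcal S_{h-1}(j+1,s)$, it is $j$ for $n=0$, and the quotient ($n=1$) or the remainder ($n=2$) of $i-\mathcal S_{h-1}(j,s)$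 by $\tilde\eta_{2,h-1}(s,j)+1$. For $s=(\omega,p,q,r,\alpha)$, let $Ip_b(0,m)=0$ and $Ip_b(h,m)=Ip\big(E(\frac{m+1-2^{h-1}}{2^{h-1}})\big)$ for $h\ge1$, and define jointly $\Theta(m,i,s,h)=\theta(i,s,Ip_b(h,m),\omega-1)$ if $h=E_2(m)$, and $=\theta\big(\Theta(m,i,s,h+1),\,C(m,h,0,i,s),\,Ip_b(h,m),\,\omega-1+h-E_2(m)\big)$ if $h<E_2(m)$; $C(m,h,l,i,s)=s$ if $E_2(m)-h<1$ or $l>E_2(m)-1-h$, and otherwise $R\big(C(m,h,l+1,i,s),\Theta(E(\frac{m+1-2^{l+1+h}}{2^{l+1+h}}),i,s,0)\big)$, where $R=T$ if $Ip\big(E(\frac{m+1-2^{l+h}}{2^{l+h}})\big)=1$ and $R=Z$ if not. $\rho(i,l,k,j,s)=s$ if $j<2$, and otherwise $R\big(\rho^*,\Theta(E(\frac{k-1+2^{j-1}-2^l}{2^l}),i,s,0)\big)$, where $\rho^*=\rho(i,l+1,k,j,s)$ if $l<j-1$, $\rho^*=s$ if $l\ge j-1$, and $R=T$ if $Ip\big(E(\frac{k-1+2^{j-1}}{2^{l-1}}-1)\big)=1$,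 $R=Z$ if not. $\aleph(i,l,k,s)=R\big(\aleph^*,\Theta(E(\frac{k-1}{2^l})-1+2^{\omega-l},i,s,0)\big)$, where $\aleph^*=\aleph(i,l+1,k,s)$ if $l<\omega$, $\aleph^*=s$ if $l\ge\omega$, and $R=T$ if $Ip\big(E(\frac{k-1}{2^{l-1}})+1\big)=1$, $R=Z$ if not. (For $\omega=0$ the value of $\Theta$ has no influence, and $\mathcal V^\alpha_{0,p,q,r}(c)=c^\alpha_{0,p,q,r}$.) -/

import Mathlib

noncomputable section

namespace NSSeries

/-! ## Power series, their sums and the Navier-Stokes equations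

Directions and components are numbered by `Fin 3` as follows: `1` is `x`, `0` is `y`, `2` is `z`.
A point of space-time is `(t, x, y, z)`. -/

/-- Coefficients `a ω p q r` of a four-variable power series `∑ a ω p q r t^ω x^p y^q z^r`. -/
abbrev Coeffs := ℕ → ℕ → ℕ → ℕ → ℝ

/-- Space-time, with points `(t, x, y, z)`. -/
abbrev SpaceTime := ℝ × ℝ × ℝ × ℝ

/-- The term of index `n = (ω, p, q, r)` of the power series `a` at the point `X`. -/
def term (a : Coeffs) (X : SpaceTime) (n : ℕ × ℕ × ℕ × ℕ) : ℝ :=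
  a n.1 n.2.1 n.2.2.1 n.2.2.2 *
    X.1 ^ n.1 * X.2.1 ^ n.2.1 * X.2.2.1 ^ n.2.2.1 * X.2.2.2 ^ n.2.2.2

/-- The sum of the power series `a`. -/
def series (a : Coeffs) (X : SpaceTime) : ℝ := ∑' n, term a X n

/-- The (open) domain of convergence of the multiple power series `a`. -/
def convDomain (a : Coeffs) : Set SpaceTime := interior {X | Summable (term a X)}

/-- The common domain of convergence of three velocity components and of the pressure. -/
def flowDomain (u : Fin 3 → Coeffs) (P : Coeffs) : Set SpaceTime :=
  (⋂ α, convDomain (u α)) ∩ convDomain P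

/-- The partial derivative in time. -/
def dT (f : SpaceTime → ℝ) (X : SpaceTime) : ℝ :=
  deriv (fun s => f (s, X.2.1, X.2.2.1, X.2.2.2)) X.1

/-- The partial derivative in the space direction `β`. -/
def dS (β : Fin 3) (f : SpaceTime → ℝ) (X : SpaceTime) : ℝ :=
  if β = 1 then deriv (fun s => f (X.1, s, X.2.2.1, X.2.2.2)) X.2.1
  else if β = 0 then deriv (fun s => f (X.1, X.2.1, s, X.2.2.2)) X.2.2.1
  else deriv (fun s => f (X.1, X.2.1, X.2.2.1, s)) X.2.2.2

/-- `(U, P)` is a smooth solution, on the open set `D`, of the incompressible Navier-Stokes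
equations with density `ρ`, dynamic viscosity `μ` and body acceleration `G`. -/
def IsNSSolutionOn (D : Set SpaceTime) (ρ μ : ℝ) (G U : Fin 3 → SpaceTime → ℝ)
    (P : SpaceTime → ℝ) : Prop :=
  (∀ α, ContDiffOn ℝ (⊤ : ℕ∞) (U α) D) ∧ ContDiffOn ℝ (⊤ : ℕ∞) P D ∧
  ∀ X ∈ D, ∑ β, dS β (U β) X = 0 ∧
    ∀ α, ρ * (dT (U α) X + ∑ β, U β X * dS β (U α) X) =
      -dS α P X + μ * ∑ β, dS β (dS β (U α)) X + ρ * G α X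

/-- The power series with coefficients `u`, `P` (and `g` for the body acceleration) have a
non-empty common domain of convergence, and their sums solve the equations there. -/
def IsConvergentSolution (ρ μ : ℝ) (g u : Fin 3 → Coeffs) (P : Coeffs) : Prop :=
  (flowDomain u P ∩ ⋂ α, convDomain (g α)).Nonempty ∧
  IsNSSolutionOn (flowDomain u P ∩ ⋂ α, convDomain (g α)) ρ μ
    (fun α => series (g α)) (fun α => series (u α)) (series P)

/-- Formal partial derivative in time. -/
def fT (a : Coeffs) : Coeffs := fun ω p q r => (ω + 1) * a (ω + 1) p q r

/-- Formal partial derivative in the space direction `β`. -/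
def fS (β : Fin 3) (a : Coeffs) : Coeffs := fun ω p q r =>
  if β = 1 then (p + 1) * a ω (p + 1) q r
  else if β = 0 then (q + 1) * a ω p (q + 1) r
  else (r + 1) * a ω p q (r + 1)

/-- Product of formal power series. -/
def fMul (a b : Coeffs) : Coeffs := fun ω p q r =>
  ∑ k ∈ Finset.range (ω + 1), ∑ i ∈ Finset.range (p + 1),
    ∑ j ∈ Finset.range (q + 1), ∑ l ∈ Finset.range (r + 1),
      a (ω - k) (p - i) (q - j) (r - l) * b k i j l

/-- `(u, P)` solves the incompressible Navier-Stokes equations in the sense of formal power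
series. No convergence is required. -/
def IsFormalSolution (ρ μ : ℝ) (g u : Fin 3 → Coeffs) (P : Coeffs) : Prop :=
  ∀ ω p q r, ∑ β, fS β (u β) ω p q r = 0 ∧
    ∀ α, ρ * (fT (u α) ω p q r + ∑ β, fMul (u β) (fS β (u α)) ω p q r) =
      -fS α P ω p q r + μ * ∑ β, fS β (fS β (u α)) ω p q r + ρ * g α ω p q r

/-- The velocity coefficients `u` and the pressure coefficients `P` have the prescribed initial
values (`ω = 0`) and boundary values (`p ≤ 1`, `q ≤ 1` or `r ≤ 1` for the velocity,
`p = 0` for the pressure). Other values of `c` are not used. -/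
def HasData (c : Fin 3 → Coeffs) (π₀ : ℕ → ℕ → ℕ → ℝ) (u : Fin 3 → Coeffs) (P : Coeffs) : Prop :=
  (∀ α ω p q r, (ω = 0 ∨ p ≤ 1 ∨ q ≤ 1 ∨ r ≤ 1) → u α ω p q r = c α ω p q r) ∧
  ∀ ω q r, P ω 0 q r = π₀ ω q r

/-- The pressure coefficients calculated from the velocity coefficients `u` by the
`x`-momentum relation, and from the boundary values `π₀` for `p = 0`. -/
def pressureFormula (ρ ν : ℝ) (g u : Fin 3 → Coeffs) (π₀ : ℕ → ℕ → ℕ → ℝ) : Coeffs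
  | ω, 0, q, r => π₀ ω q r
  | ω, p + 1, q, r => -ρ * (1 / (p + 1) * (
      (ω + 1) * u 1 (ω + 1) p q r
      + ∑ k ∈ Finset.range (ω + 1), ∑ i ∈ Finset.range (p + 1),
          ∑ j ∈ Finset.range (q + 1), ∑ l ∈ Finset.range (r + 1),
            ((i + 1) * u 1 (ω - k) (p - i) (q - j) (r - l) * u 1 k (i + 1) j l
            + (j + 1) * u 0 (ω - k) (p - i) (q - j) (r - l) * u 1 k i (j + 1) l
            + (l + 1) * u 2 (ω - k) (p - i) (q - j) (r - l) * u 1 k i j (l + 1))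
      - ν * ((p + 1) * (p + 2) * u 1 ω (p + 2) q r
            + (q + 1) * (q + 2) * u 1 ω p (q + 2) r
            + (r + 1) * (r + 2) * u 1 ω p q (r + 2))
      - g 1 ω p q r))

/-! ## The index functions

All indices are integers. The symbol `/` between integers is the floor of the quotient (every
divisor that matters is positive) and `%` is the remainder; `q / 2` is the floor of `q / 2`. -/

/-- An index `(ω, p, q, r)` together with a component number `α`. -/
structure Idx where
  w : ℤ
  p : ℤ
  q : ℤ
  r : ℤ
  a : ℤ

/-- Some index is negative. -/
abbrev P2 (s : Idx) : Prop := s.w < 0 ∨ s.p < 0 ∨ s.q < 0 ∨ s.r < 0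

/-- The index is an initial or a boundary one. -/
abbrev P3 (s : Idx) : Prop :=
  s.w = 0 ∨ (0 ≤ s.p ∧ s.p ≤ 1) ∨ (0 ≤ s.q ∧ s.q ≤ 1) ∨ (0 ≤ s.r ∧ s.r ≤ 1)

/-- All indices are in the bulk. -/
abbrev P1 (s : Idx) : Prop := 0 < s.w ∧ 1 < s.p ∧ 1 < s.q ∧ 1 < s.r

/-- `(-1) ^ n` for an integer `n`. -/
def sg (n : ℤ) : ℤ := if n % 2 = 0 then 1 else -1

/-- `X₁ = p`, `X₂ = r`. -/
def X (s : Idx) (α : ℤ) : ℤ := if α = 1 then s.p else if α = 2 then s.r else s.q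

/-- Heaviside's function, with value `1` at `0`. -/
def heav (x : ℚ) : ℤ := if 0 ≤ x then 1 else 0

/-- Factorial of a (non-negative) integer, as a real number. -/
def fac (n : ℤ) : ℝ := (n.toNat.factorial : ℕ)

/-- Binomial coefficient of (non-negative) integers, as a real number. -/
def bin (n k : ℤ) : ℝ := (n.toNat.choose k.toNat : ℕ)

def Ip (x : ℕ) : ℕ := if x % 2 = 0 then 2 else 1

def Ipb (j k : ℕ) : ℕ := if j = 0 then 0 else Ip ((k + 1 - 2 ^ (j - 1)) / 2 ^ (j - 1))

def xi (z : ℤ) (s : Idx) (n : ℤ) : ℤ :=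
  if z = 0 then -1
  else if z = 1 then s.p + 2 * (s.a - 1)
  else if z = 2 then s.p
  else if z = 3 then s.p + 2 - s.a
  else if z = 4 then s.p + 1
  else if z = 5 then s.p + (2 - s.a) * (2 * (s.q / 2) + 1)
  else if z = 6 then
    s.p + sg (s.a + 1) * (2 * n) + 3 * s.a - 4 + 2 * (s.a - 1) * (s.q / 2)
  else if z = 7 then s.p + sg (s.a + 1) * (2 * n) + 2 * (s.a - 1) * (s.q / 2)
  else s.p + sg (s.a + 1) * (2 * n - 1) + 2 * (s.a - 1) * (s.q / 2)

def Del (z q : ℤ) : ℤ :=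
  if z = 0 then -1
  else if z = 1 then q
  else if z = 2 then q + 2
  else if z = 3 then q + 1
  else if z = 4 then q
  else if z = 5 then q - 2 * (q / 2) + 1
  else if z = 6 then q - 2 * (q / 2) + 1
  else if z = 7 then q - 2 * (q / 2) + 2
  else q - 2 * (q / 2) + 2

def eps (z : ℤ) (s : Idx) (n : ℤ) : ℤ :=
  if z = 0 then -1
  else if z = 1 then s.r + 2 * (2 - s.a)
  else if z = 2 then s.r
  else if z = 3 then s.r + s.a - 1
  else if z = 4 then s.r + 1
  else if z = 5 then s.r + (s.a - 1) * (2 * (s.q / 2) + 1)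
  else if z = 6 then
    s.r + sg s.a * (2 * n) - 3 * s.a + 5 + 2 * (2 - s.a) * (s.q / 2)
  else if z = 7 then s.r + sg s.a * (2 * n) + 2 * (2 - s.a) * (s.q / 2)
  else s.r + sg s.a * (2 * n - 1) + 2 * (2 - s.a) * (s.q / 2)

def kap (z α : ℤ) : ℤ :=
  if z = 0 then -1
  else if z = 1 then α
  else if z = 2 then α
  else if z = 3 then 0
  else if z = 4 then 3 - α
  else if z = 5 then 0
  else if z = 6 then 0
  else if z = 7 then α
  else 3 - α

def s1 (s : Idx) (a n m b : ℤ) : ℤ :=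
  if a = 0 then s.p + (2 - s.a) * (2 * (s.q / 2) + 1 - b - 2 * n)
  else if a = 1 then s.p + sg s.a * (2 * m - b) + (2 - s.a) * (2 * n + 1 - b)
  else s.p + 2 * sg s.a * m + (2 - s.a) * (2 * n + 3 - b)

def s2 (q a n b : ℤ) : ℤ :=
  if a = 0 then q - (2 * (q / 2) + 1 - b - 2 * n)
  else if a = 1 then q - 1 - 2 * n + b
  else q - 2 * n - 3 + b

def s3 (s : Idx) (a n m b : ℤ) : ℤ :=
  if a = 0 then s.r + (s.a - 1) * (2 * (s.q / 2) + 1 - b - 2 * n)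
  else if a = 1 then s.r + sg (s.a + 1) * (2 * m - b) + (s.a - 1) * (2 * n + 1 - b)
  else s.r + 2 * sg (s.a + 1) * m + (s.a - 1) * (2 * n + 3 - b)

/-- `(3/2) e² - (3/2) e + 1` with `e = ⌊q/2⌋` (an integer). -/
def blk (q : ℤ) : ℤ := (3 * (q / 2) ^ 2 - 3 * (q / 2)) / 2 + 1

def bB (d q : ℤ) : ℤ := (1 + d / blk q) / 4

def aA (d q : ℤ) : ℤ :=
  if d % blk q < (q / 2) * (q / 2 + 1) / 2 then 0
  else if d % blk q < (q / 2) ^ 2 then 1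
  else 2

def phi (d q : ℤ) : ℤ := d / blk q - 3 * ((1 + d / blk q) / 4)

def gam (d q : ℤ) : ℤ :=
  d + 1 - blk q * (d / blk q)
    - (aA d q * (q / 2) ^ 2 + aA d q * (2 - aA d q) * (q / 2)) / 2

/-- `⌊(1 + √(8γ - 7)) / 2⌋` (replacing the root by its integer part does not change the value). -/
def nN (d q : ℤ) : ℤ := (1 + ((8 * gam d q - 7).toNat.sqrt : ℤ)) / 2

def mM (d q : ℤ) : ℤ := gam d q - ((nN d q - 1) ^ 2 + nN d q - 1) / 2

/-- `s₁`, `s₂`, `s₃` as functions of the block number `d`. -/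
def S1 (s : Idx) (d : ℤ) : ℤ := s1 s (aA d s.q) (nN d s.q) (mM d s.q) (bB d s.q)
def S2 (s : Idx) (d : ℤ) : ℤ := s2 s.q (aA d s.q) (nN d s.q) (bB d s.q)
def S3 (s : Idx) (d : ℤ) : ℤ := s3 s (aA d s.q) (nN d s.q) (mM d s.q) (bB d s.q)

def SS (s : Idx) (d : ℤ) : ℤ := (S1 s d + 1) * (S2 s d + 1) * (S3 s d + 1)

def y0 (q a n b : ℤ) : ℤ :=
  if a = 0 then b - 1 + q - 2 * (q / 2) + 2 * n
  else if a = 1 then b - 1 + q - 2 * n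
  else b + q - 2 * n - 3

def y1 (s : Idx) (a n m b : ℤ) : ℤ :=
  if a = 0 then s.p + (2 - s.a) * (1 - b) + (2 - s.a) * (2 * (s.q / 2) - 2 * n)
  else if a = 1 then
    s.p + (s.a - 1) * (1 - b) + sg s.a * (2 * m - 1) + 2 * n * (2 - s.a)
  else s.p + (2 - s.a) * (1 - b) + sg s.a * (2 * m) + (2 * n + 2) * (2 - s.a)

def y2 (s : Idx) (a n m b : ℤ) : ℤ :=
  if a = 0 then s.r + (s.a - 1) * (1 - b) + (s.a - 1) * (2 * (s.q / 2) - 2 * n)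
  else if a = 1 then
    s.r + (2 - s.a) * (1 - b) + sg (s.a + 1) * (2 * m - 1) + 2 * n * (s.a - 1)
  else s.r + (s.a - 1) * (1 - b) + sg (s.a + 1) * (2 * m) + (2 * n + 2) * (s.a - 1)

/-- `Y₀`, `Y₁`, `Y₂` as functions of the block number `d`. -/
def Y0 (s : Idx) (d : ℤ) : ℤ := y0 s.q (aA d s.q) (nN d s.q) (bB d s.q)
def Y1 (s : Idx) (d : ℤ) : ℤ := y1 s (aA d s.q) (nN d s.q) (mM d s.q) (bB d s.q)
def Y2 (s : Idx) (d : ℤ) : ℤ := y2 s (aA d s.q) (nN d s.q) (mM d s.q) (bB d s.q)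

def hH (q a n m b : ℤ) : ℝ :=
  if a = 0 then (if n = m then (sg (n + b + q / 2) : ℝ) else 0)
  else (sg (n + b + a * (a - 1) / 2 + (a - 1) * (a - 2) / 2 * (q / 2)) : ℝ)
    * fac (n - 2 + a) / (fac (m - 2 + a) * fac (n - m))

def L0 (s : Idx) (d i : ℤ) : ℤ := (i - 1) / (S3 s d + 1)

def L1 (s : Idx) (d i : ℤ) : ℤ := (i - 1) / ((S3 s d + 1) * (S2 s d + 1))

/-- The three Kronecker symbols of `φ = 0`, `φ = 1`, `φ = 2`. -/
def e0 (φ : ℤ) : ℤ := (φ - 1) * (φ - 2) / 2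
def e1 (φ : ℤ) : ℤ := φ * (2 - φ)
def e2 (φ : ℤ) : ℤ := φ * (φ - 1) / 2

def gG (s : Idx) (d i : ℤ) : ℝ :=
  hH s.q (aA d s.q) (nN d s.q) (mM d s.q) (bB d s.q)
  * ((e0 (phi d s.q) * (L0 s d i - (S2 s d + 1) * L1 s d i)
      + e1 (phi d s.q) * L1 s d i
      + e2 (phi d s.q) * ((i - 1) % (S3 s d + 1)) + 1 : ℤ) : ℝ)
  * (fac (Y0 s d) * fac (Y1 s d) * fac (Y2 s d) / (fac s.p * fac s.q * fac s.r))

def W0 (s : Idx) (d i : ℤ) : ℤ := e0 (phi d s.q) + L0 s d i - (S2 s d + 1) * L1 s d i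
def W1 (s : Idx) (d i : ℤ) : ℤ := e1 (phi d s.q) + L1 s d i
def W2 (s : Idx) (d i : ℤ) : ℤ := e2 (phi d s.q) + (i - 1) % (S3 s d + 1)

def V0 (s : Idx) (d i : ℤ) : ℤ := Y0 s d - L0 s d i + (S2 s d + 1) * L1 s d i
def V1 (s : Idx) (d i : ℤ) : ℤ := Y1 s d - L1 s d i
def V2 (s : Idx) (d i : ℤ) : ℤ := Y2 s d - (i - 1) % (S3 s d + 1)

/-- The number `9e² - 9e + 6` of blocks, `e = ⌊q/2⌋`. -/
def nb (q : ℤ) : ℤ := 9 * (q / 2) ^ 2 - 9 * (q / 2) + 6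

def dD (s : Idx) (τ : ℤ) : ℤ :=
  ∑ j ∈ Finset.Icc 1 (nb s.q),
    heav (((τ - 1 : ℤ) : ℚ) / ((∑ k ∈ Finset.Icc 0 (j - 1), SS s k : ℤ) : ℚ) - 1)

def iI (s : Idx) (τ : ℤ) : ℤ :=
  τ - ∑ j ∈ Finset.Icc 1 (nb s.q), SS s (j - 1) *
    heav (((τ - 1 : ℤ) : ℚ) / ((∑ k ∈ Finset.Icc 0 (j - 1), SS s k : ℤ) : ℚ) - 1)

/-- The polynomial `σ` (`A` and `B` are `X_α` and `X_{3-α}`); its values are integers. -/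
def sigmaPoly (e q A B : ℚ) : ℚ :=
  (2 * e ^ 4 + (4 * A + 6 * B + 8) * e ^ 3 + (9 * A * B + 3 / 2 * A + 3 * B - 8) * e ^ 2
    - (9 * B * A + 11 / 2 * A + 9 * B + 2) * e + 6 * A * B + 6 * A + 9 * B + 9) * q
  - 16 / 5 * e ^ 5 - (6 * A + 8 * B + 8) * e ^ 4
  + (6 * B + 6 * A - 10 * B * A + 24) * e ^ 3
  + (14 * B + 9 * A + 45 / 2 * A * B - 7) * e ^ 2
  - (9 * A + 12 * B + 25 / 2 * A * B - 11 / 5) * e + 3 * (B + 1) * (A + 1) - 8 * e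

def sigma (s : Idx) : ℤ :=
  ⌊sigmaPoly ((s.q / 2 : ℤ) : ℚ) (s.q : ℚ) (X s s.a : ℚ) (X s (3 - s.a) : ℚ)⌋

def tau (s : Idx) (j : ℤ) : ℤ := j + 1 - sigma s * (j / sigma s)

def chi (s : Idx) (i : ℤ) : ℤ := i - sigma s * s.w

/-- `z = χ - 8 E₊((χ - 1) / 8)`, where `E₊` is the floor, replaced by `0` if negative. -/
def zz (s : Idx) (i : ℤ) : ℤ := chi s i - 8 * max 0 ((chi s i - 1) / 8)

def nn (s : Idx) (i : ℤ) : ℤ := (chi s i - 1) / 8 + 1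

/-- The indices that occur for `α = 0` on the way to the components `1` and `2`. -/
def toX (s : Idx) : Idx := ⟨s.w, s.p + 1, s.q - 1, s.r, 1⟩
def toZ (s : Idx) : Idx := ⟨s.w, s.p, s.q - 1, s.r + 1, 2⟩

def fF (s : Idx) : ℤ :=
  if s.p < 2 ∨ s.q < 2 ∨ s.r < 2 ∨ s.w ≤ 0 then 0
  else if s.a = 0 ∧ s.q = 2 then 1
  else if s.a ≠ 0 then sigma s * s.w + 8 * (s.q / 2)
  else sigma (toX s) * s.w + sigma (toZ s) * s.w + 16 * ((s.q - 1) / 2) + 1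

/-- The first child `(𝓔, T₁, T₀, T₂, β)` of an index, for `α = 1, 2`. -/
def childT12 (s : Idx) (i : ℤ) : Idx :=
  if P2 s then ⟨-1, -1, -1, -1, s.a⟩
  else if P3 s then s
  else if i < sigma s * s.w then
    let d := dD s (tau s i)
    let i' := iI s (tau s i)
    ⟨i / sigma s, W1 s d i', W0 s d i', W2 s d i',
      bB d s.q * (s.a + aA d s.q * (aA d s.q - 2) * (2 * s.a - 3))⟩
  else
    ⟨s.w - 1, xi (zz s i) s (nn s i), Del (zz s i) s.q, eps (zz s i) s (nn s i),
      kap (zz s i) s.a⟩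

/-- The first child `(𝓔, T₁, T₀, T₂, β)` of an index. -/
def childT (s : Idx) (i : ℤ) : Idx :=
  if P2 s ∨ P3 s ∨ s.a = 1 ∨ s.a = 2 then childT12 s i
  else if i ≤ fF (toX s) then childT12 (toX s) i
  else childT12 (toZ s) (i - fF (toX s) - 1)

/-- The second child `(Υ, Z₁, Z₀, Z₂, Φ)` of an index, for `α = 1, 2`. -/
def childZ12 (s : Idx) (i : ℤ) : Idx :=
  if P2 s ∨ P3 s then ⟨-1, -1, -1, -1, s.a⟩
  else
    let d := dD s (tau s i)
    let i' := iI s (tau s i)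
    ⟨s.w - 1 - i / sigma s, V1 s d i', V0 s d i', V2 s d i', phi d s.q⟩

/-- The second child `(Υ, Z₁, Z₀, Z₂, Φ)` of an index. -/
def childZ (s : Idx) (i : ℤ) : Idx :=
  if P2 s ∨ P3 s ∨ s.a = 1 ∨ s.a = 2 then childZ12 s i
  else if i ≤ fF (toX s) then childZ12 (toX s) i
  else childZ12 (toZ s) (i - fF (toX s) - 1)

def eta : ℕ → Idx → ℤ
  | 0, s => if P2 s ∨ P3 s then 0 else if s.a = 0 ∧ s.q = 2 then 1 else fF s
  | ind + 1, s =>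
    if P2 s ∨ P3 s then 0 else if s.a = 0 ∧ s.q = 2 then 1
    else ∑ k ∈ Finset.Icc 0 (fF s),
      (eta ind (childT s k) + 1) * (eta ind (childZ s k) + 1) - 1

def eta1 (ind : ℕ) (s : Idx) (k : ℤ) : ℤ :=
  if ind = 0 then fF (childT s k) else eta ind (childT s k)

def eta2 (ind : ℕ) (s : Idx) (k : ℤ) : ℤ :=
  if ind = 0 then fF (childZ s k) else eta ind (childZ s k)

def Seta (j : ℤ) (s : Idx) (ind : ℕ) : ℤ :=
  ∑ k ∈ Finset.Ico 0 j, (eta1 ind s k + 1) * (eta2 ind s k + 1)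

/-- The `j` in `{0, …, 𝓕}` with `Seta j ≤ i < Seta (j + 1)`: there is exactly one for
`0 ≤ i < Seta (𝓕 + 1)`, so that the sum has one term. -/
def theta0 (i : ℤ) (s : Idx) (ind : ℕ) : ℤ :=
  ∑ j ∈ (Finset.Icc 0 (fF s)).filter (fun j => Seta j s ind ≤ i ∧ i < Seta (j + 1) s ind), j

def theta (i : ℤ) (s : Idx) (n ind : ℕ) : ℤ :=
  if P2 s ∨ P3 s then 0
  else if ind = 0 then i
  else
    let j := theta0 i s (ind - 1)
    if n = 0 then j
    else if n = 1 then (i - Seta j s (ind - 1)) / (eta2 (ind - 1) s j + 1)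
    else (i - Seta j s (ind - 1)) % (eta2 (ind - 1) s j + 1)

mutual

/-- The functions `C_ω, C₁, C₀, C₂, C_α` together; `Nat.log 2 (m + 1)` is the floor of the
binary logarithm of `m + 1`. -/
def cC (m h l : ℕ) (i : ℤ) (s : Idx) : Idx :=
  if Nat.log 2 (m + 1) < l + 1 + h then s
  else if Ip ((m + 1 - 2 ^ (l + h)) / 2 ^ (l + h)) = 1 then
    childT (cC m h (l + 1) i s)
      (Theta ((m + 1 - 2 ^ (l + 1 + h)) / 2 ^ (l + 1 + h)) i s 0)
  else
    childZ (cC m h (l + 1) i s)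
      (Theta ((m + 1 - 2 ^ (l + 1 + h)) / 2 ^ (l + 1 + h)) i s 0)
termination_by (m, 0, Nat.log 2 (m + 1) - l)
decreasing_by
  all_goals first
    | (apply Prod.Lex.right; apply Prod.Lex.right; omega)
    | (apply Prod.Lex.left
       have h1 : 1 ≤ Nat.log 2 (m + 1) := by omega
       have h2 : m ≠ 0 := by rintro rfl; simp at h1
       have h3 : 2 ≤ 2 ^ (l + 1 + h) := by
         calc 2 = 2 ^ 1 := by norm_num
           _ ≤ 2 ^ (l + 1 + h) := Nat.pow_le_pow_right (by norm_num) (by omega)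
       have h4 := Nat.div_le_self (m + 1 - 2 ^ (l + 1 + h)) (2 ^ (l + 1 + h))
       omega)

def Theta (m : ℕ) (i : ℤ) (s : Idx) (h : ℕ) : ℤ :=
  if Nat.log 2 (m + 1) ≤ h then theta i s (Ipb h m) (s.w.toNat - 1)
  else theta (Theta m i s (h + 1)) (cC m h 0 i s) (Ipb h m)
    (s.w.toNat - 1 + h - Nat.log 2 (m + 1))
termination_by (m, 1, Nat.log 2 (m + 1) - h)
decreasing_by
  all_goals first
    | (apply Prod.Lex.right; apply Prod.Lex.right; omega)
    | (apply Prod.Lex.right; apply Prod.Lex.left; omega)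

end

/-- The functions `ρ_ω, ρ₁, ρ₀, ρ₂, ρ_α` together. -/
def rho (i : ℤ) (l k j : ℕ) (s : Idx) : Idx :=
  if j < 2 then s
  else
    let t := if l < j - 1 then rho i (l + 1) k j s else s
    let n := Theta ((k - 1 + 2 ^ (j - 1) - 2 ^ l) / 2 ^ l) i s 0
    if Ip ((k - 1 + 2 ^ (j - 1)) / 2 ^ (l - 1) - 1) = 1 then childT t n else childZ t n
termination_by j - l

/-- The functions `ℵ_ω, ℵ₁, ℵ₀, ℵ₂, ℵ_α` together. -/
def aleph (i : ℤ) (l k : ℕ) (s : Idx) : Idx :=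
  let t := if l < s.w.toNat then aleph i (l + 1) k s else s
  let n := Theta ((k - 1) / 2 ^ l + 2 ^ (s.w.toNat - l) - 1) i s 0
  if Ip ((k - 1) / 2 ^ (l - 1) + 1) = 1 then childT t n else childZ t n
termination_by s.w.toNat - l

/-! ## The coefficients -/

/-- The component of number `α`. -/
def comp (α : ℤ) : Fin 3 := if α = 1 then 1 else if α = 2 then 2 else 0

/-- A velocity coefficient, with the convention that it is `1` if some index is negative. -/
def uZ (c : Fin 3 → Coeffs) (s : Idx) : ℝ :=
  if P2 s then 1 else c (comp s.a) s.w.toNat s.p.toNat s.q.toNat s.r.toNat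

/-- A coefficient of the body acceleration. -/
def gZ (g : Fin 3 → Coeffs) (s : Idx) : ℝ :=
  g (comp s.a) s.w.toNat s.p.toNat s.q.toNat s.r.toNat

def bigF0 (c : Fin 3 → Coeffs) (s : Idx) : ℝ :=
  let e := s.q / 2
  let A := X s s.a
  let B := X s (3 - s.a)
  ∑ n ∈ Finset.Icc 1 e, (sg e : ℝ) * bin (e - 1) (n - 1) *
    (fac (A + 2 * n) * fac (B + 2 * e - 2 * n) / (fac s.p * fac s.q * fac s.r)
      * uZ c ⟨s.w, s.p + sg (s.a + 1) * (2 * n) + (s.a - 1) * (2 * e), s.q - 2 * e,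
          s.r + sg s.a * (2 * n) + 2 * (2 - s.a) * e, s.a⟩
    + fac (A + 2 * n - 1) * fac (B + 2 * e - 2 * n + 1) / (fac s.p * fac s.q * fac s.r)
      * uZ c ⟨s.w, s.p + sg (s.a + 1) * (2 * n - 1) + (s.a - 1) * (2 * e), s.q - 2 * e,
          s.r + sg s.a * (2 * n - 1) + 2 * (2 - s.a) * e, 3 - s.a⟩)

def bigF0t (g : Fin 3 → Coeffs) (s : Idx) : ℝ :=
  let e := s.q / 2
  let A := X s s.a
  let B := X s (3 - s.a)
  1 / (s.w : ℝ) * ∑ n ∈ Finset.Icc 1 e, (sg (n + 1) : ℝ) *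
    (fac (s.q - 2 * n + 2) * fac (A + 2 * n - 2) / (fac A * fac s.q)
      * gZ g ⟨s.w - 1, s.p + (2 - s.a) * (2 * n - 2), s.q - 2 * n + 2,
          s.r + (s.a - 1) * (2 * n - 2), s.a⟩
    - fac (s.q - 2 * n + 1) * fac (A + 2 * n - 1) / (fac A * fac s.q)
      * gZ g ⟨s.w - 1, s.p + (2 - s.a) * (2 * n - 1), s.q - 2 * n + 1,
          s.r + (s.a - 1) * (2 * n - 1), 0⟩)
  + 1 / (s.w : ℝ) * ∑ n ∈ Finset.Icc 1 (e - 1), ∑ m ∈ Finset.Icc 1 n, (sg n : ℝ) *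
    (bin (n - 1) (m - 1)
      * (fac (B + 2 * m - 1) * fac (s.q - 2 * n) * fac (A - 2 * m + 2 * n + 1)
        / (fac s.p * fac s.q * fac s.r))
      * gZ g ⟨s.w - 1, s.p + sg s.a * (2 * m - 1) + 2 * n * (2 - s.a), s.q - 2 * n,
          s.r + sg (s.a + 1) * (2 * m - 1) + 2 * (s.a - 1) * n, 3 - s.a⟩
    - bin n m
      * (fac (B + 2 * m) * fac (s.q - 1 - 2 * n) * fac (A - 2 * m + 2 * n + 1)
        / (fac s.p * fac s.q * fac s.r))
      * gZ g ⟨s.w - 1, s.p + 2 * m * sg s.a + (2 - s.a) * (2 * n + 1), s.q - 1 - 2 * n,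
          s.r + 2 * m * sg (s.a + 1) + (s.a - 1) * (2 * n + 1), 0⟩)
  + 1 / (s.w : ℝ) * ∑ n ∈ Finset.Icc 1 (e - 2), ∑ m ∈ Finset.Icc 1 n, (sg (n + 1) : ℝ) *
    (bin n m
      * (fac (B + 2 * m) * fac (s.q - 2 - 2 * n) * fac (A - 2 * m + 2 * n + 2)
        / (fac s.p * fac s.q * fac s.r))
      * gZ g ⟨s.w - 1, s.p + 2 * m * sg s.a + (2 - s.a) * (2 * n + 2), s.q - 2 - 2 * n,
          s.r + 2 * m * sg (s.a + 1) + (s.a - 1) * (2 * n + 2), s.a⟩)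

def bigF (ν : ℝ) (g c : Fin 3 → Coeffs) (z : ℤ) (s : Idx) (n : ℤ) : ℝ :=
  let e := s.q / 2
  let A := X s s.a
  let B := X s (3 - s.a)
  let w : ℝ := s.w
  if z = 0 then (if P1 s then bigF0 c s + bigF0t g s else uZ c s)
  else if z = 1 ∧ n = 1 then ν / w * (B + 1) * (B + 2)
  else if z = 2 ∧ n = 1 then ν / w * (s.q + 1) * (s.q + 2)
  else if z = 3 ∧ n = 1 then -(ν / w) * (s.q + 1) * (A + 1)
  else if z = 4 ∧ n = 1 then -(ν / w) * (s.p + 1) * (s.r + 1) * heav (s.q - 4)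
  else if z = 5 ∧ n = 1 then
    ν / w * sg e * (fac (A + 2 * e + 1) * (s.q - 2 * e + 1) / (fac A * fac s.q))
  else if z = 6 then
    ν / w * sg e * bin e (n - 1) * (fac (A + 2 * n - 1) * fac (B + 2 * e - 2 * n + 2)
      * (1 + s.q - 2 * e) / (fac s.p * fac s.q * fac s.r))
  else if z = 7 then
    2 * (ν / w) * sg (e + 1) * bin (e - 1) (n - 1) * (fac (A + 2 * n) * fac (B + 2 * e - 2 * n)
      * (1 + 2 * s.q - 4 * e) / (fac s.p * fac s.q * fac s.r))
  else if z = 8 then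
    2 * heav (s.q - 4) * (ν / w) * sg (e + 1) * bin (e - 1) (n - 1)
      * (fac (A + 2 * n - 1) * fac (B + 2 * e - 2 * n + 1)
      * (1 + 2 * s.q - 4 * e) / (fac s.p * fac s.q * fac s.r))
  else 0

/-- `Γ` for `α = 1, 2`. -/
def Gam12 (ν : ℝ) (g c : Fin 3 → Coeffs) (s : Idx) (i : ℤ) : ℝ :=
  if P2 s ∨ P3 s then 1
  else if i < sigma s * s.w then 1 / (s.w : ℝ) * gG s (dD s (tau s i)) (iI s (tau s i))
  else bigF ν g c (zz s i) s (nn s i)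

def Gam (ν : ℝ) (g c : Fin 3 → Coeffs) (s : Idx) (i : ℤ) : ℝ :=
  if P2 s ∨ P3 s ∨ s.a = 1 ∨ s.a = 2 then Gam12 ν g c s i
  else if i ≤ fF (toX s) then -((s.p + 1) / (s.q : ℝ)) * Gam12 ν g c (toX s) i
  else -((s.r + 1) / (s.q : ℝ)) * Gam12 ν g c (toZ s) (i - fF (toX s) - 1)

/-- The explicit expression of the velocity coefficient of index `(α, ω, p, q, r)` in terms of
the coefficients `c` (of which it uses initial and boundary ones only), of the body acceleration
`g` and of the kinematic viscosity `ν`. -/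
def velocityFormula (ν : ℝ) (g c : Fin 3 → Coeffs) : Fin 3 → Coeffs :=
  fun α ω p q r =>
    let s : Idx := ⟨ω, p, q, r, (α : ℕ)⟩
    ∑ i ∈ Finset.Icc 0 (eta (ω - 1) s),
      (∏ j ∈ Finset.Icc 1 ω, ∏ k ∈ Finset.Icc 1 (2 ^ (j - 1)),
        Gam ν g c (rho i 1 k j s) (Theta (k + 2 ^ (j - 1) - 2) i s 0))
      * ∏ k ∈ Finset.Icc 1 (2 ^ ω), uZ c (aleph i 1 k s)

end NSSeries

end

open NSSeries

/-!
The theorem is a statement about formal power series: on its domain of convergence a power series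
is differentiated term by term and two of them are multiplied by the Cauchy product, and its
coefficients are determined by its sum near `0`, a point of every nonempty domain of convergence.
Hence a convergent solution is a formal one (`RepOn.unique`,
`IsConvergentSolution.isFormalSolution`), and a formal solution solves the equations wherever the
series involved converge (`IsFormalSolution.isNSSolutionOn`). In the latter the body acceleration
needs no assumption of its own: by the momentum equation its coefficients are those of derivatives
and products of the velocity and the pressure.

*One step of the recurrence.* After multiplication of the coefficients by `p! q! r!` spatial
derivatives become shifts of the index. The momentum equation then says that the solenoidal field
`V = ∂ₜU` differs by a gradient from `R = -U·∇U + ν∇²U + g`. For such a field, a component `V¹` or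
`V²` satisfies `∇²V = ∇²R - ∇(∇·R)`, so that two derivatives in the middle direction can be traded
for derivatives in the two other directions. After `E(q/2)` such trades the middle index is `0` or
`1` and the coefficient is a datum, while all other terms are sources with time index one less
(`solenoidal_eq_source`). For the viscous part of `R`, which is itself solenoidal, the sources
telescope (`source_laplacian`). The rest is bookkeeping: the convective sources come in blocks
whose number encodes the parameters `b`, `φ`, `a`, `n`, `m` (`sum_blocks`), the polynomial `σ` is
the total number of terms of these blocks (`sigma_eq_sum`), the blocks add up to the convective
sources (`sum_convective_eq_blocks`, `sum_convBlock`), and the groups of eight terms to the viscous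
ones (`sum_viscTerm`). The outcome is `u_s = ∑ᵢ Γ(s,i) u_{T(s,i)} u_{Z(s,i)}`
(`IsFormalSolution.sum_eq`); for the middle component `U⁰` it follows from those for `U¹` and `U²`
through the divergence relation (`IsFormalSolution.expand_zero`).

*Iteration.* `T` and `Z` lead to data, or to indices with a smaller time index. After `ω` steps
only data are left, and multiplying out expresses `u_s` as a sum over binary trees of depth `ω`
with a choice of a summand `i` at each inner node. The function `η` counts these trees and `θ`
recovers the choice at the root and the numbers of the two subtrees (`sum_treeTerm`). With the
nodes numbered as in a heap, the children of `M` being `2M` and `2M + 1`, the functions `Θ`, `ρ`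
and `ℵ` give the choice at a node, the index of an inner node and the index of a leaf
(`treeTerm_eq_prod`, `velocityFormula_eq`). So the velocity coefficients of a solution are those of
the formula, and the pressure is read off the momentum equation in the direction `x`
(`IsFormalSolution.pressure_eq`). In particular the series with the coefficients of the formula are
the given solution, which yields the second part.
-/

noncomputable section

namespace NSSeries

/-! ### Sums over integer intervals -/

theorem Ico_succ_eq_insert {N : ℤ} (hN : 0 ≤ N) :
    Finset.Ico 0 (N + 1) = insert N (Finset.Ico 0 N) := by
  ext x; simp only [Finset.mem_Ico, Finset.mem_insert]; omega

theorem sum_Ico_succ {M : Type*} [AddCommMonoid M] (F : ℤ → M) {N : ℤ} (hN : 0 ≤ N) :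
    ∑ k ∈ Finset.Ico 0 (N + 1), F k = ∑ k ∈ Finset.Ico 0 N, F k + F N := by
  rw [Ico_succ_eq_insert hN, Finset.sum_insert (by simp), add_comm]

theorem sum_Ico_add {M : Type*} [AddCommMonoid M] (F : ℤ → M) {a b : ℤ} (ha : 0 ≤ a)
    (hb : 0 ≤ b) : ∑ k ∈ Finset.Ico 0 (a + b), F k =
      ∑ k ∈ Finset.Ico 0 a, F k + ∑ k ∈ Finset.Ico 0 b, F (a + k) := by
  induction b, hb using Int.leInduction with
  | base => simp
  | succ n hn ih =>
    rw [← add_assoc, sum_Ico_succ _ (by omega), ih, sum_Ico_succ _ hn, add_assoc]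

theorem sum_Ico_nonneg {S : ℤ → ℤ} {d : ℤ} (hS : ∀ k, 0 ≤ k → k < d → 0 ≤ S k) :
    0 ≤ ∑ k ∈ Finset.Ico 0 d, S k :=
  Finset.sum_nonneg fun k hk => hS k (Finset.mem_Ico.1 hk).1 (Finset.mem_Ico.1 hk).2

/-- An interval cut into consecutive blocks of lengths `S 0, S 1, …`. -/
theorem sum_Ico_blocks {M : Type*} [AddCommMonoid M] (S : ℤ → ℤ) (F : ℤ → M) {N : ℤ}
    (hN : 0 ≤ N) (hS : ∀ k, 0 ≤ k → k < N → 0 ≤ S k) :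
    ∑ i ∈ Finset.Ico 0 (∑ k ∈ Finset.Ico 0 N, S k), F i =
      ∑ d ∈ Finset.Ico 0 N, ∑ t ∈ Finset.Ico 0 (S d), F ((∑ k ∈ Finset.Ico 0 d, S k) + t) := by
  induction N, hN using Int.leInduction with
  | base => simp
  | succ n hn ih =>
    have h1 : ∀ k, 0 ≤ k → k < n → 0 ≤ S k := fun k h h' => hS k h (by omega)
    rw [sum_Ico_succ _ hn, sum_Ico_add _ (sum_Ico_nonneg h1) (hS n hn (by omega)), ih h1,
      sum_Ico_succ _ hn]

theorem sum_Ico_mul {M : Type*} [AddCommMonoid M] (F : ℤ → M) {N b : ℤ}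
    (hN : 0 ≤ N) (hb : 0 ≤ b) :
    ∑ i ∈ Finset.Ico 0 (N * b), F i =
      ∑ d ∈ Finset.Ico 0 N, ∑ t ∈ Finset.Ico 0 b, F (d * b + t) := by
  have key : ∀ d : ℤ, 0 ≤ d → ∑ _k ∈ Finset.Ico 0 d, b = d * b := by
    intro d hd
    simp [Int.toNat_of_nonneg hd]
  have h := sum_Ico_blocks (fun _ => b) F hN (fun _ _ _ => hb)
  rw [key N hN] at h
  rw [h]
  refine Finset.sum_congr rfl fun d hd => ?_
  rw [key d (Finset.mem_Ico.1 hd).1]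

theorem sum_Ico_le_of_lt {S : ℤ → ℤ} {N j d : ℤ} (hS : ∀ k, 0 ≤ k → k < N → 0 ≤ S k)
    (hjd : j ≤ d) (hd : d ≤ N) :
    ∑ k ∈ Finset.Ico 0 j, S k ≤ ∑ k ∈ Finset.Ico 0 d, S k := by
  refine Finset.sum_le_sum_of_subset_of_nonneg ?_ ?_
  · intro x hx; simp only [Finset.mem_Ico] at *; omega
  · intro x hx _; simp only [Finset.mem_Ico] at hx; exact hS x hx.1 (by omega)

theorem Icc_zero_eq_Ico (n : ℤ) : Finset.Icc 0 n = Finset.Ico 0 (n + 1) := by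
  ext x; simp only [Finset.mem_Icc, Finset.mem_Ico]; omega

/-! ### The tree of products -/

/-- An index whose coefficient is a datum, or a formal index standing for the number `1`. -/
abbrev IsLeaf (s : Idx) : Prop := P2 s ∨ P3 s

theorem fF_of_isLeaf {s : Idx} (h : IsLeaf s) : fF s = 0 := by
  unfold fF
  rw [if_pos]
  rcases h with h | h <;> omega

theorem eta_of_isLeaf {s : Idx} (h : IsLeaf s) (n : ℕ) : eta n s = 0 := by
  cases n <;> simp only [eta] <;> rw [if_pos h]

theorem eta_zero_eq (s : Idx) : eta 0 s = fF s := by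
  by_cases h : IsLeaf s
  · rw [fF_of_isLeaf h, eta_of_isLeaf h]
  · simp only [eta]
    rw [if_neg h]
    split_ifs with h2
    · unfold fF
      rw [if_neg (by simp only [IsLeaf, not_or] at h; omega), if_pos h2]
    · rfl

theorem eta1_eq (n : ℕ) (s : Idx) (k : ℤ) : eta1 n s k = eta n (childT s k) := by
  unfold eta1
  split_ifs with h
  · rw [h, eta_zero_eq]
  · rfl

theorem eta2_eq (n : ℕ) (s : Idx) (k : ℤ) : eta2 n s k = eta n (childZ s k) := by
  unfold eta2
  split_ifs with h
  · rw [h, eta_zero_eq]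
  · rfl

theorem childT_of_isLeaf {s : Idx} (h : IsLeaf s) (i : ℤ) :
    childT s i = if P2 s then ⟨-1, -1, -1, -1, s.a⟩ else s := by
  unfold childT childT12
  rw [if_pos (by tauto)]
  by_cases h1 : P2 s
  · rw [if_pos h1, if_pos h1]
  · rw [if_neg h1, if_neg h1, if_pos (h.resolve_left h1)]

theorem childZ_of_isLeaf {s : Idx} (h : IsLeaf s) (i : ℤ) :
    childZ s i = ⟨-1, -1, -1, -1, s.a⟩ := by
  unfold childZ childZ12
  rw [if_pos (by tauto), if_pos h]

theorem isLeaf_neg (a : ℤ) : IsLeaf ⟨-1, -1, -1, -1, a⟩ :=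
  Or.inl (Or.inl (neg_one_lt_zero (R := ℤ)))

theorem isLeaf_childT {s : Idx} (h : IsLeaf s) (i : ℤ) : IsLeaf (childT s i) := by
  rw [childT_of_isLeaf h]
  split_ifs
  · exact isLeaf_neg _
  · exact h

theorem isLeaf_childZ {s : Idx} (h : IsLeaf s) (i : ℤ) : IsLeaf (childZ s i) := by
  rw [childZ_of_isLeaf h]
  exact isLeaf_neg _

theorem uZ_of_P2 (c : Fin 3 → Coeffs) {s : Idx} (h : P2 s) : uZ c s = 1 := if_pos h

theorem uZ_mul_of_isLeaf (c : Fin 3 → Coeffs) {s : Idx} (h : IsLeaf s) (i k : ℤ) :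
    uZ c (childT s i) * uZ c (childZ s k) = uZ c s := by
  rw [childT_of_isLeaf h, childZ_of_isLeaf h, uZ_of_P2 c (s := ⟨-1, -1, -1, -1, s.a⟩)
    (Or.inl neg_one_lt_zero)]
  split_ifs with h2
  · rw [uZ_of_P2 c h2, uZ_of_P2 c (Or.inl neg_one_lt_zero), mul_one]
  · rw [mul_one]

theorem Gam_of_isLeaf (ν : ℝ) (g c : Fin 3 → Coeffs) {s : Idx} (h : IsLeaf s) (i : ℤ) :
    Gam ν g c s i = 1 := by
  unfold Gam Gam12
  rw [if_pos (by tauto), if_pos h]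

/-- The product attached to the tree of depth `h` below the index `s` whose branches are
selected by the number `i`. The factor of an inner node is its `Gam`, that of a node at the
bottom is its datum. -/
def treeTerm (ν : ℝ) (g c : Fin 3 → Coeffs) : ℕ → Idx → ℤ → ℝ
  | 0, s, _ => uZ c s
  | h + 1, s, i =>
    Gam ν g c s (theta i s 0 h)
      * (treeTerm ν g c h (childT s (theta i s 0 h)) (theta i s 1 h)
        * treeTerm ν g c h (childZ s (theta i s 0 h)) (theta i s 2 h))

theorem treeTerm_of_isLeaf (ν : ℝ) (g c : Fin 3 → Coeffs) (h : ℕ) {s : Idx} (hs : IsLeaf s)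
    (i : ℤ) : treeTerm ν g c h s i = uZ c s := by
  induction h generalizing s i with
  | zero => rfl
  | succ h ih =>
    rw [treeTerm, Gam_of_isLeaf _ _ _ hs, ih (isLeaf_childT hs _), ih (isLeaf_childZ hs _),
      uZ_mul_of_isLeaf c hs, one_mul]

/-- An index that may occur in the tree: its component number is a true one. -/
def IsNode (s : Idx) : Prop := IsLeaf s ∨ s.a = 0 ∨ s.a = 1 ∨ s.a = 2

/-- `v` is obtained from the data `c` by the expansion of every inner index into the products of
its children, and the time order of the children is smaller. -/
structure HasExpansion (ν : ℝ) (g c : Fin 3 → Coeffs) (v : Idx → ℝ) : Prop where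
  leaf : ∀ s, IsLeaf s → v s = uZ c s
  fF_nonneg : ∀ s, IsNode s → 0 ≤ fF s
  expand : ∀ s, IsNode s → ¬ IsLeaf s →
    v s = ∑ i ∈ Finset.Ico 0 (fF s + 1), Gam ν g c s i * (v (childT s i) * v (childZ s i))
  childT_node : ∀ s, IsNode s → ¬ IsLeaf s → ∀ i, 0 ≤ i → i < fF s + 1 →
    IsNode (childT s i) ∧ (IsLeaf (childT s i) ∨ (childT s i).w < s.w)
  childZ_node : ∀ s, IsNode s → ¬ IsLeaf s → ∀ i, 0 ≤ i → i < fF s + 1 →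
    IsNode (childZ s i) ∧ (IsLeaf (childZ s i) ∨ (childZ s i).w < s.w)

section HasExpansion

variable {ν : ℝ} {g c : Fin 3 → Coeffs} {v : Idx → ℝ}

theorem isNode_childT (hv : HasExpansion ν g c v) {s : Idx} (hs : IsNode s) {i : ℤ}
    (h0 : 0 ≤ i) (h1 : i < fF s + 1) : IsNode (childT s i) := by
  by_cases hl : IsLeaf s
  · exact Or.inl (isLeaf_childT hl i)
  · exact (hv.childT_node s hs hl i h0 h1).1

theorem isNode_childZ (hv : HasExpansion ν g c v) {s : Idx} (hs : IsNode s) {i : ℤ}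
    (h0 : 0 ≤ i) (h1 : i < fF s + 1) : IsNode (childZ s i) := by
  by_cases hl : IsLeaf s
  · exact Or.inl (isLeaf_childZ hl i)
  · exact (hv.childZ_node s hs hl i h0 h1).1

theorem fF_of_zero_two {s : Idx} (hl : ¬ IsLeaf s) (h : s.a = 0 ∧ s.q = 2) : fF s = 1 := by
  unfold fF
  rw [if_neg (by simp only [IsLeaf, not_or] at hl; omega), if_pos h]

/-- For `α = 0` and `q = 2` both choices lead to boundary values. -/
theorem isLeaf_children_of_zero_two {s : Idx} (hl : ¬ IsLeaf s) (h : s.a = 0 ∧ s.q = 2) (i : ℤ) :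
    IsLeaf (childT s i) ∧ IsLeaf (childZ s i) := by
  have hq : 0 ≤ s.q - 1 ∧ s.q - 1 ≤ 1 := by omega
  have hX : IsLeaf (toX s) := Or.inr (Or.inr (Or.inr (Or.inl hq)))
  have hZ : IsLeaf (toZ s) := Or.inr (Or.inr (Or.inr (Or.inl hq)))
  have hn : ¬(P2 s ∨ P3 s ∨ s.a = 1 ∨ s.a = 2) := by
    rintro (h1 | h1 | h1 | h1)
    · exact hl (Or.inl h1)
    · exact hl (Or.inr h1)
    all_goals omega
  have hT12 : ∀ s i, IsLeaf s → IsLeaf (childT12 s i) := by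
    intro s i hs
    have := isLeaf_childT hs i
    unfold childT at this
    rwa [if_pos (hs.elim Or.inl fun h => Or.inr (Or.inl h))] at this
  have hZ12 : ∀ s i, IsLeaf s → IsLeaf (childZ12 s i) := by
    intro s i hs
    have := isLeaf_childZ hs i
    unfold childZ at this
    rwa [if_pos (hs.elim Or.inl fun h => Or.inr (Or.inl h))] at this
  unfold childT childZ
  rw [if_neg hn, if_neg hn]
  constructor
  · split_ifs
    · exact hT12 _ _ hX
    · exact hT12 _ _ hZ
  · split_ifs
    · exact hZ12 _ _ hX
    · exact hZ12 _ _ hZ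

theorem eta_succ_eq {s : Idx} (hl : ¬ IsLeaf s) (h : ℕ) :
    eta (h + 1) s + 1 =
      ∑ k ∈ Finset.Ico 0 (fF s + 1), (eta h (childT s k) + 1) * (eta h (childZ s k) + 1) := by
  rw [eta, if_neg hl]
  split_ifs with h2
  · rw [fF_of_zero_two hl h2]
    have := isLeaf_children_of_zero_two hl h2
    have e : ∀ k ∈ Finset.Ico (0 : ℤ) (1 + 1),
        (eta h (childT s k) + 1) * (eta h (childZ s k) + 1) = 1 := by
      intro k _
      rw [eta_of_isLeaf (this k).1, eta_of_isLeaf (this k).2]; rfl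
    rw [Finset.sum_congr rfl e]; rfl
  · rw [← Icc_zero_eq_Ico]; ring

theorem eta_nonneg (hv : HasExpansion ν g c v) (h : ℕ) {s : Idx} (hs : IsNode s) :
    0 ≤ eta h s := by
  induction h generalizing s with
  | zero => rw [eta_zero_eq]; exact hv.fF_nonneg s hs
  | succ h ih =>
    by_cases hl : IsLeaf s
    · rw [eta_of_isLeaf hl]
    · have hF := hv.fF_nonneg s hs
      have h1 : ∀ k ∈ Finset.Ico 0 (fF s + 1),
          0 ≤ (eta h (childT s k) + 1) * (eta h (childZ s k) + 1) := by
        intro k hk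
        rw [Finset.mem_Ico] at hk
        have := ih (isNode_childT hv hs hk.1 hk.2)
        have := ih (isNode_childZ hv hs hk.1 hk.2)
        positivity
      have h2 := Finset.single_le_sum h1 (a := 0) (by rw [Finset.mem_Ico]; omega)
      rw [← eta_succ_eq hl] at h2
      have := ih (isNode_childT hv hs (i := 0) le_rfl (by omega))
      have := ih (isNode_childZ hv hs (i := 0) le_rfl (by omega))
      nlinarith

theorem theta0_eq (hv : HasExpansion ν g c v) {s : Idx} (hs : IsNode s) (h : ℕ)
    {j t : ℤ} (hj : 0 ≤ j) (hj' : j < fF s + 1) (ht : 0 ≤ t)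
    (ht' : t < (eta h (childT s j) + 1) * (eta h (childZ s j) + 1)) :
    theta0 (Seta j s h + t) s h = j := by
  have hS : ∀ k, 0 ≤ k → k < fF s + 1 →
      0 ≤ (eta1 h s k + 1) * (eta2 h s k + 1) := by
    intro k h0 h1
    rw [eta1_eq, eta2_eq]
    have := eta_nonneg hv h (isNode_childT hv hs h0 h1)
    have := eta_nonneg hv h (isNode_childZ hv hs h0 h1)
    positivity
  have hsucc : ∀ j, 0 ≤ j → Seta (j + 1) s h =
      Seta j s h + (eta h (childT s j) + 1) * (eta h (childZ s j) + 1) := by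
    intro j hj
    unfold Seta
    rw [sum_Ico_succ _ hj, eta1_eq, eta2_eq]
  have hmono : ∀ a b, a ≤ b → b ≤ fF s + 1 → Seta a s h ≤ Seta b s h := fun a b hab hb =>
    sum_Ico_le_of_lt hS hab hb
  unfold theta0
  rw [Finset.sum_eq_single j]
  · intro k hk hkj
    exfalso
    rw [Finset.mem_filter, Finset.mem_Icc] at hk
    rcases lt_or_gt_of_ne hkj with hlt | hlt
    · have := hmono (k + 1) j (by omega) (by omega)
      omega
    · have := hmono (j + 1) k (by omega) (by omega)
      rw [hsucc j hj] at this
      omega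
  · intro hn
    exfalso
    apply hn
    rw [Finset.mem_filter, Finset.mem_Icc, hsucc j hj]
    omega

/-- Summation of all the products of trees of depth `h + 1` gives back the expanded coefficient,
provided that all branches have ended at this depth. -/
theorem sum_treeTerm (hv : HasExpansion ν g c v) (h : ℕ) {s : Idx} (hs : IsNode s)
    (hw : IsLeaf s ∨ s.w ≤ h + 1) :
    ∑ i ∈ Finset.Ico 0 (eta h s + 1), treeTerm ν g c (h + 1) s i = v s := by
  induction h generalizing s with
  | zero =>
    by_cases hl : IsLeaf s
    · rw [eta_of_isLeaf hl, show Finset.Ico (0 : ℤ) (0 + 1) = {0} from rfl,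
        Finset.sum_singleton, treeTerm_of_isLeaf _ _ _ _ hl, hv.leaf s hl]
    · rw [eta_zero_eq, hv.expand s hs hl]
      refine Finset.sum_congr rfl fun i hi => ?_
      rw [Finset.mem_Ico] at hi
      have hleaf : ∀ t : Idx, (IsLeaf t ∨ t.w < s.w) → v t = uZ c t := by
        intro t ht
        apply hv.leaf
        rcases ht with ht | ht
        · exact ht
        · have := hw.resolve_left hl
          simp only [Nat.cast_zero, zero_add] at this
          by_cases h0 : t.w < 0
          · exact Or.inl (Or.inl h0)
          · exact Or.inr (Or.inl (by omega))
      have hth : theta i s 0 0 = i := by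
        unfold theta; rw [if_neg hl, if_pos rfl]
      rw [treeTerm, hth, treeTerm, treeTerm,
        hleaf _ (hv.childT_node s hs hl i hi.1 hi.2).2,
        hleaf _ (hv.childZ_node s hs hl i hi.1 hi.2).2]
  | succ h ih =>
    by_cases hl : IsLeaf s
    · rw [eta_of_isLeaf hl, show Finset.Ico (0 : ℤ) (0 + 1) = {0} from rfl,
        Finset.sum_singleton, treeTerm_of_isLeaf _ _ _ _ hl, hv.leaf s hl]
    · have hF := hv.fF_nonneg s hs
      have h1 := fun k (h0 : 0 ≤ k) (h1 : k < fF s + 1) =>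
        eta_nonneg hv h (isNode_childT hv hs h0 h1)
      have h2 := fun k (h0 : 0 ≤ k) (h1 : k < fF s + 1) =>
        eta_nonneg hv h (isNode_childZ hv hs h0 h1)
      rw [eta_succ_eq hl, sum_Ico_blocks _ _ (by omega) (fun k h0 h3 => by
        have := h1 k h0 h3; have := h2 k h0 h3; positivity), hv.expand s hs hl]
      refine Finset.sum_congr rfl fun j hj => ?_
      rw [Finset.mem_Ico] at hj
      have e1 := h1 j hj.1 hj.2
      have e2 := h2 j hj.1 hj.2
      have hT := hv.childT_node s hs hl j hj.1 hj.2
      have hZ := hv.childZ_node s hs hl j hj.1 hj.2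
      have hwT : IsLeaf (childT s j) ∨ (childT s j).w ≤ h + 1 := by
        rcases hT.2 with h' | h'
        · exact Or.inl h'
        · right; have := hw.resolve_left hl; push_cast at this; omega
      have hwZ : IsLeaf (childZ s j) ∨ (childZ s j).w ≤ h + 1 := by
        rcases hZ.2 with h' | h'
        · exact Or.inl h'
        · right; have := hw.resolve_left hl; push_cast at this; omega
      rw [sum_Ico_mul _ (by omega) (by omega), ← ih hT.1 hwT, ← ih hZ.1 hwZ, Finset.sum_mul_sum,
        Finset.mul_sum]
      refine Finset.sum_congr rfl fun x hx => ?_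
      rw [Finset.mul_sum]
      refine Finset.sum_congr rfl fun y hy => ?_
      rw [Finset.mem_Ico] at hx hy
      set b := eta h (childZ s j) + 1 with hb
      have hSeta : ∑ k ∈ Finset.Ico 0 j, (eta h (childT s k) + 1) * (eta h (childZ s k) + 1)
          = Seta j s h := by
        unfold Seta
        refine Finset.sum_congr rfl fun k _ => ?_
        rw [eta1_eq, eta2_eq]
      have ht0 : 0 ≤ x * b + y := add_nonneg (mul_nonneg hx.1 (by omega)) hy.1
      have ht1 : x * b + y < (eta h (childT s j) + 1) * b := by nlinarith
      have hθ := theta0_eq hv hs h hj.1 hj.2 ht0 ht1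
      have hdiv : (x * b + y) / b = x := by
        rw [add_comm, Int.add_mul_ediv_right _ _ (by omega), Int.ediv_eq_zero_of_lt hy.1 hy.2,
          zero_add]
      have hmod : (x * b + y) % b = y := by
        rw [add_comm, Int.add_mul_emod_self_right, Int.emod_eq_of_lt hy.1 hy.2]
      rw [hSeta]
      have t0 : theta (Seta j s h + (x * b + y)) s 0 (h + 1) = j := by
        unfold theta
        rw [if_neg hl, if_neg (by omega), if_pos rfl]
        exact hθ
      have t1 : theta (Seta j s h + (x * b + y)) s 1 (h + 1) = x := by
        unfold theta
        rw [if_neg hl, if_neg (by omega), if_neg (by omega), if_pos rfl, Nat.add_sub_cancel]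
        simp only [hθ]
        rw [eta2_eq, ← hb, add_sub_cancel_left, hdiv]
      have t2 : theta (Seta j s h + (x * b + y)) s 2 (h + 1) = y := by
        unfold theta
        rw [if_neg hl, if_neg (by omega), if_neg (by omega), if_neg (by omega),
          Nat.add_sub_cancel]
        simp only [hθ]
        rw [eta2_eq, ← hb, add_sub_cancel_left, hmod]
      rw [treeTerm, t0, t1, t2]

/-! ### The numbering of the nodes of the tree -/

/-- The node of heap number `M` (the root is `1`, the children of `M` are `2 M` and `2 M + 1`) in
the tree of depth `h + 1` below `s`, together with the number that selects the branches below
it. -/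
def nodeAt (h : ℕ) (s : Idx) (i : ℤ) (M : ℕ) : Idx × ℤ :=
  if M ≤ 1 then (s, i)
  else
    let N := nodeAt h s i (M / 2)
    let ind := h - Nat.log 2 (M / 2)
    if M % 2 = 0 then (childT N.1 (theta N.2 N.1 0 ind), theta N.2 N.1 1 ind)
    else (childZ N.1 (theta N.2 N.1 0 ind), theta N.2 N.1 2 ind)
termination_by M
decreasing_by omega

/-- The branch taken at the node of heap number `M`. -/
def choiceAt (h : ℕ) (s : Idx) (i : ℤ) (M : ℕ) : ℤ :=
  theta (nodeAt h s i M).2 (nodeAt h s i M).1 0 (h - Nat.log 2 M)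

theorem nodeAt_one (h : ℕ) (s : Idx) (i : ℤ) : nodeAt h s i 1 = (s, i) := by
  rw [nodeAt, if_pos le_rfl]

theorem nodeAt_even (h : ℕ) (s : Idx) (i : ℤ) {M : ℕ} (hM : 2 ≤ M) (h2 : M % 2 = 0) :
    nodeAt h s i M = (childT (nodeAt h s i (M / 2)).1 (choiceAt h s i (M / 2)),
      theta (nodeAt h s i (M / 2)).2 (nodeAt h s i (M / 2)).1 1 (h - Nat.log 2 (M / 2))) := by
  rw [nodeAt, if_neg (by omega)]
  simp only [if_pos h2]; rfl

theorem nodeAt_odd (h : ℕ) (s : Idx) (i : ℤ) {M : ℕ} (hM : 2 ≤ M) (h2 : M % 2 ≠ 0) :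
    nodeAt h s i M = (childZ (nodeAt h s i (M / 2)).1 (choiceAt h s i (M / 2)),
      theta (nodeAt h s i (M / 2)).2 (nodeAt h s i (M / 2)).1 2 (h - Nat.log 2 (M / 2))) := by
  rw [nodeAt, if_neg (by omega)]
  simp only [if_neg h2]; rfl

theorem Ip_eq_one_iff (x : ℕ) : Ip x = 1 ↔ x % 2 = 1 := by
  unfold Ip; split_ifs with h <;> omega

theorem ite_Ip {M : Type*} (x : ℕ) (a b : M) :
    (if Ip x = 1 then a else b) = if x % 2 = 1 then a else b := by
  simp only [Ip_eq_one_iff]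

theorem sub_pow_div (M l : ℕ) : (M - 2 ^ l) / 2 ^ l = M / 2 ^ l - 1 := by
  simpa using Nat.sub_mul_div M (2 ^ l) 1

theorem div_pow_succ (M l : ℕ) : M / 2 ^ (l + 1) = M / 2 ^ l / 2 := by
  rw [pow_succ, Nat.div_div_eq_div_mul]

theorem log_div_pow (M l : ℕ) : Nat.log 2 (M / 2 ^ l) = Nat.log 2 M - l := by
  induction l with
  | zero => simp
  | succ l ih => rw [div_pow_succ, Nat.log_div_base, ih]; omega

theorem div_pow_log {M : ℕ} (hM : 1 ≤ M) : M / 2 ^ Nat.log 2 M = 1 := by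
  have h1 := Nat.pow_log_le_self 2 (x := M) (by omega)
  have h2 := Nat.lt_pow_succ_log_self (b := 2) (by norm_num) M
  rw [pow_succ] at h2
  exact Nat.div_eq_of_lt_le (by omega) (by omega)

theorem one_le_div_pow {M l : ℕ} (hM : 1 ≤ M) (hl : l ≤ Nat.log 2 M) : 1 ≤ M / 2 ^ l := by
  have h1 := Nat.pow_log_le_self 2 (x := M) (by omega)
  have h2 : 2 ^ l ≤ 2 ^ Nat.log 2 M := Nat.pow_le_pow_right (by norm_num) hl
  exact (Nat.one_le_div_iff (by positivity)).2 (by omega)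

theorem two_le_div_pow {M l : ℕ} (hM : 1 ≤ M) (hl : l < Nat.log 2 M) : 2 ≤ M / 2 ^ l := by
  have := one_le_div_pow (l := l + 1) hM hl
  rw [div_pow_succ] at this
  omega

/-- The recursion `cC` runs through the ancestors of a node, the recursion `Theta` through the
numbers that select their branches. -/
theorem cC_Theta_eq (s : Idx) (i : ℤ) (m : ℕ) (hm : Nat.log 2 (m + 1) + 1 ≤ s.w.toNat) :
    (∀ h l, l + h ≤ Nat.log 2 (m + 1) →
      cC m h l i s = (nodeAt (s.w.toNat - 1) s i ((m + 1) / 2 ^ (l + h))).1) ∧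
    Theta m i s 0 = choiceAt (s.w.toNat - 1) s i (m + 1) := by
  induction m using Nat.strong_induction_on with
  | _ m IH =>
    have hM : 1 ≤ m + 1 := by omega
    have hC : ∀ h k l, l + h + k = Nat.log 2 (m + 1) →
        cC m h l i s = (nodeAt (s.w.toNat - 1) s i ((m + 1) / 2 ^ (l + h))).1 := by
      intro h k
      induction k with
      | zero =>
        intro l hl
        rw [cC, if_pos (by omega), show l + h = Nat.log 2 (m + 1) by omega, div_pow_log hM,
          nodeAt_one]
      | succ k ih =>
        intro l hl
        have h2 : 2 ≤ (m + 1) / 2 ^ (l + h) := two_le_div_pow hM (by omega)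
        have hlog : Nat.log 2 ((m + 1) / 2 ^ (l + h) / 2) = Nat.log 2 (m + 1) - (l + h + 1) := by
          rw [← div_pow_succ, log_div_pow]
        have hlt : (m + 1) / 2 ^ (l + h) ≤ m + 1 := Nat.div_le_self _ _
        have hTh : Theta ((m + 1 - 2 ^ (l + 1 + h)) / 2 ^ (l + 1 + h)) i s 0 =
            choiceAt (s.w.toNat - 1) s i ((m + 1) / 2 ^ (l + h) / 2) := by
          rw [sub_pow_div, show l + 1 + h = l + h + 1 by omega, div_pow_succ]
          have e : (m + 1) / 2 ^ (l + h) / 2 - 1 + 1 = (m + 1) / 2 ^ (l + h) / 2 := by omega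
          have := (IH ((m + 1) / 2 ^ (l + h) / 2 - 1) (by omega) (by rw [e, hlog]; omega)).2
          rwa [e] at this
        rw [cC, if_neg (by omega), ih (l + 1) (by omega), hTh, sub_pow_div, ite_Ip,
          show l + 1 + h = l + h + 1 by omega, div_pow_succ]
        by_cases hpar : (m + 1) / 2 ^ (l + h) % 2 = 0
        · rw [if_pos (by omega), nodeAt_even _ _ _ h2 hpar]
        · rw [if_neg (by omega), nodeAt_odd _ _ _ h2 hpar]
    have hT : ∀ k h, h + 1 + k = Nat.log 2 (m + 1) →
        Theta m i s (h + 1) = (nodeAt (s.w.toNat - 1) s i ((m + 1) / 2 ^ h)).2 := by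
      intro k
      induction k with
      | zero =>
        intro h hh
        have h2 : 2 ≤ (m + 1) / 2 ^ h := two_le_div_pow hM (by omega)
        have h1 : (m + 1) / 2 ^ h / 2 = 1 := by
          rw [← div_pow_succ, show h + 1 = Nat.log 2 (m + 1) by omega, div_pow_log hM]
        rw [Theta, if_pos (by omega), Ipb, if_neg (by omega), Nat.add_sub_cancel, sub_pow_div]
        by_cases hpar : (m + 1) / 2 ^ h % 2 = 0
        · rw [nodeAt_even _ _ _ h2 hpar, (Ip_eq_one_iff _).2 (by omega), h1, nodeAt_one]
          simp
        · rw [nodeAt_odd _ _ _ h2 hpar, h1, nodeAt_one, Ip, if_pos (by omega)]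
          simp
      | succ k ih =>
        intro h hh
        have h2 : 2 ≤ (m + 1) / 2 ^ h := two_le_div_pow hM (by omega)
        have hlog : Nat.log 2 ((m + 1) / 2 ^ h / 2) = Nat.log 2 (m + 1) - (h + 1) := by
          rw [← div_pow_succ, log_div_pow]
        rw [Theta, if_neg (by omega), ih (h + 1) (by omega), hC (h + 1) (k + 1) 0 (by omega),
          Ipb, if_neg (by omega), Nat.add_sub_cancel, sub_pow_div, zero_add, div_pow_succ,
          show s.w.toNat - 1 + (h + 1) - Nat.log 2 (m + 1)
            = s.w.toNat - 1 - Nat.log 2 ((m + 1) / 2 ^ h / 2) by omega]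
        by_cases hpar : (m + 1) / 2 ^ h % 2 = 0
        · rw [nodeAt_even _ _ _ h2 hpar, (Ip_eq_one_iff _).2 (by omega)]
        · rw [nodeAt_odd _ _ _ h2 hpar, Ip, if_pos (by omega)]
    refine ⟨fun h l hl => hC h (Nat.log 2 (m + 1) - (l + h)) l (by omega), ?_⟩
    by_cases h0 : Nat.log 2 (m + 1) = 0
    · have hm0 : m = 0 := by
        by_contra hne
        have : 1 ≤ Nat.log 2 (m + 1) := by
          exact Nat.le_log_of_pow_le (by norm_num) (by omega)
        omega
      subst hm0
      rw [Theta, if_pos (by omega), Ipb, if_pos rfl, choiceAt, zero_add, nodeAt_one]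
      simp
    · rw [Theta, if_neg (by omega), hT (Nat.log 2 (m + 1) - 1) 0 (by omega),
        hC 0 (Nat.log 2 (m + 1)) 0 (by omega), Ipb, if_pos rfl, choiceAt]
      simp

theorem Theta_eq_choiceAt {s : Idx} {i : ℤ} {m M : ℕ} (hM : m + 1 = M)
    (hl : Nat.log 2 M + 1 ≤ s.w.toNat) : Theta m i s 0 = choiceAt (s.w.toNat - 1) s i M := by
  subst hM
  exact (cC_Theta_eq s i m hl).2

theorem log_two_pow_add {j k : ℕ} (hk : k < 2 ^ j) : Nat.log 2 (2 ^ j + k) = j := by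
  rw [Nat.log_eq_iff (Or.inr ⟨by norm_num, by positivity⟩)]
  rw [pow_succ]; omega

theorem two_pow_add_div {j k l : ℕ} (hl : l ≤ j) :
    (2 ^ j + k) / 2 ^ l = k / 2 ^ l + 2 ^ (j - l) := by
  have : 2 ^ j = 2 ^ (j - l) * 2 ^ l := by rw [← pow_add]; congr 1; omega
  rw [this, add_comm, Nat.add_mul_div_right _ _ (by positivity)]

theorem rho_eq_nodeAt (s : Idx) (i : ℤ) {j k : ℕ} (hk : k < 2 ^ j) (hj : j + 1 ≤ s.w.toNat) :
    rho i 1 (k + 1) (j + 1) s = (nodeAt (s.w.toNat - 1) s i (2 ^ j + k)).1 := by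
  rcases Nat.eq_zero_or_pos j with h0 | hpos
  · subst h0
    rw [rho, if_pos (by omega)]
    obtain rfl : k = 0 := by omega
    rw [pow_zero, add_zero, nodeAt_one]
  have key : ∀ d l, l + 1 + d = j →
      rho i (l + 1) (k + 1) (j + 1) s
        = (nodeAt (s.w.toNat - 1) s i ((2 ^ j + k) / 2 ^ l)).1 := by
    have hlog := log_two_pow_add hk
    have hM : 1 ≤ 2 ^ j + k := by have : 0 < 2 ^ j := by positivity
                                  omega
    have hTh : ∀ l, l + 1 ≤ j → Theta ((k + 1 - 1 + 2 ^ (j + 1 - 1) - 2 ^ (l + 1)) / 2 ^ (l + 1)) i s 0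
        = choiceAt (s.w.toNat - 1) s i ((2 ^ j + k) / 2 ^ l / 2) := by
      intro l hl
      have h1 := one_le_div_pow (l := l + 1) hM (by omega)
      rw [div_pow_succ] at h1
      apply Theta_eq_choiceAt
      · rw [sub_pow_div, Nat.add_sub_cancel, Nat.add_sub_cancel, add_comm k, div_pow_succ]; omega
      · rw [← div_pow_succ, log_div_pow]; omega
    intro d
    induction d with
    | zero =>
      intro l hl
      have h2 : 2 ≤ (2 ^ j + k) / 2 ^ l := two_le_div_pow hM (by omega)
      have h1 : (2 ^ j + k) / 2 ^ l / 2 = 1 := by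
        rw [← div_pow_succ, show l + 1 = Nat.log 2 (2 ^ j + k) by omega, div_pow_log hM]
      rw [rho, if_neg (by omega)]
      simp only
      rw [hTh l (by omega), if_neg (show ¬ l + 1 < j + 1 - 1 by omega), ite_Ip,
        Nat.add_sub_cancel, Nat.add_sub_cancel, Nat.add_sub_cancel, add_comm k]
      by_cases hpar : (2 ^ j + k) / 2 ^ l % 2 = 0
      · rw [nodeAt_even _ _ _ h2 hpar, if_pos (by omega), h1, nodeAt_one]
      · rw [nodeAt_odd _ _ _ h2 hpar, if_neg (by omega), h1, nodeAt_one]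
    | succ d ih =>
      intro l hl
      have h2 : 2 ≤ (2 ^ j + k) / 2 ^ l := two_le_div_pow hM (by omega)
      rw [rho, if_neg (by omega)]
      simp only
      rw [hTh l (by omega), if_pos (show l + 1 < j + 1 - 1 by omega), ih (l + 1) (by omega),
        ite_Ip, Nat.add_sub_cancel, Nat.add_sub_cancel, Nat.add_sub_cancel, add_comm k, div_pow_succ]
      by_cases hpar : (2 ^ j + k) / 2 ^ l % 2 = 0
      · rw [nodeAt_even _ _ _ h2 hpar, if_pos (by omega)]
      · rw [nodeAt_odd _ _ _ h2 hpar, if_neg (by omega)]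
  have := key (j - 1) 0 (by omega)
  rwa [zero_add, pow_zero, Nat.div_one] at this

theorem aleph_eq_nodeAt (s : Idx) (i : ℤ) {k : ℕ} (hk : k < 2 ^ s.w.toNat)
    (hw : 1 ≤ s.w.toNat) :
    aleph i 1 (k + 1) s = (nodeAt (s.w.toNat - 1) s i (2 ^ s.w.toNat + k)).1 := by
  have hlog := log_two_pow_add hk
  have hM : 1 ≤ 2 ^ s.w.toNat + k := by have : 0 < 2 ^ s.w.toNat := by positivity
                                        omega
  have hTh : ∀ l, l + 1 ≤ s.w.toNat →
      Theta ((k + 1 - 1) / 2 ^ (l + 1) + 2 ^ (s.w.toNat - (l + 1)) - 1) i s 0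
      = choiceAt (s.w.toNat - 1) s i ((2 ^ s.w.toNat + k) / 2 ^ l / 2) := by
    intro l hl
    have h1 := one_le_div_pow (l := l + 1) hM (by omega)
    apply Theta_eq_choiceAt
    · rw [← div_pow_succ, Nat.add_sub_cancel, ← two_pow_add_div hl]; omega
    · rw [← div_pow_succ, log_div_pow]; omega
  have hpar' : ∀ l, l + 1 ≤ s.w.toNat →
      ((k / 2 ^ l + 1) % 2 = 1 ↔ (2 ^ s.w.toNat + k) / 2 ^ l % 2 = 0) := by
    intro l hl
    rw [two_pow_add_div (by omega)]
    have : 2 ^ (s.w.toNat - l) = 2 * 2 ^ (s.w.toNat - l - 1) := by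
      rw [← pow_succ']; congr 1; omega
    omega
  have key : ∀ d l, l + 1 + d = s.w.toNat →
      aleph i (l + 1) (k + 1) s
        = (nodeAt (s.w.toNat - 1) s i ((2 ^ s.w.toNat + k) / 2 ^ l)).1 := by
    intro d
    induction d with
    | zero =>
      intro l hl
      have h2 : 2 ≤ (2 ^ s.w.toNat + k) / 2 ^ l := two_le_div_pow hM (by omega)
      have h1 : (2 ^ s.w.toNat + k) / 2 ^ l / 2 = 1 := by
        rw [← div_pow_succ, show l + 1 = Nat.log 2 (2 ^ s.w.toNat + k) by omega, div_pow_log hM]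
      rw [aleph, hTh l (by omega), if_neg (show ¬ l + 1 < s.w.toNat by omega), ite_Ip,
        Nat.add_sub_cancel, Nat.add_sub_cancel]
      simp only [hpar' l (by omega)]
      by_cases hpar : (2 ^ s.w.toNat + k) / 2 ^ l % 2 = 0
      · rw [nodeAt_even _ _ _ h2 hpar, if_pos hpar, h1, nodeAt_one]
      · rw [nodeAt_odd _ _ _ h2 hpar, if_neg hpar, h1, nodeAt_one]
    | succ d ih =>
      intro l hl
      have h2 : 2 ≤ (2 ^ s.w.toNat + k) / 2 ^ l := two_le_div_pow hM (by omega)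
      rw [aleph, hTh l (by omega), if_pos (show l + 1 < s.w.toNat by omega),
        ih (l + 1) (by omega), ite_Ip, Nat.add_sub_cancel, Nat.add_sub_cancel, div_pow_succ]
      simp only [hpar' l (by omega)]
      by_cases hpar : (2 ^ s.w.toNat + k) / 2 ^ l % 2 = 0
      · rw [nodeAt_even _ _ _ h2 hpar, if_pos hpar]
      · rw [nodeAt_odd _ _ _ h2 hpar, if_neg hpar]
  have := key (s.w.toNat - 1) 0 (by omega)
  rwa [zero_add, pow_zero, Nat.div_one] at this

theorem prod_range_two_mul (f : ℕ → ℝ) (n : ℕ) :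
    ∏ k ∈ Finset.range (2 * n), f k = ∏ k ∈ Finset.range n, f (2 * k) * f (2 * k + 1) := by
  induction n with
  | zero => simp
  | succ n ih =>
    rw [show 2 * (n + 1) = 2 * n + 1 + 1 by ring, Finset.prod_range_succ, Finset.prod_range_succ,
      ih, Finset.prod_range_succ, mul_assoc]

theorem prod_Icc_one (f : ℕ → ℝ) (n : ℕ) :
    ∏ k ∈ Finset.Icc 1 n, f k = ∏ k ∈ Finset.range n, f (k + 1) := by
  rw [Finset.range_eq_Ico, Finset.prod_Ico_add' f 0 n 1]; rfl

/-- The product over a tree, level by level. -/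
theorem treeTerm_eq_prod (ν : ℝ) (g c : Fin 3 → Coeffs) (h : ℕ) (s : Idx) (i : ℤ) (d : ℕ)
    (hd : d ≤ h + 1) :
    treeTerm ν g c (h + 1) s i =
      (∏ j ∈ Finset.range d, ∏ k ∈ Finset.range (2 ^ j),
        Gam ν g c (nodeAt h s i (2 ^ j + k)).1 (choiceAt h s i (2 ^ j + k)))
      * ∏ k ∈ Finset.range (2 ^ d),
          treeTerm ν g c (h + 1 - d) (nodeAt h s i (2 ^ d + k)).1 (nodeAt h s i (2 ^ d + k)).2 := by
  induction d with
  | zero => simp [nodeAt_one]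
  | succ d ih =>
    rw [ih (by omega), Finset.prod_range_succ, mul_assoc, pow_succ' 2 d, prod_range_two_mul,
      ← Finset.prod_mul_distrib]
    congr 1
    refine Finset.prod_congr rfl fun k hk => ?_
    rw [Finset.mem_range] at hk
    have hlog := log_two_pow_add hk
    have hM : 1 ≤ 2 ^ d + k := by have : 0 < 2 ^ d := by positivity
                                  omega
    rw [show h + 1 - d = h - d + 1 by omega, treeTerm,
      show h + 1 - (d + 1) = h - d by omega,
      nodeAt_even h s i (M := 2 * 2 ^ d + 2 * k) (by omega) (by omega),
      nodeAt_odd h s i (M := 2 * 2 ^ d + (2 * k + 1)) (by omega) (by omega),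
      show (2 * 2 ^ d + 2 * k) / 2 = 2 ^ d + k by omega,
      show (2 * 2 ^ d + (2 * k + 1)) / 2 = 2 ^ d + k by omega, hlog, choiceAt, hlog]

/-- The explicit expression equals every coefficient family that has the expansion. -/
theorem velocityFormula_eq (hv : HasExpansion ν g c v) (α : Fin 3) (ω p q r : ℕ) :
    velocityFormula ν g c α ω p q r = v ⟨ω, p, q, r, (α : ℕ)⟩ := by
  unfold velocityFormula
  simp only
  set s : Idx := ⟨ω, p, q, r, (α : ℕ)⟩ with hs
  have hw : s.w.toNat = ω := by simp [hs]
  have hnode : IsNode s := by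
    right
    have : (α : ℕ) < 3 := α.2
    simp only [hs]; omega
  rcases Nat.eq_zero_or_pos ω with h0 | hpos
  · subst h0
    have hl : IsLeaf s := Or.inr (Or.inl rfl)
    rw [eta_of_isLeaf hl, hv.leaf s hl]
    simp only [Finset.Icc_self, Finset.sum_singleton, pow_zero, Finset.prod_singleton]
    rw [show Finset.Icc 1 0 = (∅ : Finset ℕ) from rfl, Finset.prod_empty, one_mul, aleph]
    simp only [hw]
    rw [if_neg (show ¬ 1 < 0 by omega), ite_Ip, if_pos (by norm_num), childT_of_isLeaf hl, if_neg]
    simp [P2, hs]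
  · obtain ⟨h, rfl⟩ : ∃ h, ω = h + 1 := ⟨ω - 1, by omega⟩
    rw [← sum_treeTerm hv h hnode (Or.inr (by simp [hs])), Icc_zero_eq_Ico, Nat.add_sub_cancel]
    refine Finset.sum_congr rfl fun i _ => ?_
    rw [treeTerm_eq_prod ν g c h s i (h + 1) le_rfl, prod_Icc_one, prod_Icc_one, Nat.sub_self]
    congr 1
    · refine Finset.prod_congr rfl fun j hj => ?_
      rw [Finset.mem_range] at hj
      rw [prod_Icc_one, Nat.add_sub_cancel]
      refine Finset.prod_congr rfl fun k hk => ?_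
      rw [Finset.mem_range] at hk
      have hlog := log_two_pow_add hk
      have : 0 < 2 ^ j := by positivity
      rw [rho_eq_nodeAt s i hk (by omega), hw, Nat.add_sub_cancel,
        Theta_eq_choiceAt (M := 2 ^ j + k) (by omega) (by rw [hlog, hw]; omega), hw,
        Nat.add_sub_cancel]
    · refine Finset.prod_congr rfl fun k hk => ?_
      rw [Finset.mem_range] at hk
      rw [aleph_eq_nodeAt s i (by rwa [hw]) (by omega), hw, Nat.add_sub_cancel, treeTerm]

end HasExpansion

/-! ### Elimination of the pressure on the level of normalized coefficients -/

/-- The `n`-th power of the Laplacian in the two directions `A`, `B`, for coefficients that are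
normalized so that derivatives are shifts of the indices. -/
def lapPow (n : ℕ) (f : ℕ → ℕ → ℝ) (A B : ℕ) : ℝ :=
  ∑ m ∈ Finset.range (n + 1), (n.choose m : ℝ) * f (A + 2 * (n - m)) (B + 2 * m)

theorem lapPow_succ (n : ℕ) (f : ℕ → ℕ → ℝ) (A B : ℕ) :
    lapPow (n + 1) f A B = lapPow n (fun A B => f (A + 2) B + f A (B + 2)) A B := by
  unfold lapPow
  have h := Finset.sum_choose_succ_mul (R := ℝ)
    (fun i j => f (A + 2 * j) (B + 2 * i)) n
  rw [h, ← Finset.sum_add_distrib]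
  refine Finset.sum_congr rfl fun m hm => ?_
  rw [Finset.mem_range] at hm
  rw [show A + 2 * (n + 1 - m) = A + 2 * (n - m) + 2 by omega,
    show B + 2 * (m + 1) = B + 2 * m + 2 by omega]
  ring

theorem lapPow_add (n : ℕ) (f g : ℕ → ℕ → ℝ) (A B : ℕ) :
    lapPow n (fun A B => f A B + g A B) A B = lapPow n f A B + lapPow n g A B := by
  unfold lapPow
  rw [← Finset.sum_add_distrib]
  exact Finset.sum_congr rfl fun m _ => by ring

theorem lapPow_smul (n : ℕ) (x : ℝ) (f : ℕ → ℕ → ℝ) (A B : ℕ) :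
    lapPow n (fun A B => x * f A B) A B = x * lapPow n f A B := by
  unfold lapPow
  rw [Finset.mul_sum]
  exact Finset.sum_congr rfl fun m _ => by ring

theorem lapPow_neg (n : ℕ) (f : ℕ → ℕ → ℝ) (A B : ℕ) :
    lapPow n (fun A B => - f A B) A B = - lapPow n f A B := by
  have := lapPow_smul n (-1) f A B
  simpa using this

/-- The contribution of a force `(Ra, R0, Rb)` to the `A`-component of an accelerated solenoidal
field, after `k + 1` double integrations in the direction of the middle index. -/
def source (k : ℕ) (Ra R0 Rb : ℕ → ℕ → ℕ → ℝ) (A q B : ℕ) : ℝ :=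
  Ra A q B - R0 (A + 1) (q - 1) B
  + ∑ n ∈ Finset.range k, (-1 : ℝ) ^ (n + 1) *
    (lapPow n (fun A B => Ra (A + 2) (q - 2 * (n + 1)) B + Rb (A + 1) (q - 2 * (n + 1)) (B + 1)) A B
      - lapPow (n + 1) (fun A B => R0 (A + 1) (q - 2 * (n + 1) - 1) B) A B)

theorem source_add (k : ℕ) (Ra R0 Rb Ra' R0' Rb' : ℕ → ℕ → ℕ → ℝ) (A q B : ℕ) :
    source k (fun A q B => Ra A q B + Ra' A q B) (fun A q B => R0 A q B + R0' A q B)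
      (fun A q B => Rb A q B + Rb' A q B) A q B
      = source k Ra R0 Rb A q B + source k Ra' R0' Rb' A q B := by
  unfold source
  simp only [lapPow_add]
  rw [add_add_add_comm, ← Finset.sum_add_distrib]
  congr 1
  · ring
  · exact Finset.sum_congr rfl fun n _ => by ring

theorem source_smul (k : ℕ) (x : ℝ) (Ra R0 Rb : ℕ → ℕ → ℕ → ℝ) (A q B : ℕ) :
    source k (fun A q B => x * Ra A q B) (fun A q B => x * R0 A q B)
      (fun A q B => x * Rb A q B) A q B = x * source k Ra R0 Rb A q B := by
  unfold source
  simp only [lapPow_smul, lapPow_add]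
  rw [mul_add, Finset.mul_sum]
  congr 1
  · ring
  · exact Finset.sum_congr rfl fun n _ => by ring

/-- If the field `V` is solenoidal and `V - R` is the gradient of `φ`, then
`(∂_y² + M) V = ∂_y² R - ∂_y v R₀`, where `v = (∂_A, ∂_B)` and `M = v vᵀ`. Since
`M ^ n = (v · v) ^ (n - 1) M`, the iteration of this relation gives `V` in terms of `R` and of the
values of `V` at small middle indices. -/
theorem solenoidal_eq_source {Va V0 Vb Ra R0 Rb φ : ℕ → ℕ → ℕ → ℝ}
    (hdiv : ∀ A q B, Va (A + 1) q B + V0 A (q + 1) B + Vb A q (B + 1) = 0)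
    (ha : ∀ A q B, Va A q B = Ra A q B + φ (A + 1) q B)
    (h0 : ∀ A q B, V0 A q B = R0 A q B + φ A (q + 1) B)
    (hb : ∀ A q B, Vb A q B = Rb A q B + φ A q (B + 1)) (k f A B : ℕ) :
    Va A (f + 2 * (k + 1)) B =
      (-1) ^ (k + 1) * lapPow k (fun A B => Va (A + 2) f B + Vb (A + 1) f (B + 1)) A B
      + source k Ra R0 Rb A (f + 2 * (k + 1)) B := by
  have hVd : ∀ A q B, Va (A + 2) q B + Vb (A + 1) q (B + 1) = - V0 (A + 1) (q + 1) B := by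
    intro A q B
    have := hdiv (A + 1) q B
    linarith
  induction k generalizing f with
  | zero =>
    simp only [source, lapPow, zero_add, Finset.range_zero, Finset.sum_empty,
      Finset.sum_range_one, hVd]
    rw [ha, h0, show f + 2 * 1 - 1 = f + 1 by omega]
    simp
    ring_nf
  | succ k ih =>
    have h := ih (f + 2)
    rw [show f + 2 + 2 * (k + 1) = f + 2 * (k + 1 + 1) by ring] at h
    rw [h]
    unfold source
    rw [Finset.sum_range_succ]
    simp only [hVd, show f + 2 * (k + 1 + 1) - 2 * (k + 1) = f + 2 by omega]
    have e1 : lapPow k (fun A B => - V0 (A + 1) (f + 2 + 1) B) A B =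
        lapPow k (fun A B => Ra (A + 2) (f + 2) B + Rb (A + 1) (f + 2) (B + 1)) A B
        + lapPow (k + 1) (fun A B => φ (A + 1) (f + 2) B) A B := by
      rw [lapPow_succ, ← lapPow_add]
      congr 1
      funext A B
      rw [← hVd, ha, hb]
      ring
    have e2 : lapPow (k + 1) (fun A B => - V0 (A + 1) (f + 1) B) A B =
        - lapPow (k + 1) (fun A B => R0 (A + 1) (f + 2 - 1) B) A B
        - lapPow (k + 1) (fun A B => φ (A + 1) (f + 2) B) A B := by
      rw [← lapPow_neg, sub_eq_add_neg, ← lapPow_neg, ← lapPow_add]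
      congr 1
      funext A B
      rw [h0]
      simp only [show f + 2 - 1 = f + 1 by omega]
      ring
    rw [e1, e2]
    ring

/-- The source of the Laplacian of a solenoidal field. -/
theorem source_laplacian {Ua U0 Ub : ℕ → ℕ → ℕ → ℝ}
    (hdiv : ∀ A q B, Ua (A + 1) q B + U0 A (q + 1) B + Ub A q (B + 1) = 0) (k f A B : ℕ) :
    source k (fun A q B => Ua (A + 2) q B + Ua A (q + 2) B + Ua A q (B + 2))
      (fun A q B => U0 (A + 2) q B + U0 A (q + 2) B + U0 A q (B + 2))
      (fun A q B => Ub (A + 2) q B + Ub A (q + 2) B + Ub A q (B + 2)) A (f + 2 * (k + 1)) B =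
    Ua A (f + 2 * (k + 1)) (B + 2) + Ua A (f + 2 * (k + 1) + 2) B
      - U0 (A + 1) (f + 2 * (k + 1) + 1) B - Ub (A + 1) (f + 2 * (k + 1)) (B + 1)
    + (-1) ^ (k + 1) * lapPow (k + 1) (fun A B => U0 (A + 1) (f + 1) B) A B
    - (-1) ^ (k + 1) * lapPow k
        (fun A B => Ua (A + 2) (f + 2) B + Ub (A + 1) (f + 2) (B + 1)) A B := by
  have h := solenoidal_eq_source
    (Va := fun A q B => Ua (A + 2) q B + Ua A (q + 2) B + Ua A q (B + 2))
    (V0 := fun A q B => U0 (A + 2) q B + U0 A (q + 2) B + U0 A q (B + 2))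
    (Vb := fun A q B => Ub (A + 2) q B + Ub A (q + 2) B + Ub A q (B + 2)) (φ := fun _ _ _ => 0)
    (fun A q B => by
      have h1 := hdiv (A + 2) q B
      have h2 := hdiv A (q + 2) B
      have h3 := hdiv A q (B + 2)
      simp only [show ∀ n, n + 2 + 1 = n + 1 + 2 by intro n; ring] at *
      linarith)
    (fun _ _ _ => (add_zero _).symm) (fun _ _ _ => (add_zero _).symm)
    (fun _ _ _ => (add_zero _).symm) k f A B
  rw [← sub_eq_iff_eq_add'] at h
  rw [← h]
  have e : lapPow k (fun A B => Ua (A + 2 + 2) f B + Ua (A + 2) (f + 2) B + Ua (A + 2) f (B + 2)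
        + (Ub (A + 1 + 2) f (B + 1) + Ub (A + 1) (f + 2) (B + 1) + Ub (A + 1) f (B + 1 + 2))) A B
      = lapPow k (fun A B => Ua (A + 2) (f + 2) B + Ub (A + 1) (f + 2) (B + 1)) A B
        - lapPow (k + 1) (fun A B => U0 (A + 1) (f + 1) B) A B := by
    rw [lapPow_succ, sub_eq_add_neg, ← lapPow_neg, ← lapPow_add]
    congr 1
    funext A B
    have h1 := hdiv (A + 3) f B
    have h2 := hdiv (A + 1) f (B + 2)
    simp only [add_assoc, Nat.reduceAdd] at h1 h2 ⊢
    linarith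
  simp only [e]
  have h1 := hdiv (A + 1) (f + 2 * (k + 1)) B
  rw [show A + 1 + 1 = A + 2 by ring] at h1
  linear_combination h1

theorem sum_choose_split (n : ℕ) (F : ℕ → ℝ) :
    ∑ m ∈ Finset.range (n + 1), (n.choose m : ℝ) * F m =
      F 0 + ∑ m ∈ Finset.range n, (n.choose (m + 1) : ℝ) * F (m + 1) := by
  rw [Finset.sum_range_succ', add_comm]; simp

/-- The source in the form used for the body acceleration. -/
theorem source_eq_sums (k : ℕ) (Ra R0 Rb : ℕ → ℕ → ℕ → ℝ) (A q B : ℕ) :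
    source k Ra R0 Rb A q B =
      (∑ n ∈ Finset.range (k + 1), (-1 : ℝ) ^ n *
        (Ra (A + 2 * n) (q - 2 * n) B - R0 (A + 2 * n + 1) (q - 2 * n - 1) B))
      + (∑ n ∈ Finset.range k, ∑ m ∈ Finset.range (n + 1), (-1 : ℝ) ^ (n + 1) *
        ((n.choose m : ℝ) * Rb (A + 2 * (n - m) + 1) (q - 2 * (n + 1)) (B + 2 * m + 1)
          - ((n + 1).choose (m + 1) : ℝ)
            * R0 (A + 2 * (n - m) + 1) (q - 2 * (n + 1) - 1) (B + 2 * (m + 1))))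
      + ∑ n ∈ Finset.range (k - 1), ∑ m ∈ Finset.range (n + 1), (-1 : ℝ) ^ n *
        (((n + 1).choose (m + 1) : ℝ)
          * Ra (A + 2 * (n - m) + 2) (q - 2 * (n + 2)) (B + 2 * (m + 1))) := by
  have hRa : ∀ n, lapPow n (fun A B => Ra (A + 2) (q - 2 * (n + 1)) B) A B =
      Ra (A + 2 * (n + 1)) (q - 2 * (n + 1)) B +
      ∑ m ∈ Finset.range n, (n.choose (m + 1) : ℝ)
        * Ra (A + 2 * (n - (m + 1)) + 2) (q - 2 * (n + 1)) (B + 2 * (m + 1)) := by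
    intro n
    unfold lapPow
    rw [sum_choose_split]
    rfl
  have hR : ∀ n, lapPow n (fun A B => Ra (A + 2) (q - 2 * (n + 1)) B
        + Rb (A + 1) (q - 2 * (n + 1)) (B + 1)) A B =
      Ra (A + 2 * (n + 1)) (q - 2 * (n + 1)) B +
      (∑ m ∈ Finset.range n, (n.choose (m + 1) : ℝ)
        * Ra (A + 2 * (n - (m + 1)) + 2) (q - 2 * (n + 1)) (B + 2 * (m + 1))) +
      ∑ m ∈ Finset.range (n + 1),
        (n.choose m : ℝ) * Rb (A + 2 * (n - m) + 1) (q - 2 * (n + 1)) (B + 2 * m + 1) :=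
    fun n => (lapPow_add _ _ _ _ _).trans (congrArg₂ (· + ·) (hRa n) rfl)
  have hR0 : ∀ n, lapPow (n + 1) (fun A B => R0 (A + 1) (q - 2 * (n + 1) - 1) B) A B =
      R0 (A + 2 * (n + 1) + 1) (q - 2 * (n + 1) - 1) B
      + ∑ m ∈ Finset.range (n + 1), ((n + 1).choose (m + 1) : ℝ)
        * R0 (A + 2 * (n - m) + 1) (q - 2 * (n + 1) - 1) (B + 2 * (m + 1)) := by
    intro n
    unfold lapPow
    rw [sum_choose_split]
    congr 1
    refine Finset.sum_congr rfl fun m _ => ?_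
    rw [show n + 1 - (m + 1) = n - m by omega]
  have hshift : ∑ n ∈ Finset.range k, (-1 : ℝ) ^ (n + 1) * ∑ m ∈ Finset.range n,
        (n.choose (m + 1) : ℝ)
        * Ra (A + 2 * (n - (m + 1)) + 2) (q - 2 * (n + 1)) (B + 2 * (m + 1)) =
      ∑ n ∈ Finset.range (k - 1), ∑ m ∈ Finset.range (n + 1), (-1 : ℝ) ^ n *
        (((n + 1).choose (m + 1) : ℝ)
          * Ra (A + 2 * (n - m) + 2) (q - 2 * (n + 2)) (B + 2 * (m + 1))) := by
    cases k with
    | zero => simp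
    | succ k =>
      rw [Finset.sum_range_succ', Finset.range_zero, Finset.sum_empty, mul_zero, add_zero,
        Nat.add_sub_cancel]
      refine Finset.sum_congr rfl fun n _ => ?_
      rw [Finset.mul_sum]
      refine Finset.sum_congr rfl fun m _ => ?_
      rw [show n + 1 - (m + 1) = n - m by omega, show 2 * (n + 1 + 1) = 2 * (n + 2) by ring]
      ring
  rw [← hshift, Finset.sum_range_succ', source]
  simp only [hR, hR0, mul_zero, add_zero, pow_zero, one_mul, Nat.sub_zero]
  rw [add_comm (∑ n ∈ Finset.range k, _) (Ra A q B - _), add_assoc, add_assoc,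
    ← Finset.sum_add_distrib, ← Finset.sum_add_distrib]
  congr 1
  refine Finset.sum_congr rfl fun n _ => ?_
  rw [← Finset.mul_sum, Finset.sum_sub_distrib]
  ring

/-- The source in the form used for the convective terms: the coefficients of `R0` are split by
Pascal's rule. -/
theorem source_eq_blocks (k : ℕ) (Ra R0 Rb : ℕ → ℕ → ℕ → ℝ) (A q B : ℕ) :
    source k Ra R0 Rb A q B =
      (∑ n ∈ Finset.range (k + 1), (-1 : ℝ) ^ n *
        (Ra (A + 2 * n) (q - 2 * n) B - R0 (A + 2 * n + 1) (q - 2 * n - 1) B))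
      + (∑ n ∈ Finset.range k, ∑ m ∈ Finset.range (n + 1), (-1 : ℝ) ^ (n + 1) * (n.choose m : ℝ) *
        (Rb (A + 2 * (n - m) + 1) (q - 2 * (n + 1)) (B + 2 * m + 1)
          - R0 (A + 2 * (n - m) + 1) (q - 2 * (n + 1) - 1) (B + 2 * (m + 1))))
      + ∑ n ∈ Finset.range (k - 1), ∑ m ∈ Finset.range (n + 1),
        (-1 : ℝ) ^ n * ((n + 1).choose (m + 1) : ℝ) *
        (Ra (A + 2 * (n - m) + 2) (q - 2 * (n + 2)) (B + 2 * (m + 1))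
          - R0 (A + 2 * (n - m) + 3) (q - 2 * (n + 2) - 1) (B + 2 * (m + 1))) := by
  rw [source_eq_sums]
  have key : ∑ n ∈ Finset.range k, ∑ m ∈ Finset.range (n + 1), (-1 : ℝ) ^ (n + 1) *
        (((n + 1).choose (m + 1) : ℝ)
            * R0 (A + 2 * (n - m) + 1) (q - 2 * (n + 1) - 1) (B + 2 * (m + 1))) =
      (∑ n ∈ Finset.range k, ∑ m ∈ Finset.range (n + 1), (-1 : ℝ) ^ (n + 1) * (n.choose m : ℝ) *
          R0 (A + 2 * (n - m) + 1) (q - 2 * (n + 1) - 1) (B + 2 * (m + 1)))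
      + ∑ n ∈ Finset.range (k - 1), ∑ m ∈ Finset.range (n + 1),
        (-1 : ℝ) ^ n * ((n + 1).choose (m + 1) : ℝ) *
          R0 (A + 2 * (n - m) + 3) (q - 2 * (n + 2) - 1) (B + 2 * (m + 1)) := by
    have h1 : ∀ n, ∑ m ∈ Finset.range (n + 1), (-1 : ℝ) ^ (n + 1) *
        (((n + 1).choose (m + 1) : ℝ)
            * R0 (A + 2 * (n - m) + 1) (q - 2 * (n + 1) - 1) (B + 2 * (m + 1))) =
        (∑ m ∈ Finset.range (n + 1), (-1 : ℝ) ^ (n + 1) * (n.choose m : ℝ) *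
          R0 (A + 2 * (n - m) + 1) (q - 2 * (n + 1) - 1) (B + 2 * (m + 1)))
        + ∑ m ∈ Finset.range n, (-1 : ℝ) ^ (n + 1) * (n.choose (m + 1) : ℝ) *
          R0 (A + 2 * (n - m) + 1) (q - 2 * (n + 1) - 1) (B + 2 * (m + 1)) := by
      intro n
      have : ∑ m ∈ Finset.range n, (-1 : ℝ) ^ (n + 1) * (n.choose (m + 1) : ℝ) *
          R0 (A + 2 * (n - m) + 1) (q - 2 * (n + 1) - 1) (B + 2 * (m + 1)) =
          ∑ m ∈ Finset.range (n + 1), (-1 : ℝ) ^ (n + 1) * (n.choose (m + 1) : ℝ) *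
          R0 (A + 2 * (n - m) + 1) (q - 2 * (n + 1) - 1) (B + 2 * (m + 1)) := by
        rw [Finset.sum_range_succ]; simp
      rw [this, ← Finset.sum_add_distrib]
      refine Finset.sum_congr rfl fun m _ => ?_
      rw [Nat.choose_succ_succ]; push_cast; ring
    simp only [h1, Finset.sum_add_distrib]
    congr 1
    cases k with
    | zero => simp
    | succ k =>
      rw [Finset.sum_range_succ']
      simp only [Finset.range_zero, Finset.sum_empty, add_zero, Nat.add_sub_cancel]
      refine Finset.sum_congr rfl fun n _ => Finset.sum_congr rfl fun m hm => ?_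
      rw [Finset.mem_range] at hm
      rw [show A + 2 * (n + 1 - m) + 1 = A + 2 * (n - m) + 3 by omega,
        show 2 * (n + 1 + 1) = 2 * (n + 2) by ring]
      ring
  simp only [mul_sub, Finset.sum_sub_distrib] at key ⊢
  rw [key]
  simp only [mul_assoc]
  ring

/-! ### The blocks of the convective sum -/

/-- The triangular number `n (n + 1) / 2`. -/
def tri (n : ℤ) : ℤ := n * (n + 1) / 2

theorem two_mul_tri (n : ℤ) : 2 * tri n = n * (n + 1) :=
  Int.mul_ediv_cancel' (Int.even_mul_succ_self n).two_dvd

theorem tri_succ (n : ℤ) : tri (n + 1) = tri n + (n + 1) := by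
  have h1 := two_mul_tri n
  have h2 := two_mul_tri (n + 1)
  nlinarith

theorem tri_nonneg {n : ℤ} (hn : -1 ≤ n) : 0 ≤ tri n := by
  have := two_mul_tri n
  rcases eq_or_lt_of_le hn with h | h
  · subst h; decide
  · have : 0 ≤ n * (n + 1) := mul_nonneg (by omega) (by omega)
    omega

theorem tri_mono {m n : ℤ} (hm : 0 ≤ m) (h : m ≤ n) : tri m ≤ tri n := by
  have := two_mul_tri n
  have := two_mul_tri m
  nlinarith

theorem sum_succ_eq_tri {d : ℤ} (hd : 0 ≤ d) : ∑ k ∈ Finset.Ico 0 d, (k + 1) = tri d := by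
  induction d, hd using Int.leInduction with
  | base => rfl
  | succ n hn ih => rw [sum_Ico_succ _ hn, ih, tri_succ]

theorem sum_Ico_tri {M : Type*} [AddCommMonoid M] (F : ℤ → M) {N : ℤ} (hN : -1 ≤ N) :
    ∑ x ∈ Finset.Ico 0 (tri N), F x =
      ∑ n ∈ Finset.Ico 0 N, ∑ m ∈ Finset.Ico 0 (n + 1), F (tri n + m) := by
  rcases eq_or_lt_of_le hN with h | h
  · subst h; rfl
  · rw [← sum_succ_eq_tri (d := N) (by omega), sum_Ico_blocks _ _ (by omega) (by intros; omega)]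
    refine Finset.sum_congr rfl fun n hn => ?_
    rw [sum_succ_eq_tri (Finset.mem_Ico.1 hn).1]

theorem blk_eq (q : ℤ) : blk q = tri (q / 2) + (tri (q / 2 - 1) + tri (q / 2 - 2)) := by
  unfold blk
  have h1 := two_mul_tri (q / 2)
  have h2 := two_mul_tri (q / 2 - 1)
  have h3 := two_mul_tri (q / 2 - 2)
  have : 3 * (q / 2) ^ 2 - 3 * (q / 2) =
      2 * (tri (q / 2) + (tri (q / 2 - 1) + tri (q / 2 - 2)) - 1) := by linarith
  rw [this, Int.mul_ediv_cancel_left _ (by norm_num)]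
  ring

theorem nb_eq (q : ℤ) : nb q = 6 * blk q := by
  rw [blk_eq, nb]
  have h1 := two_mul_tri (q / 2)
  have h2 := two_mul_tri (q / 2 - 1)
  have h3 := two_mul_tri (q / 2 - 2)
  linarith

theorem nN_of_gam {d q n m : ℤ} (h : gam d q = tri n + m + 1) (hn : 0 ≤ n) (hm : 0 ≤ m)
    (hmn : m ≤ n) : nN d q = n + 1 := by
  have h1 := two_mul_tri n
  unfold nN
  obtain ⟨k, rfl⟩ := Int.eq_ofNat_of_zero_le hn
  obtain ⟨l, rfl⟩ := Int.eq_ofNat_of_zero_le hm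
  have e : (8 * gam d q - 7).toNat = (2 * k + 1) * (2 * k + 1) + 8 * l := by
    have : 8 * gam d q - 7 = (((2 * k + 1) * (2 * k + 1) + 8 * l : ℕ) : ℤ) := by
      rw [h]; push_cast; linarith
    rw [this, Int.toNat_natCast]
  rw [e]
  have lo : 2 * k + 1 ≤ Nat.sqrt ((2 * k + 1) * (2 * k + 1) + 8 * l) := by
    rw [Nat.le_sqrt]; omega
  have hi : Nat.sqrt ((2 * k + 1) * (2 * k + 1) + 8 * l) < 2 * k + 3 := by
    rw [Nat.sqrt_lt]
    have : l ≤ k := by exact_mod_cast hmn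
    nlinarith
  omega

theorem mM_of_gam {d q n m : ℤ} (h : gam d q = tri n + m + 1) (hn : 0 ≤ n) (hm : 0 ≤ m)
    (hmn : m ≤ n) : mM d q = m + 1 := by
  unfold mM
  rw [nN_of_gam h hn hm hmn, h,
    show (n + 1 - 1) ^ 2 + (n + 1) - 1 = n * (n + 1) by ring]
  unfold tri; ring

/-- The block number with the parameters `D₀`, `a`, `n + 1`, `m + 1`. -/
def blockNo (q D a n m : ℤ) : ℤ :=
  D * blk q + ((if a = 0 then 0 else if a = 1 then tri (q / 2) else (q / 2) ^ 2) + (tri n + m))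

/-- The encoding `blockNo` is inverted by the functions that decode a block number. -/
theorem blockNo_spec {q D a n m : ℤ} (he : 1 ≤ q / 2) (ha : a = 0 ∨ a = 1 ∨ a = 2)
    (hn : 0 ≤ n) (hna : n < q / 2 - a) (hm : 0 ≤ m) (hmn : m ≤ n) :
    blockNo q D a n m / blk q = D ∧ aA (blockNo q D a n m) q = a ∧
      nN (blockNo q D a n m) q = n + 1 ∧ mM (blockNo q D a n m) q = m + 1 := by
  have hb := blk_eq q
  have t0 := two_mul_tri (q / 2)
  have t1 := two_mul_tri (q / 2 - 1)
  have s0 := tri_succ (q / 2 - 1)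
  have s1 := tri_succ (q / 2 - 2)
  rw [show q / 2 - 1 + 1 = q / 2 by ring] at s0
  rw [show q / 2 - 2 + 1 = q / 2 - 1 by ring] at s1
  have p1 := tri_nonneg (n := q / 2 - 1) (by omega)
  have p2 := tri_nonneg (n := q / 2 - 2) (by omega)
  have pn := tri_nonneg (n := n) (by omega)
  have hsq : (q / 2) ^ 2 = tri (q / 2) + tri (q / 2 - 1) := by linarith
  have hlt : tri n + m < tri (q / 2 - a) := by
    have := tri_mono (m := n + 1) (n := q / 2 - a) (by omega) (by omega)
    rw [tri_succ] at this
    omega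
  have htri : q / 2 * (q / 2 + 1) / 2 = tri (q / 2) := rfl
  set x := (if a = 0 then 0 else if a = 1 then tri (q / 2) else (q / 2) ^ 2) + (tri n + m) with hx
  have hx0 : 0 ≤ x := by rcases ha with rfl | rfl | rfl <;> simp at hx <;> omega
  have hx1 : x < blk q := by
    rcases ha with rfl | rfl | rfl <;> simp at hx hlt <;> omega
  have hbp : 0 < blk q := by omega
  have hd : blockNo q D a n m = D * blk q + x := rfl
  have hdiv : blockNo q D a n m / blk q = D := by
    rw [hd, add_comm, Int.add_mul_ediv_right _ _ hbp.ne', Int.ediv_eq_zero_of_lt hx0 hx1, zero_add]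
  have hmod : blockNo q D a n m % blk q = x := by
    rw [hd, add_comm, Int.add_mul_emod_self_right, Int.emod_eq_of_lt hx0 hx1]
  have hA : aA (blockNo q D a n m) q = a := by
    unfold aA
    rw [hmod, htri, hsq]
    rcases ha with rfl | rfl | rfl <;> simp at hx hlt
    · rw [if_pos (by omega)]
    · rw [if_neg (by omega), if_pos (by omega)]
    · rw [if_neg (by omega), if_neg (by omega)]
  have hg : gam (blockNo q D a n m) q = tri n + m + 1 := by
    unfold gam
    rw [hdiv, hA, hd, hx]
    rcases ha with rfl | rfl | rfl
    · simp; ring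
    · have : (1 * (q / 2) ^ 2 + 1 * (2 - 1) * (q / 2)) / 2 = tri (q / 2) := by
        rw [← htri]; congr 1; ring
      rw [this]; simp; ring
    · have : (2 * (q / 2) ^ 2 + 2 * (2 - 2) * (q / 2)) / 2 = (q / 2) ^ 2 := by
        rw [show 2 * (q / 2) ^ 2 + 2 * (2 - 2) * (q / 2) = 2 * (q / 2) ^ 2 by ring,
          Int.mul_ediv_cancel_left _ (by norm_num)]
      rw [this]; simp; ring
  exact ⟨hdiv, hA, nN_of_gam hg hn hm hmn, mM_of_gam hg hn hm hmn⟩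

theorem sum_blocks_aux {M : Type*} [AddCommMonoid M] {q : ℤ} (he : 1 ≤ q / 2) (F : ℤ → M) :
    ∑ d ∈ Finset.Ico 0 (nb q), F d = ∑ D ∈ Finset.Ico 0 6,
      ((∑ n ∈ Finset.Ico 0 (q / 2), ∑ m ∈ Finset.Ico 0 (n + 1), F (blockNo q D 0 n m))
      + ((∑ n ∈ Finset.Ico 0 (q / 2 - 1), ∑ m ∈ Finset.Ico 0 (n + 1), F (blockNo q D 1 n m))
      + ∑ n ∈ Finset.Ico 0 (q / 2 - 2), ∑ m ∈ Finset.Ico 0 (n + 1), F (blockNo q D 2 n m))) := by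
  have hb := blk_eq q
  have p0 := tri_nonneg (n := q / 2) (by omega)
  have p1 := tri_nonneg (n := q / 2 - 1) (by omega)
  have p2 := tri_nonneg (n := q / 2 - 2) (by omega)
  have t0 := two_mul_tri (q / 2)
  have t1 := two_mul_tri (q / 2 - 1)
  have hsq : (q / 2) ^ 2 = tri (q / 2) + tri (q / 2 - 1) := by linarith
  rw [nb_eq, sum_Ico_mul _ (by norm_num) (by omega)]
  refine Finset.sum_congr rfl fun D _ => ?_
  rw [hb, sum_Ico_add _ p0 (by omega), sum_Ico_add _ p1 p2, sum_Ico_tri _ (by omega),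
    sum_Ico_tri _ (by omega), sum_Ico_tri _ (by omega)]
  simp only [blockNo, if_true, one_ne_zero, if_false, hsq, zero_add, hb, two_ne_zero,
    OfNat.ofNat_ne_one, add_assoc]

/-- Summation over the blocks by means of their parameters `b`, `φ`, `a`, `n`, `m`. -/
theorem sum_blocks {M : Type*} [AddCommMonoid M] {q : ℤ} (he : 1 ≤ q / 2)
    (G : ℤ → ℤ → ℤ → ℤ → ℤ → M) :
    ∑ d ∈ Finset.Ico 0 (nb q), G (bB d q) (phi d q) (aA d q) (nN d q) (mM d q) =
    ∑ b ∈ Finset.Ico 0 2, ∑ φ ∈ Finset.Ico 0 3,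
      ((∑ n ∈ Finset.Ico 0 (q / 2), ∑ m ∈ Finset.Ico 0 (n + 1), G b φ 0 (n + 1) (m + 1))
      + ((∑ n ∈ Finset.Ico 0 (q / 2 - 1), ∑ m ∈ Finset.Ico 0 (n + 1), G b φ 1 (n + 1) (m + 1))
      + ∑ n ∈ Finset.Ico 0 (q / 2 - 2), ∑ m ∈ Finset.Ico 0 (n + 1), G b φ 2 (n + 1) (m + 1))) := by
  rw [sum_blocks_aux he, show (6 : ℤ) = 2 * 3 by norm_num,
    sum_Ico_mul _ (by norm_num) (by norm_num)]
  refine Finset.sum_congr rfl fun b hb => Finset.sum_congr rfl fun φ hφ => ?_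
  rw [Finset.mem_Ico] at hb hφ
  have key : ∀ a n m, (a = 0 ∨ a = 1 ∨ a = 2) → n ∈ Finset.Ico 0 (q / 2 - a) →
      m ∈ Finset.Ico 0 (n + 1) →
      G (bB (blockNo q (b * 3 + φ) a n m) q) (phi (blockNo q (b * 3 + φ) a n m) q)
        (aA (blockNo q (b * 3 + φ) a n m) q) (nN (blockNo q (b * 3 + φ) a n m) q)
        (mM (blockNo q (b * 3 + φ) a n m) q) = G b φ a (n + 1) (m + 1) := by
    intro a n m ha hn hm
    rw [Finset.mem_Ico] at hn hm
    obtain ⟨h1, h2, h3, h4⟩ := blockNo_spec (D := b * 3 + φ) he ha hn.1 hn.2 hm.1 (by omega)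
    rw [h2, h3, h4, bB, phi, h1, show (1 + (b * 3 + φ)) / 4 = b by omega,
      show b * 3 + φ - 3 * b = φ by ring]
  refine congrArg₂ _ ?_ (congrArg₂ _ ?_ ?_)
  · exact Finset.sum_congr rfl fun n hn => Finset.sum_congr rfl fun m hm =>
      key 0 n m (by simp) (by simpa using hn) hm
  · exact Finset.sum_congr rfl fun n hn => Finset.sum_congr rfl fun m hm =>
      key 1 n m (by simp) hn hm
  · exact Finset.sum_congr rfl fun n hn => Finset.sum_congr rfl fun m hm =>
      key 2 n m (by simp) hn hm

/-- The parameters of every block are in their ranges. -/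
theorem forall_blocks {q : ℤ} (he : 1 ≤ q / 2) {p : ℤ → ℤ → ℤ → ℤ → ℤ → Prop}
    (hp : ∀ b φ a n m, (b = 0 ∨ b = 1) → (φ = 0 ∨ φ = 1 ∨ φ = 2) → (a = 0 ∨ a = 1 ∨ a = 2) →
      1 ≤ m → m ≤ n → n ≤ q / 2 - a → p b φ a n m) {d : ℤ} (hd : 0 ≤ d) (hd' : d < nb q) :
    p (bB d q) (phi d q) (aA d q) (nN d q) (mM d q) := by
  classical
  -- The number of the blocks that violate `p` is computed by `sum_blocks`.
  have h := sum_blocks he fun b φ a n m => if p b φ a n m then (0 : ℕ) else 1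
  have key : ∀ b ∈ Finset.Ico (0 : ℤ) 2, ∀ φ ∈ Finset.Ico (0 : ℤ) 3, ∀ a : ℤ,
      (a = 0 ∨ a = 1 ∨ a = 2) → ∑ n ∈ Finset.Ico 0 (q / 2 - a), ∑ m ∈ Finset.Ico 0 (n + 1),
        (if p b φ a (n + 1) (m + 1) then (0 : ℕ) else 1) = 0 := by
    intro b hb φ hφ a ha
    refine Finset.sum_eq_zero fun n hn => Finset.sum_eq_zero fun m hm => ?_
    rw [Finset.mem_Ico] at *
    rw [if_pos]
    exact hp _ _ _ _ _ (by omega) (by omega) ha (by omega) (by omega) (by omega)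
  rw [Finset.sum_eq_zero (s := Finset.Ico 0 2) fun b hb => Finset.sum_eq_zero fun φ hφ => by
    have := key b hb φ hφ 0 (by simp)
    rw [sub_zero] at this
    rw [this, key b hb φ hφ 1 (by simp), key b hb φ hφ 2 (by simp)]; rfl,
    Finset.sum_eq_zero_iff] at h
  by_contra hn
  have := h d (Finset.mem_Ico.2 ⟨hd, hd'⟩)
  rw [if_neg hn] at this
  exact one_ne_zero this

/-! ### The number of the convective terms -/

theorem sum_Ico_poly {N : ℤ} (hN : 0 ≤ N) (c₀ c₁ c₂ c₃ c₄ : ℚ) :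
    ∑ n ∈ Finset.Ico 0 N,
      (c₀ + c₁ * (n : ℚ) + c₂ * (n : ℚ) ^ 2 + c₃ * (n : ℚ) ^ 3 + c₄ * (n : ℚ) ^ 4) =
    c₀ * N + c₁ * (N * (N - 1) / 2) + c₂ * (N * (N - 1) * (2 * N - 1) / 6)
      + c₃ * (N * (N - 1) / 2) ^ 2
      + c₄ * (N * (N - 1) * (2 * N - 1) * (3 * N ^ 2 - 3 * N - 1) / 30) := by
  induction N, hN using Int.leInduction with
  | base => simp
  | succ n hn ih =>
    rw [sum_Ico_succ _ hn, ih]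
    push_cast
    ring

theorem sum_Ico_linear_mul_cubic {N : ℤ} (hN : 0 ≤ N) (x₀ x₁ y₀ y₁ y₂ y₃ : ℚ) :
    ∑ n ∈ Finset.Ico 0 N, (x₀ + x₁ * (n : ℚ)) *
      (y₀ + y₁ * (n : ℚ) + y₂ * (n : ℚ) ^ 2 + y₃ * (n : ℚ) ^ 3) =
    x₀ * y₀ * N + (x₀ * y₁ + x₁ * y₀) * (N * (N - 1) / 2)
      + (x₀ * y₂ + x₁ * y₁) * (N * (N - 1) * (2 * N - 1) / 6)
      + (x₀ * y₃ + x₁ * y₂) * (N * (N - 1) / 2) ^ 2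
      + x₁ * y₃ * (N * (N - 1) * (2 * N - 1) * (3 * N ^ 2 - 3 * N - 1) / 30) := by
  rw [← sum_Ico_poly hN]
  exact Finset.sum_congr rfl fun n _ => by ring

theorem sum_Ico_product {n : ℤ} (hn : 0 ≤ n) (u v : ℚ) :
    ∑ m ∈ Finset.Ico 0 (n + 1), (u + 2 * (n : ℚ) - 2 * (m : ℚ)) * (v + 2 * (m : ℚ)) =
      u * v + (u * v + u + v - 2 / 3) * n + (u + v) * (n : ℚ) ^ 2 + 2 / 3 * (n : ℚ) ^ 3 := by
  have h := sum_Ico_poly (N := n + 1) (by omega) ((u + 2 * n) * v) (2 * (u + 2 * n) - 2 * v) (-4) 0 0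
  refine Eq.trans (Finset.sum_congr rfl fun m _ => ?_) (h.trans ?_)
  · ring
  · push_cast; ring

/-- The number of terms of a convective block with the parameters `b`, `a`, `n`, `m`. -/
def boxSize (s : Idx) (b a n m : ℤ) : ℤ :=
  (s1 s a n m b + 1) * (s2 s.q a n b + 1) * (s3 s a n m b + 1)

theorem SS_eq_boxSize (s : Idx) (d : ℤ) :
    SS s d = boxSize s (bB d s.q) (aA d s.q) (nN d s.q) (mM d s.q) := rfl

/-- The numbers of terms of the blocks with a given `b`, with the sums over `m` carried out: what
remains are sums of polynomials in `n`. -/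
theorem sum_boxSize {s : Idx} (hα : s.a = 1 ∨ s.a = 2) {A B : ℤ}
    (hA : A = X s s.a) (hB : B = X s (3 - s.a)) (b : ℤ) :
    (((∑ n ∈ Finset.Ico 0 (s.q / 2), ∑ m ∈ Finset.Ico 0 (n + 1), boxSize s b 0 (n + 1) (m + 1))
      + ((∑ n ∈ Finset.Ico 0 (s.q / 2 - 1), ∑ m ∈ Finset.Ico 0 (n + 1),
          boxSize s b 1 (n + 1) (m + 1))
      + ∑ n ∈ Finset.Ico 0 (s.q / 2 - 2), ∑ m ∈ Finset.Ico 0 (n + 1),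
          boxSize s b 2 (n + 1) (m + 1)) : ℤ) : ℚ) =
    (∑ n ∈ Finset.Ico 0 (s.q / 2), (((s.q : ℚ) - 2 * (s.q / 2 : ℤ) + b + 2) + 2 * (n : ℚ)) *
      (((B : ℚ) + 1) * ((A : ℚ) + 2 * (s.q / 2 : ℤ) - b)
        + ((B : ℚ) + 1) * ((A : ℚ) + 2 * (s.q / 2 : ℤ) - b - 2) * (n : ℚ)
        + ((B : ℚ) + 1) * (-2) * (n : ℚ) ^ 2 + 0 * (n : ℚ) ^ 3))
    + ((∑ n ∈ Finset.Ico 0 (s.q / 2 - 1), (((s.q : ℚ) - 2 + b) + (-2) * (n : ℚ)) *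
      (((A : ℚ) + 2) * (B + 3 - b) + (((A : ℚ) + 2) * (B + 3 - b) + ((A : ℚ) + 2) + (B + 3 - b)
        - 2 / 3) * n + (((A : ℚ) + 2) + (B + 3 - b)) * (n : ℚ) ^ 2 + 2 / 3 * (n : ℚ) ^ 3))
    + ∑ n ∈ Finset.Ico 0 (s.q / 2 - 2), (((s.q : ℚ) - 4 + b) + (-2) * (n : ℚ)) *
      (((A : ℚ) + 4 - b) * (B + 3) + (((A : ℚ) + 4 - b) * (B + 3) + ((A : ℚ) + 4 - b) + (B + 3)
        - 2 / 3) * n + (((A : ℚ) + 4 - b) + (B + 3)) * (n : ℚ) ^ 2 + 2 / 3 * (n : ℚ) ^ 3)) := by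
  push_cast
  refine congrArg₂ _ ?_ (congrArg₂ _ ?_ ?_)
  · refine Finset.sum_congr rfl fun n hn => ?_
    rw [Finset.mem_Ico] at hn
    have e1 : ∀ m ∈ Finset.Ico 0 (n + 1), ((boxSize s b 0 (n + 1) (m + 1) : ℤ) : ℚ) =
        ((A : ℚ) + 2 * (s.q / 2 : ℤ) - b - 2 * n) * ((s.q : ℚ) - 2 * (s.q / 2 : ℤ) + b + 2 + 2 * n)
          * (B + 1) := by
      intro m _
      unfold boxSize s1 s2 s3
      rw [hA, hB]
      unfold X
      rcases hα with h | h <;> rw [h] <;>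
        norm_num [-mul_eq_mul_right_iff, -mul_eq_mul_left_iff] <;> ring
    rw [Finset.sum_congr rfl e1, Finset.sum_const, Int.card_Ico, nsmul_eq_mul]
    have : (((n + 1 - 0).toNat : ℕ) : ℚ) = n + 1 := by
      have : ((n + 1 - 0).toNat : ℤ) = n + 1 := by omega
      exact_mod_cast this
    rw [this]
    ring
  · refine Finset.sum_congr rfl fun n hn => ?_
    rw [Finset.mem_Ico] at hn
    rw [← sum_Ico_product hn.1, Finset.mul_sum]
    refine Finset.sum_congr rfl fun m _ => ?_
    unfold boxSize s1 s2 s3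
    rw [hA, hB]
    unfold X
    rcases hα with h | h <;> rw [h] <;> norm_num [sg] <;> ring
  · refine Finset.sum_congr rfl fun n hn => ?_
    rw [Finset.mem_Ico] at hn
    rw [← sum_Ico_product hn.1, Finset.mul_sum]
    refine Finset.sum_congr rfl fun m _ => ?_
    unfold boxSize s1 s2 s3
    rw [hA, hB]
    unfold X
    rcases hα with h | h <;> rw [h] <;> norm_num [sg] <;> ring

/-- The polynomial `σ` counts the convective terms. -/
theorem sigma_eq_sum {s : Idx} (hα : s.a = 1 ∨ s.a = 2) (he : 1 ≤ s.q / 2) :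
    sigma s = ∑ d ∈ Finset.Ico 0 (nb s.q), SS s d := by
  have h := sum_blocks (M := ℤ) he fun b _ a n m => boxSize s b a n m
  have hsum : ((∑ d ∈ Finset.Ico 0 (nb s.q), SS s d : ℤ) : ℚ) =
      sigmaPoly ((s.q / 2 : ℤ) : ℚ) (s.q : ℚ) (X s s.a : ℚ) (X s (3 - s.a) : ℚ) := by
    rw [Finset.sum_congr rfl fun d _ => SS_eq_boxSize s d, h]
    simp only [Finset.sum_const, Int.card_Ico]
    rw [Int.cast_sum, show Finset.Ico (0 : ℤ) 2 = {0, 1} from rfl,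
      Finset.sum_pair (by norm_num)]
    rw [nsmul_eq_mul, nsmul_eq_mul, Int.cast_mul, Int.cast_mul, sum_boxSize hα rfl rfl,
      sum_boxSize hα rfl rfl]
    generalize (X s s.a : ℚ) = A, (X s (3 - s.a) : ℚ) = B, (s.q : ℚ) = q
    rcases eq_or_lt_of_le he with h1 | h1
    · rw [← h1]
      norm_num [sigmaPoly, Finset.sum_Ico_consecutive, show Finset.Ico (0 : ℤ) 1 = {0} from rfl]
      ring
    · rw [sum_Ico_linear_mul_cubic (by omega), sum_Ico_linear_mul_cubic (by omega),
        sum_Ico_linear_mul_cubic (by omega), sum_Ico_linear_mul_cubic (by omega),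
        sum_Ico_linear_mul_cubic (by omega), sum_Ico_linear_mul_cubic (by omega)]
      unfold sigmaPoly
      push_cast
      generalize ((s.q / 2 : ℤ) : ℚ) = e
      norm_num
      ring
  unfold sigma
  rw [← hsum, Int.floor_intCast]

/-! ### Decoding of the summation number -/

/-- Ranges of the data of a block of an inner index. -/
theorem block_ranges {s : Idx} (hα : s.a = 1 ∨ s.a = 2) (hp : 1 < s.p) (hq : 1 < s.q)
    (hr : 1 < s.r) {d : ℤ} (hd : 0 ≤ d) (hd' : d < nb s.q) :
    (0 ≤ S1 s d ∧ 0 ≤ S2 s d ∧ 0 ≤ S3 s d) ∧ (Y1 s d = S1 s d ∧ Y0 s d = S2 s d ∧ Y2 s d = S3 s d)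
      ∧ (bB d s.q = 0 ∨ bB d s.q = 1) ∧ (phi d s.q = 0 ∨ phi d s.q = 1 ∨ phi d s.q = 2)
      ∧ (aA d s.q = 0 ∨ aA d s.q = 1 ∨ aA d s.q = 2) := by
  obtain ⟨w, p, q, r, α⟩ := s
  dsimp only at *
  refine forall_blocks (q := q) (p := fun b φ a n m =>
    (0 ≤ s1 ⟨w, p, q, r, α⟩ a n m b ∧ 0 ≤ s2 q a n b ∧ 0 ≤ s3 ⟨w, p, q, r, α⟩ a n m b) ∧
    (y1 ⟨w, p, q, r, α⟩ a n m b = s1 ⟨w, p, q, r, α⟩ a n m b ∧ y0 q a n b = s2 q a n b ∧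
      y2 ⟨w, p, q, r, α⟩ a n m b = s3 ⟨w, p, q, r, α⟩ a n m b)
    ∧ (b = 0 ∨ b = 1) ∧ (φ = 0 ∨ φ = 1 ∨ φ = 2) ∧ (a = 0 ∨ a = 1 ∨ a = 2))
    (by omega) ?_ hd hd'
  intro b φ a n m hb hφ ha hm hmn hn
  refine ⟨⟨?_, ?_, ?_⟩, ⟨?_, ?_, ?_⟩, hb, hφ, ha⟩
  all_goals
    simp only [s1, s2, s3, y0, y1, y2]
    rcases ha with rfl | rfl | rfl <;> rcases hα with rfl | rfl <;>
      norm_num [sg] <;> omega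

theorem SS_pos {s : Idx} (hα : s.a = 1 ∨ s.a = 2) (hp : 1 < s.p) (hq : 1 < s.q)
    (hr : 1 < s.r) {d : ℤ} (hd : 0 ≤ d) (hd' : d < nb s.q) : 0 < SS s d := by
  obtain ⟨⟨h1, h2, h3⟩, -⟩ := block_ranges hα hp hq hr hd hd'
  unfold SS
  positivity

theorem nb_pos {q : ℤ} (hq : 1 < q) : 0 < nb q := by
  have he : 1 ≤ q / 2 := by omega
  unfold nb
  nlinarith

theorem sigma_pos {s : Idx} (hα : s.a = 1 ∨ s.a = 2) (hp : 1 < s.p) (hq : 1 < s.q)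
    (hr : 1 < s.r) : 0 < sigma s := by
  rw [sigma_eq_sum hα (by omega)]
  refine Finset.sum_pos (fun d hd => ?_) ⟨0, Finset.mem_Ico.2 ⟨le_rfl, nb_pos hq⟩⟩
  rw [Finset.mem_Ico] at hd
  exact SS_pos hα hp hq hr hd.1 hd.2

theorem heav_eq {x y : ℤ} (hy : 0 < y) :
    heav ((x : ℚ) / (y : ℚ) - 1) = if y ≤ x then 1 else 0 := by
  unfold heav
  have : (0 : ℚ) ≤ (x : ℚ) / (y : ℚ) - 1 ↔ y ≤ x := by
    rw [sub_nonneg, le_div_iff₀ (by exact_mod_cast hy), one_mul]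
    exact_mod_cast Iff.rfl
  simp only [this]

/-- The functions `dD` and `iI` find the block and the place in the block. -/
theorem dD_iI_eq {s : Idx} (hα : s.a = 1 ∨ s.a = 2) (hp : 1 < s.p) (hq : 1 < s.q)
    (hr : 1 < s.r) {d t : ℤ} (hd : 0 ≤ d) (hd' : d < nb s.q) (ht : 0 ≤ t) (ht' : t < SS s d) :
    dD s ((∑ k ∈ Finset.Ico 0 d, SS s k) + t + 1) = d ∧
      iI s ((∑ k ∈ Finset.Ico 0 d, SS s k) + t + 1) = t + 1 := by
  have hS : ∀ k, 0 ≤ k → k < nb s.q → 0 ≤ SS s k := fun k h h' => (SS_pos hα hp hq hr h h').le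
  have key : ∀ j ∈ Finset.Icc 1 (nb s.q),
      heav (((((∑ k ∈ Finset.Ico 0 d, SS s k) + t + 1) - 1 : ℤ) : ℚ)
        / ((∑ k ∈ Finset.Icc 0 (j - 1), SS s k : ℤ) : ℚ) - 1) = if j ≤ d then 1 else 0 := by
    intro j hj
    rw [Finset.mem_Icc] at hj
    rw [Icc_zero_eq_Ico, sub_add_cancel]
    have hpos : 0 < ∑ k ∈ Finset.Ico 0 j, SS s k := by
      refine Finset.sum_pos (fun k hk => ?_) ⟨0, Finset.mem_Ico.2 ⟨le_rfl, by omega⟩⟩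
      rw [Finset.mem_Ico] at hk
      exact SS_pos hα hp hq hr hk.1 (by omega)
    rw [heav_eq hpos]
    by_cases hjd : j ≤ d
    · have := sum_Ico_le_of_lt hS hjd hd'.le
      rw [if_pos (by omega), if_pos hjd]
    · have := sum_Ico_le_of_lt hS (show d + 1 ≤ j by omega) hj.2
      rw [sum_Ico_succ _ hd] at this
      rw [if_neg (by omega), if_neg hjd]
  have hfil : (Finset.Icc 1 (nb s.q)).filter (fun j => j ≤ d) = Finset.Icc 1 d := by
    ext j; simp only [Finset.mem_filter, Finset.mem_Icc]; omega
  constructor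
  · unfold dD
    rw [Finset.sum_congr rfl key, ← Finset.sum_filter, hfil]
    simp [hd]
  · unfold iI
    have e : ∑ j ∈ Finset.Icc 1 (nb s.q), SS s (j - 1) *
        heav (((((∑ k ∈ Finset.Ico 0 d, SS s k) + t + 1) - 1 : ℤ) : ℚ)
          / ((∑ k ∈ Finset.Icc 0 (j - 1), SS s k : ℤ) : ℚ) - 1) =
        ∑ j ∈ Finset.Icc 1 (nb s.q), if j ≤ d then SS s (j - 1) else 0 :=
      Finset.sum_congr rfl fun j hj => by rw [key j hj, mul_ite, mul_one, mul_zero]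
    rw [e, ← Finset.sum_filter, hfil]
    have : ∑ j ∈ Finset.Icc 1 d, SS s (j - 1) = ∑ k ∈ Finset.Ico 0 d, SS s k := by
      refine Finset.sum_bij' (fun j _ => j - 1) (fun j _ => j + 1) ?_ ?_ ?_ ?_ ?_
      all_goals intro j hj
      · simp only [Finset.mem_Ico, Finset.mem_Icc] at *; omega
      · simp only [Finset.mem_Ico, Finset.mem_Icc] at *; omega
      all_goals simp
    rw [this]; ring

/-- The sum over the numbers `i < σ ω` in terms of the time order `k`, of the block `d` and of the
place `(x, y, z)` in the block. -/
theorem sum_convective {M : Type*} [AddCommMonoid M] {s : Idx} (hα : s.a = 1 ∨ s.a = 2)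
    (hw : 0 < s.w) (hp : 1 < s.p) (hq : 1 < s.q) (hr : 1 < s.r) (F : ℤ → ℤ → ℤ → M) :
    ∑ i ∈ Finset.Ico 0 (sigma s * s.w), F (i / sigma s) (dD s (tau s i)) (iI s (tau s i)) =
      ∑ d ∈ Finset.Ico 0 (nb s.q), ∑ k ∈ Finset.Ico 0 s.w, ∑ t ∈ Finset.Ico 0 (SS s d),
        F k d (t + 1) := by
  have hσ := sigma_pos hα hp hq hr
  rw [mul_comm, sum_Ico_mul _ hw.le hσ.le,
    Finset.sum_comm (s := Finset.Ico 0 (nb s.q))]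
  refine Finset.sum_congr rfl fun k _ => ?_
  have h1 : ∀ j ∈ Finset.Ico 0 (sigma s), F ((k * sigma s + j) / sigma s)
      (dD s (tau s (k * sigma s + j))) (iI s (tau s (k * sigma s + j))) =
      F k (dD s (j + 1)) (iI s (j + 1)) := by
    intro j hj
    rw [Finset.mem_Ico] at hj
    have hdiv : (k * sigma s + j) / sigma s = k := by
      rw [add_comm, Int.add_mul_ediv_right _ _ hσ.ne', Int.ediv_eq_zero_of_lt hj.1 hj.2, zero_add]
    have : tau s (k * sigma s + j) = j + 1 := by unfold tau; rw [hdiv]; ring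
    rw [hdiv, this]
  rw [Finset.sum_congr rfl h1, sigma_eq_sum hα (by omega), sum_Ico_blocks _ _ (nb_pos hq).le
    (fun k h h' => (SS_pos hα hp hq hr h h').le)]
  refine Finset.sum_congr rfl fun d hd => Finset.sum_congr rfl fun t ht => ?_
  rw [Finset.mem_Ico] at hd ht
  obtain ⟨e1, e2⟩ := dD_iI_eq hα hp hq hr hd.1 hd.2 ht.1 ht.2
  rw [e1, e2]

/-- The block and the place of the number `i` are in their ranges. -/
theorem dD_mem {s : Idx} (hα : s.a = 1 ∨ s.a = 2)
    (hw : 0 < s.w) (hp : 1 < s.p) (hq : 1 < s.q) (hr : 1 < s.r) {i : ℤ} (hi : 0 ≤ i)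
    (hi' : i < sigma s * s.w) : 0 ≤ dD s (tau s i) ∧ dD s (tau s i) < nb s.q := by
  classical
  -- The number of the violations is computed by `sum_convective`.
  have h := sum_convective hα hw hp hq hr
    fun _ d _ => if 0 ≤ d ∧ d < nb s.q then (0 : ℕ) else 1
  rw [Finset.sum_eq_zero (s := Finset.Ico 0 (nb s.q)) fun d hd => Finset.sum_eq_zero fun k _ =>
    Finset.sum_eq_zero fun t _ => if_pos (Finset.mem_Ico.1 hd), Finset.sum_eq_zero_iff] at h
  by_contra hn
  have := h i (Finset.mem_Ico.2 ⟨hi, hi'⟩)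
  rw [if_neg hn] at this
  exact one_ne_zero this

/-- The place in a block of sides `a`, `b`, `c`. -/
theorem sum_box {M : Type*} [AddCommMonoid M] {a b c : ℤ} (ha : 0 ≤ a) (hb : 0 < b) (hc : 0 < c)
    (H : ℤ → ℤ → ℤ → M) :
    ∑ t ∈ Finset.Ico 0 (a * b * c), H (t / (c * b)) (t / c - b * (t / (c * b))) (t % c) =
      ∑ x ∈ Finset.Ico 0 a, ∑ y ∈ Finset.Ico 0 b, ∑ z ∈ Finset.Ico 0 c, H x y z := by
  rw [mul_assoc, sum_Ico_mul _ ha (by positivity)]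
  refine Finset.sum_congr rfl fun x _ => ?_
  rw [sum_Ico_mul _ hb.le hc.le]
  refine Finset.sum_congr rfl fun y hy => Finset.sum_congr rfl fun z hz => ?_
  rw [Finset.mem_Ico] at hy hz
  have h1 : (x * (b * c) + (y * c + z)) / c = x * b + y := by
    rw [show x * (b * c) + (y * c + z) = z + (x * b + y) * c by ring,
      Int.add_mul_ediv_right _ _ hc.ne', Int.ediv_eq_zero_of_lt hz.1 hz.2, zero_add]
  have h2 : (x * (b * c) + (y * c + z)) / (c * b) = x := by
    rw [← Int.ediv_ediv_of_nonneg hc.le, h1, add_comm, Int.add_mul_ediv_right _ _ hb.ne',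
      Int.ediv_eq_zero_of_lt hy.1 hy.2, zero_add]
  have h3 : (x * (b * c) + (y * c + z)) % c = z := by
    rw [show x * (b * c) + (y * c + z) = z + (x * b + y) * c by ring,
      Int.add_mul_emod_self_right, Int.emod_eq_of_lt hz.1 hz.2]
  rw [h1, h2, h3, show x * b + y - b * x = y by ring]

theorem sum_Ico_natCast {M : Type*} [AddCommMonoid M] (n : ℕ) (F : ℤ → M) :
    ∑ k ∈ Finset.Ico (0 : ℤ) n, F k = ∑ k ∈ Finset.range n, F k := by
  induction n with
  | zero => simp
  | succ n ih =>
    rw [Nat.cast_succ, sum_Ico_succ _ (Int.natCast_nonneg n), ih, Finset.sum_range_succ]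

theorem sum_Icc_one {M : Type*} [AddCommMonoid M] (n : ℤ) (F : ℤ → M) :
    ∑ k ∈ Finset.Icc 1 n, F k = ∑ k ∈ Finset.range n.toNat, F (k + 1) := by
  rw [← sum_Ico_natCast n.toNat fun k => F (k + 1)]
  refine Finset.sum_bij' (fun j _ => j - 1) (fun j _ => j + 1) ?_ ?_ ?_ ?_ ?_
  all_goals intro j hj
  · simp only [Finset.mem_Ico, Finset.mem_Icc] at *; omega
  · simp only [Finset.mem_Ico, Finset.mem_Icc] at *; omega
  all_goals simp

/-! ### The convective terms -/

theorem uZ_of_eq (c : Fin 3 → Coeffs) {s : Idx} {w p q r : ℕ} (hw : s.w = w) (hp : s.p = p)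
    (hq : s.q = q) (hr : s.r = r) : uZ c s = c (comp s.a) w p q r := by
  unfold uZ
  rw [if_neg (by simp [P2, hw, hp, hq, hr]), hw, hp, hq, hr]
  simp

/-- The contribution of a block is a coefficient of the convective term of one direction. -/
theorem sum_block (u : Fin 3 → Coeffs) {s : Idx} (hα : s.a = 1 ∨ s.a = 2) (hw : 0 < s.w)
    (hp : 1 < s.p) (hq : 1 < s.q) (hr : 1 < s.r) {d : ℤ} (hd : 0 ≤ d) (hd' : d < nb s.q) (β : ℤ) :
    ∑ k ∈ Finset.Ico 0 s.w, ∑ t ∈ Finset.Ico 0 (SS s d), gG s d (t + 1) *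
      (uZ u ⟨k, W1 s d (t + 1), W0 s d (t + 1), W2 s d (t + 1), β⟩ *
        uZ u ⟨s.w - 1 - k, V1 s d (t + 1), V0 s d (t + 1), V2 s d (t + 1), phi d s.q⟩) =
    hH s.q (aA d s.q) (nN d s.q) (mM d s.q) (bB d s.q) *
      (fac (S2 s d) * fac (S1 s d) * fac (S3 s d) / (fac s.p * fac s.q * fac s.r)) *
      fMul (u (comp (phi d s.q))) (fS (comp (phi d s.q)) (u (comp β))) (s.w - 1).toNat
        (S1 s d).toNat (S2 s d).toNat (S3 s d).toNat := by
  obtain ⟨⟨h1, h2, h3⟩, ⟨y1, y0, y2⟩, -, hφ, -⟩ := block_ranges hα hp hq hr hd hd'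
  have hbox : ∀ k : ℤ, ∑ t ∈ Finset.Ico 0 (SS s d), gG s d (t + 1) *
      (uZ u ⟨k, W1 s d (t + 1), W0 s d (t + 1), W2 s d (t + 1), β⟩ *
        uZ u ⟨s.w - 1 - k, V1 s d (t + 1), V0 s d (t + 1), V2 s d (t + 1), phi d s.q⟩) =
      ∑ x ∈ Finset.Ico 0 (S1 s d + 1), ∑ y ∈ Finset.Ico 0 (S2 s d + 1),
        ∑ z ∈ Finset.Ico 0 (S3 s d + 1),
        hH s.q (aA d s.q) (nN d s.q) (mM d s.q) (bB d s.q)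
          * ((e0 (phi d s.q) * y + e1 (phi d s.q) * x + e2 (phi d s.q) * z + 1 : ℤ) : ℝ)
          * (fac (S2 s d) * fac (S1 s d) * fac (S3 s d) / (fac s.p * fac s.q * fac s.r)) *
          (uZ u ⟨k, e1 (phi d s.q) + x, e0 (phi d s.q) + y, e2 (phi d s.q) + z, β⟩ *
          uZ u ⟨s.w - 1 - k, S1 s d - x, S2 s d - y, S3 s d - z, phi d s.q⟩) := by
    intro k
    rw [← sum_box (by omega) (by omega) (by omega)]
    refine Finset.sum_congr rfl fun t _ => ?_
    unfold gG W0 W1 W2 V0 V1 V2 L0 L1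
    rw [y1, y0, y2, add_sub_cancel_right]
    congr 3
    · rw [add_sub_assoc]
    · congr 1 <;> ring
  rw [Finset.sum_congr rfl fun k _ => hbox k]
  generalize hH s.q (aA d s.q) (nN d s.q) (mM d s.q) (bB d s.q) = H
  generalize (fac (S2 s d) * fac (S1 s d) * fac (S3 s d) / (fac s.p * fac s.q * fac s.r)) = Φ
  generalize S1 s d = a at *
  generalize S2 s d = b at *
  generalize S3 s d = c at *
  generalize phi d s.q = φ at *
  obtain ⟨ω, hω⟩ : ∃ ω : ℕ, s.w = ω + 1 := ⟨(s.w - 1).toNat, by omega⟩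
  obtain ⟨a, rfl⟩ := Int.eq_ofNat_of_zero_le h1
  obtain ⟨b, rfl⟩ := Int.eq_ofNat_of_zero_le h2
  obtain ⟨c, rfl⟩ := Int.eq_ofNat_of_zero_le h3
  rw [hω]
  simp only [← Nat.cast_succ, sum_Ico_natCast]
  rw [show ((ω.succ : ℤ) - 1).toNat = ω by simp]
  simp only [Int.toNat_natCast, fMul, Nat.succ_eq_add_one, Finset.mul_sum]
  refine Finset.sum_congr rfl fun k hk => Finset.sum_congr rfl fun x hx =>
    Finset.sum_congr rfl fun y hy => Finset.sum_congr rfl fun z hz => ?_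
  rw [Finset.mem_range] at hk hx hy hz
  have eV : uZ u ⟨((ω + 1 : ℕ) : ℤ) - 1 - k, (a : ℤ) - x, (b : ℤ) - y, (c : ℤ) - z, φ⟩ =
      u (comp φ) (ω - k) (a - x) (b - y) (c - z) :=
    uZ_of_eq u (by dsimp only; omega) (by dsimp only; omega) (by dsimp only; omega)
      (by dsimp only; omega)
  rw [eV]
  rcases hφ with rfl | rfl | rfl
  · have eW : uZ u ⟨(k : ℤ), e1 0 + x, e0 0 + y, e2 0 + z, β⟩ = u (comp β) k x (y + 1) z := by
      apply uZ_of_eq <;> simp [e0, e1, e2, add_comm]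
    rw [eW]
    simp [fS, comp, e0, e1, e2]
    ring
  · have eW : uZ u ⟨(k : ℤ), e1 1 + x, e0 1 + y, e2 1 + z, β⟩ = u (comp β) k (x + 1) y z := by
      apply uZ_of_eq <;> simp [e0, e1, e2, add_comm]
    rw [eW]
    simp [fS, comp, e0, e1, e2]
    ring
  · have eW : uZ u ⟨(k : ℤ), e1 2 + x, e0 2 + y, e2 2 + z, β⟩ = u (comp β) k x y (z + 1) := by
      apply uZ_of_eq <;> simp [e0, e1, e2, add_comm]
    rw [eW]
    simp [fS, comp, e0, e1, e2]
    ring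

/-- The coefficients of the convective term `U · ∇ U^β`. -/
def conv (u : Fin 3 → Coeffs) (β : Fin 3) : Coeffs :=
  fun ω p q r => ∑ φ, fMul (u φ) (fS φ (u β)) ω p q r

/-- The normalized coefficient of `U · ∇ U^β` at integer indices. -/
def convZ (u : Fin 3 → Coeffs) (β : ℤ) (ω p q r : ℤ) : ℝ :=
  fac q * fac p * fac r * conv u (comp β) ω.toNat p.toNat q.toNat r.toNat

/-- The contribution of a group of blocks with the same `b`, `a`, `n`, `m`. -/
def convBlock (u : Fin 3 → Coeffs) (s : Idx) (b a n m : ℤ) : ℝ :=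
  hH s.q a n m b * convZ u (b * (s.a + a * (a - 2) * (2 * s.a - 3))) (s.w - 1)
    (s1 s a n m b) (s2 s.q a n b) (s3 s a n m b)

theorem childT12_of_lt {s : Idx} (hl : ¬ IsLeaf s) {i : ℤ} (hi : i < sigma s * s.w) :
    childT12 s i = ⟨i / sigma s, W1 s (dD s (tau s i)) (iI s (tau s i)),
      W0 s (dD s (tau s i)) (iI s (tau s i)), W2 s (dD s (tau s i)) (iI s (tau s i)),
      bB (dD s (tau s i)) s.q * (s.a + aA (dD s (tau s i)) s.q
        * (aA (dD s (tau s i)) s.q - 2) * (2 * s.a - 3))⟩ := by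
  unfold childT12
  rw [if_neg fun h => hl (Or.inl h), if_neg fun h => hl (Or.inr h), if_pos hi]

theorem childZ12_eq {s : Idx} (hl : ¬ IsLeaf s) (i : ℤ) :
    childZ12 s i = ⟨s.w - 1 - i / sigma s, V1 s (dD s (tau s i)) (iI s (tau s i)),
      V0 s (dD s (tau s i)) (iI s (tau s i)), V2 s (dD s (tau s i)) (iI s (tau s i)),
      phi (dD s (tau s i)) s.q⟩ := by
  unfold childZ12
  rw [if_neg hl]

theorem Gam12_of_lt (ν : ℝ) (g c : Fin 3 → Coeffs) {s : Idx} (hl : ¬ IsLeaf s) {i : ℤ}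
    (hi : i < sigma s * s.w) :
    Gam12 ν g c s i = 1 / (s.w : ℝ) * gG s (dD s (tau s i)) (iI s (tau s i)) := by
  unfold Gam12
  rw [if_neg hl, if_pos hi]

theorem sum_convective_eq_blocks (ν : ℝ) (g c u : Fin 3 → Coeffs) {s : Idx}
    (hα : s.a = 1 ∨ s.a = 2) (hl : ¬ IsLeaf s) (hw : 0 < s.w) (hp : 1 < s.p) (hq : 1 < s.q)
    (hr : 1 < s.r) :
    ∑ i ∈ Finset.Ico 0 (sigma s * s.w),
      Gam12 ν g c s i * (uZ u (childT12 s i) * uZ u (childZ12 s i)) =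
    1 / ((s.w : ℝ) * (fac s.p * fac s.q * fac s.r)) * ∑ b ∈ Finset.Ico 0 2,
      ((∑ n ∈ Finset.Ico 0 (s.q / 2), ∑ m ∈ Finset.Ico 0 (n + 1),
          convBlock u s b 0 (n + 1) (m + 1))
      + ((∑ n ∈ Finset.Ico 0 (s.q / 2 - 1), ∑ m ∈ Finset.Ico 0 (n + 1),
          convBlock u s b 1 (n + 1) (m + 1))
      + ∑ n ∈ Finset.Ico 0 (s.q / 2 - 2), ∑ m ∈ Finset.Ico 0 (n + 1),
          convBlock u s b 2 (n + 1) (m + 1))) := by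
  obtain ⟨F, hF⟩ : ∃ F : ℤ → ℤ → ℤ → ℝ, F = (fun k d t => 1 / (s.w : ℝ) * (gG s d t * (uZ u ⟨k, W1 s d t, W0 s d t, W2 s d t,
          bB d s.q * (s.a + aA d s.q * (aA d s.q - 2) * (2 * s.a - 3))⟩ *
        uZ u ⟨s.w - 1 - k, V1 s d t, V0 s d t, V2 s d t, phi d s.q⟩))) := ⟨_, rfl⟩
  obtain ⟨G, hG⟩ : ∃ G : ℤ → ℤ → ℤ → ℤ → ℤ → ℝ, G = (fun b φ a n m => hH s.q a n m b *
        (fac (s2 s.q a n b) * fac (s1 s a n m b) * fac (s3 s a n m b) *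
        fMul (u (comp φ)) (fS (comp φ) (u (comp (b * (s.a + a * (a - 2) * (2 * s.a - 3))))))
        (s.w - 1).toNat (s1 s a n m b).toNat (s2 s.q a n b).toNat (s3 s a n m b).toNat)) :=
    ⟨_, rfl⟩
  have h1 : ∀ i ∈ Finset.Ico 0 (sigma s * s.w),
      Gam12 ν g c s i * (uZ u (childT12 s i) * uZ u (childZ12 s i)) =
      F (i / sigma s) (dD s (tau s i)) (iI s (tau s i)) := by
    intro i hi
    rw [Finset.mem_Ico] at hi
    subst hF
    rw [childT12_of_lt hl hi.2, childZ12_eq hl, Gam12_of_lt _ _ _ hl hi.2, mul_assoc]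
  rw [Finset.sum_congr rfl h1, sum_convective hα hw hp hq hr]
  subst hF
  simp only [← Finset.mul_sum]
  have h2 : ∀ d ∈ Finset.Ico 0 (nb s.q), (∑ k ∈ Finset.Ico 0 s.w, ∑ t ∈ Finset.Ico 0 (SS s d),
      gG s d (t + 1) * (uZ u ⟨k, W1 s d (t + 1), W0 s d (t + 1), W2 s d (t + 1),
        bB d s.q * (s.a + aA d s.q * (aA d s.q - 2) * (2 * s.a - 3))⟩ *
        uZ u ⟨s.w - 1 - k, V1 s d (t + 1), V0 s d (t + 1), V2 s d (t + 1), phi d s.q⟩)) =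
      1 / (fac s.p * fac s.q * fac s.r) * G (bB d s.q) (phi d s.q) (aA d s.q) (nN d s.q) (mM d s.q) := by
    intro d hd
    rw [Finset.mem_Ico] at hd
    rw [sum_block u hα hw hp hq hr hd.1 hd.2]
    subst hG
    unfold S1 S2 S3
    ring
  rw [Finset.sum_congr rfl h2, ← Finset.mul_sum, sum_blocks (by omega), ← mul_assoc,
    one_div_mul_one_div]
  subst hG
  congr 1
  refine Finset.sum_congr rfl fun b _ => ?_
  have h3 : ∀ a n m, ∑ φ ∈ Finset.Ico (0 : ℤ) 3, hH s.q a n m b *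
        (fac (s2 s.q a n b) * fac (s1 s a n m b) * fac (s3 s a n m b) *
        fMul (u (comp φ)) (fS (comp φ) (u (comp (b * (s.a + a * (a - 2) * (2 * s.a - 3))))))
        (s.w - 1).toNat (s1 s a n m b).toNat (s2 s.q a n b).toNat (s3 s a n m b).toNat) =
      convBlock u s b a n m := by
    intro a n m
    rw [show Finset.Ico (0 : ℤ) 3 = {0, 1, 2} from rfl, Finset.sum_insert (by decide),
      Finset.sum_insert (by decide), Finset.sum_singleton, convBlock, convZ, conv, Fin.sum_univ_three]
    simp only [show comp 0 = 0 from rfl, show comp 1 = 1 from rfl, show comp 2 = 2 from rfl]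
    ring
  simp only [Finset.sum_add_distrib]
  refine congrArg₂ _ ?_ (congrArg₂ _ ?_ ?_)
  all_goals
    rw [Finset.sum_comm]
    refine Finset.sum_congr rfl fun n _ => ?_
    rw [Finset.sum_comm]
    exact Finset.sum_congr rfl fun m _ => h3 _ _ _

/-! ### Normalized coefficients in the coordinates of a component -/

/-- The coefficient of `F` times the factorials of its space indices. For `α = 1` the index `A`
belongs to `x` and `B` to `z`, otherwise the two are exchanged. -/
def nrm (α : ℤ) (F : Coeffs) (ω A q B : ℕ) : ℝ :=
  (A.factorial * q.factorial * B.factorial : ℝ) * if α = 1 then F ω A q B else F ω B q A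

/-- The index of component `β` with the entries `A`, `q`, `B` in the coordinates of the component
`α`. -/
def idxOf (α β w A q B : ℤ) : Idx := if α = 1 then ⟨w, A, q, B, β⟩ else ⟨w, B, q, A, β⟩

theorem fac_natCast (n : ℕ) : fac n = n.factorial := by simp [fac]

theorem fac_eq {x : ℤ} {n : ℕ} (h : x = n) : fac x = n.factorial := by rw [h, fac_natCast]

theorem bin_eq {x y : ℤ} {n m : ℕ} (hx : x = n) (hy : y = m) : bin x y = n.choose m := by
  simp [bin, hx, hy]

theorem sg_eq {x : ℤ} {n : ℕ} (h : (x - n) % 2 = 0) : (sg x : ℝ) = (-1) ^ n := by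
  unfold sg
  rcases Nat.even_or_odd n with hn | hn
  · rw [hn.neg_one_pow, if_pos (by obtain ⟨j, rfl⟩ := hn; omega)]; simp
  · rw [hn.neg_one_pow, if_neg (by obtain ⟨j, rfl⟩ := hn; omega)]; simp

theorem uZ_idxOf (c : Fin 3 → Coeffs) {α : ℤ} {s : Idx} {β : ℤ} {w A q B : ℕ}
    (h : s = idxOf α β w A q B) :
    (A.factorial * q.factorial * B.factorial : ℝ) * uZ c s = nrm α (c (comp β)) w A q B := by
  subst h
  unfold nrm idxOf
  congr 1
  split_ifs
  · exact uZ_of_eq c rfl rfl rfl rfl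
  · exact uZ_of_eq c rfl rfl rfl rfl

theorem gZ_idxOf (g : Fin 3 → Coeffs) {α : ℤ} {s : Idx} {β : ℤ} {w A q B : ℕ}
    (h : s = idxOf α β w A q B) :
    (A.factorial * q.factorial * B.factorial : ℝ) * gZ g s = nrm α (g (comp β)) w A q B := by
  subst h
  unfold nrm idxOf gZ
  split_ifs <;> simp

theorem convZ_eq_nrm (u : Fin 3 → Coeffs) {α β x y z w : ℤ} {ω A q B : ℕ} (hw : w = ω)
    (hx : x = if α = 1 then (A : ℤ) else B) (hy : y = q) (hz : z = if α = 1 then (B : ℤ) else A) :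
    convZ u β w x y z = nrm α (conv u (comp β)) ω A q B := by
  subst hw hx hy hz
  unfold convZ nrm
  split_ifs <;> simp only [fac_natCast, Int.toNat_natCast] <;> ring

theorem sum_range_choose_reflect (n : ℕ) (F : ℕ → ℕ → ℝ) :
    ∑ m ∈ Finset.range (n + 1), (n.choose m : ℝ) * F (n - m) m =
      ∑ m ∈ Finset.range (n + 1), (n.choose m : ℝ) * F m (n - m) := by
  rw [← Finset.sum_range_reflect]
  refine Finset.sum_congr rfl fun m hm => ?_
  rw [Finset.mem_range] at hm
  rw [show n + 1 - 1 - m = n - m by omega, Nat.choose_symm (by omega),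
    show n - (n - m) = m by omega]

theorem lapPow_eq_reflect (n : ℕ) (f : ℕ → ℕ → ℝ) (A B : ℕ) :
    lapPow n f A B = ∑ m ∈ Finset.range (n + 1), (n.choose m : ℝ) * f (A + 2 * m) (B + 2 * (n - m)) :=
  sum_range_choose_reflect n fun i j => f (A + 2 * i) (B + 2 * j)

theorem hH_zero (q n m b : ℤ) : hH q 0 n m b = if n = m then (sg (n + b + q / 2) : ℝ) else 0 :=
  if_pos rfl

theorem hH_one (q b : ℤ) {n m : ℕ} (h : m ≤ n) :
    hH q 1 (n + 1) (m + 1) b = (sg (n + 1 + b) : ℝ) * n.choose m := by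
  unfold hH
  rw [if_neg (by norm_num), Nat.cast_choose ℝ h, fac_eq (n := n) (by ring),
    fac_eq (x := (m : ℤ) + 1 - 2 + 1) (n := m) (by ring), fac_eq (n := n - m) (by omega)]
  norm_num
  ring

theorem hH_two (q b : ℤ) {n m : ℕ} (h : m ≤ n) :
    hH q 2 (n + 1) (m + 1) b = (sg (n + 1 + b + 1) : ℝ) * (n + 1).choose (m + 1) := by
  unfold hH
  rw [if_neg (by norm_num), Nat.cast_choose ℝ (show m + 1 ≤ n + 1 by omega),
    fac_eq (n := n + 1) (by push_cast; ring),
    fac_eq (x := (m : ℤ) + 1 - 2 + 2) (n := m + 1) (by push_cast; ring),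
    fac_eq (n := n + 1 - (m + 1)) (by omega)]
  norm_num
  ring

/-- The inner index of component `α` with `ω + 1` as time order and `f + 2 (k + 1)` as middle
index. -/
def bulk (α : ℤ) (ω A k f B : ℕ) : Idx := idxOf α α (ω + 1 : ℕ) A (f + 2 * (k + 1) : ℕ) B

theorem bulk_q (α : ℤ) (ω A k f B : ℕ) : (bulk α ω A k f B).q = (f + 2 * (k + 1) : ℕ) := by
  unfold bulk idxOf; split_ifs <;> rfl

theorem bulk_w (α : ℤ) (ω A k f B : ℕ) : (bulk α ω A k f B).w = (ω + 1 : ℕ) := by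
  unfold bulk idxOf; split_ifs <;> rfl

theorem bulk_a (α : ℤ) (ω A k f B : ℕ) : (bulk α ω A k f B).a = α := by
  unfold bulk idxOf; split_ifs <;> rfl

theorem bulk_half (α : ℤ) (ω A k : ℕ) {f : ℕ} (hf : f ≤ 1) (B : ℕ) :
    (bulk α ω A k f B).q / 2 = (k + 1 : ℕ) := by
  rw [bulk_q]; omega

theorem X_bulk {α : ℤ} (hα : α = 1 ∨ α = 2) (ω A k f B : ℕ) :
    X (bulk α ω A k f B) α = A ∧ X (bulk α ω A k f B) (3 - α) = B := by
  rcases hα with rfl | rfl <;> simp [X, bulk, idxOf]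

theorem fac_bulk {α : ℤ} (hα : α = 1 ∨ α = 2) (ω A k f B : ℕ) :
    fac (bulk α ω A k f B).p * fac (bulk α ω A k f B).q * fac (bulk α ω A k f B).r =
    (A.factorial * (f + 2 * (k + 1)).factorial * B.factorial : ℝ) := by
  rw [bulk_q, fac_natCast]
  unfold bulk idxOf
  rcases hα with rfl | rfl
  · simp [fac_natCast]
  · simp only [OfNat.ofNat_ne_one, if_false, fac_natCast]; ring

theorem comp_zero : comp 0 = 0 := rfl

/-- The convective blocks of a component form the source of the force `- U · ∇ U`. -/
theorem sum_convBlock (u : Fin 3 → Coeffs) {α : ℤ} (hα : α = 1 ∨ α = 2) (ω A k : ℕ) {f : ℕ}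
    (hf : f ≤ 1) (B : ℕ) :
    ∑ b ∈ Finset.Ico 0 2,
      ((∑ n ∈ Finset.Ico 0 ((bulk α ω A k f B).q / 2), ∑ m ∈ Finset.Ico 0 (n + 1),
          convBlock u (bulk α ω A k f B) b 0 (n + 1) (m + 1))
      + ((∑ n ∈ Finset.Ico 0 ((bulk α ω A k f B).q / 2 - 1), ∑ m ∈ Finset.Ico 0 (n + 1),
          convBlock u (bulk α ω A k f B) b 1 (n + 1) (m + 1))
      + ∑ n ∈ Finset.Ico 0 ((bulk α ω A k f B).q / 2 - 2), ∑ m ∈ Finset.Ico 0 (n + 1),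
          convBlock u (bulk α ω A k f B) b 2 (n + 1) (m + 1))) =
    - source k (nrm α (conv u (comp α)) ω) (nrm α (conv u 0) ω) (nrm α (conv u (comp (3 - α))) ω)
        A (f + 2 * (k + 1)) B := by
  have hhalf := bulk_half α ω A k hf B
  have hq := bulk_q α ω A k f B
  have ha := bulk_a α ω A k f B
  have hw := bulk_w α ω A k f B
  -- the values of the blocks
  have z1 : ∀ n m : ℕ, n ≤ k → convBlock u (bulk α ω A k f B) 1 0 (n + 1) (m + 1) =
      if (n : ℤ) + 1 = m + 1 then -((-1) ^ (k - n) * nrm α (conv u (comp α)) ω (A + 2 * (k - n))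
        (f + 2 * (k + 1) - 2 * (k - n)) B) else 0 := by
    intro n m hn
    unfold convBlock
    rw [hH_zero, hhalf, ha, hw, hq, convZ_eq_nrm (α := α) u (ω := ω) (A := A + 2 * (k - n))
      (q := f + 2 * (k + 1) - 2 * (k - n)) (B := B), sg_eq (n := k - n + 1), ite_mul, zero_mul]
    · rw [show (1 : ℤ) * (α + 0 * (2 * α - 3)) = α by ring, zero_mul]
      congr 1
      ring
    · push_cast; omega
    · push_cast; ring
    · unfold s1; rw [hhalf, ha]; rcases hα with rfl | rfl <;> simp [bulk, idxOf] <;> omega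
    · unfold s2; simp; omega
    · unfold s3; rw [hhalf, ha]; rcases hα with rfl | rfl <;> simp [bulk, idxOf] <;> omega
  have z0 : ∀ n m : ℕ, n ≤ k → convBlock u (bulk α ω A k f B) 0 0 (n + 1) (m + 1) =
      if (n : ℤ) + 1 = m + 1 then (-1) ^ (k - n) * nrm α (conv u 0) ω (A + 2 * (k - n) + 1)
        (f + 2 * (k + 1) - 2 * (k - n) - 1) B else 0 := by
    intro n m hn
    unfold convBlock
    rw [hH_zero, hhalf, ha, hw, hq, convZ_eq_nrm (α := α) u (ω := ω) (A := A + 2 * (k - n) + 1)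
      (q := f + 2 * (k + 1) - 2 * (k - n) - 1) (B := B), sg_eq (n := k - n), ite_mul, zero_mul,
      zero_mul, comp_zero]
    · push_cast; omega
    · push_cast; ring
    · unfold s1; rw [hhalf, ha]; rcases hα with rfl | rfl <;> simp [bulk, idxOf] <;> omega
    · unfold s2; simp; omega
    · unfold s3; rw [hhalf, ha]; rcases hα with rfl | rfl <;> simp [bulk, idxOf] <;> omega
  have o1 : ∀ n m : ℕ, n < k → m ≤ n → convBlock u (bulk α ω A k f B) 1 1 (n + 1) (m + 1) =
      -((-1) ^ (n + 1) * (n.choose m : ℝ) * nrm α (conv u (comp (3 - α))) ω (A + 2 * (n - m) + 1)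
        (f + 2 * (k + 1) - 2 * (n + 1)) (B + 2 * m + 1)) := by
    intro n m hn hm
    unfold convBlock
    rw [hH_one _ _ hm, ha, hw, hq, convZ_eq_nrm (α := α) u (ω := ω) (A := A + 2 * (n - m) + 1)
      (q := f + 2 * (k + 1) - 2 * (n + 1)) (B := B + 2 * m + 1), sg_eq (n := n)]
    · rw [show (1 : ℤ) * (α + 1 * (1 - 2) * (2 * α - 3)) = 3 - α by ring]
      ring
    · omega
    · push_cast; ring
    · unfold s1; rw [ha]; rcases hα with rfl | rfl <;> simp [bulk, idxOf, sg] <;> omega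
    · unfold s2; simp; omega
    · unfold s3; rw [ha]; rcases hα with rfl | rfl <;> simp [bulk, idxOf, sg] <;> omega
  have o0 : ∀ n m : ℕ, n < k → m ≤ n → convBlock u (bulk α ω A k f B) 0 1 (n + 1) (m + 1) =
      (-1) ^ (n + 1) * (n.choose m : ℝ) * nrm α (conv u 0) ω (A + 2 * (n - m) + 1)
        (f + 2 * (k + 1) - 2 * (n + 1) - 1) (B + 2 * (m + 1)) := by
    intro n m hn hm
    unfold convBlock
    rw [hH_one _ _ hm, ha, hw, hq, convZ_eq_nrm (α := α) u (ω := ω) (A := A + 2 * (n - m) + 1)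
      (q := f + 2 * (k + 1) - 2 * (n + 1) - 1) (B := B + 2 * (m + 1)), sg_eq (n := n + 1), zero_mul,
      comp_zero]
    · push_cast; omega
    · push_cast; ring
    · unfold s1; rw [ha]; rcases hα with rfl | rfl <;> simp [bulk, idxOf, sg] <;> omega
    · unfold s2; simp; omega
    · unfold s3; rw [ha]; rcases hα with rfl | rfl <;> simp [bulk, idxOf, sg] <;> omega
  have t1 : ∀ n m : ℕ, n + 1 < k → m ≤ n → convBlock u (bulk α ω A k f B) 1 2 (n + 1) (m + 1) =
      -((-1) ^ n * ((n + 1).choose (m + 1) : ℝ) * nrm α (conv u (comp α)) ω (A + 2 * (n - m) + 2)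
        (f + 2 * (k + 1) - 2 * (n + 2)) (B + 2 * (m + 1))) := by
    intro n m hn hm
    unfold convBlock
    rw [hH_two _ _ hm, ha, hw, hq, convZ_eq_nrm (α := α) u (ω := ω) (A := A + 2 * (n - m) + 2)
      (q := f + 2 * (k + 1) - 2 * (n + 2)) (B := B + 2 * (m + 1)), sg_eq (n := n + 1)]
    · rw [show (1 : ℤ) * (α + 2 * (2 - 2) * (2 * α - 3)) = α by ring]
      ring
    · push_cast; omega
    · push_cast; ring
    · unfold s1; rw [ha]; rcases hα with rfl | rfl <;> simp [bulk, idxOf, sg] <;> omega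
    · unfold s2; simp; omega
    · unfold s3; rw [ha]; rcases hα with rfl | rfl <;> simp [bulk, idxOf, sg] <;> omega
  have t0 : ∀ n m : ℕ, n + 1 < k → m ≤ n → convBlock u (bulk α ω A k f B) 0 2 (n + 1) (m + 1) =
      (-1) ^ n * ((n + 1).choose (m + 1) : ℝ) * nrm α (conv u 0) ω (A + 2 * (n - m) + 3)
        (f + 2 * (k + 1) - 2 * (n + 2) - 1) (B + 2 * (m + 1)) := by
    intro n m hn hm
    unfold convBlock
    rw [hH_two _ _ hm, ha, hw, hq, convZ_eq_nrm (α := α) u (ω := ω) (A := A + 2 * (n - m) + 3)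
      (q := f + 2 * (k + 1) - 2 * (n + 2) - 1) (B := B + 2 * (m + 1)), sg_eq (n := n), zero_mul,
      comp_zero]
    · omega
    · push_cast; ring
    · unfold s1; rw [ha]; rcases hα with rfl | rfl <;> simp [bulk, idxOf, sg] <;> omega
    · unfold s2; simp; omega
    · unfold s3; rw [ha]; rcases hα with rfl | rfl <;> simp [bulk, idxOf, sg] <;> omega
  have hIco1 : Finset.Ico (0 : ℤ) ((k + 1 : ℕ) - 1) = Finset.Ico 0 (k : ℤ) := by
    congr 1; push_cast; ring
  have hIco2 : Finset.Ico (0 : ℤ) ((k + 1 : ℕ) - 2) = Finset.Ico 0 ((k - 1 : ℕ) : ℤ) := by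
    ext x; simp only [Finset.mem_Ico]; omega
  rw [show Finset.Ico (0 : ℤ) 2 = {0, 1} from rfl, Finset.sum_pair (by norm_num), hhalf, hIco1,
    hIco2, source_eq_blocks]
  simp only [sum_Ico_natCast, ← Nat.cast_succ]
  simp only [Nat.cast_succ]
  have S0 : ∀ b : ℤ, ∀ T : ℕ → ℝ, (∀ n m : ℕ, n ≤ k →
      convBlock u (bulk α ω A k f B) b 0 (n + 1) (m + 1)
        = if (n : ℤ) + 1 = m + 1 then T (k - n) else 0) →
      ∑ n ∈ Finset.range (k + 1), ∑ m ∈ Finset.range (n + 1),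
        convBlock u (bulk α ω A k f B) b 0 (n + 1) (m + 1) = ∑ n ∈ Finset.range (k + 1), T n := by
    intro b T hT
    rw [← Finset.sum_range_reflect T]
    refine Finset.sum_congr rfl fun n hn => ?_
    rw [Finset.mem_range] at hn
    rw [Finset.sum_congr rfl fun m _ => hT n m (by omega), Finset.sum_eq_single n]
    · rw [if_pos rfl]; congr 1
    · intro m _ hm
      rw [if_neg (by omega)]
    · intro h; simp at h
  have S : ∀ a b : ℤ, ∀ K : ℕ, ∀ T : ℕ → ℕ → ℝ, (∀ n m : ℕ, n < K → m ≤ n →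
      convBlock u (bulk α ω A k f B) b a (n + 1) (m + 1) = T n m) →
      ∑ n ∈ Finset.range K, ∑ m ∈ Finset.range (n + 1),
        convBlock u (bulk α ω A k f B) b a (n + 1) (m + 1) =
      ∑ n ∈ Finset.range K, ∑ m ∈ Finset.range (n + 1), T n m := by
    intro a b K T hT
    refine Finset.sum_congr rfl fun n hn => Finset.sum_congr rfl fun m hm => ?_
    rw [Finset.mem_range] at hn hm
    exact hT n m hn (by omega)
  rw [S0 0 (fun n => (-1) ^ n * nrm α (conv u 0) ω (A + 2 * n + 1)
      (f + 2 * (k + 1) - 2 * n - 1) B) z0,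
    S0 1 (fun n => -((-1) ^ n * nrm α (conv u (comp α)) ω (A + 2 * n)
      (f + 2 * (k + 1) - 2 * n) B)) z1, S 1 0 k _ o0, S 1 1 k _ o1, S 2 0 (k - 1) _ fun n m hn => t0 n m (by omega),
    S 2 1 (k - 1) _ fun n m hn => t1 n m (by omega)]
  simp only [mul_sub, Finset.sum_sub_distrib, Finset.sum_neg_distrib]
  ring

/-! ### The terms of the initial values, of the body acceleration and of the viscosity -/

theorem factorial_of_le_one {f : ℕ} (hf : f ≤ 1) : f.factorial = 1 :=
  Nat.factorial_eq_one.2 hf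

/-- The part of the coefficient of the zeroth term that comes from the data. -/
theorem bigF0_bulk (c : Fin 3 → Coeffs) {α : ℤ} (hα : α = 1 ∨ α = 2) (ω A k : ℕ) {f : ℕ}
    (hf : f ≤ 1) (B : ℕ) :
    bigF0 c (bulk α ω A k f B) =
      1 / (A.factorial * (f + 2 * (k + 1)).factorial * B.factorial : ℝ) *
      ((-1) ^ (k + 1) * lapPow k (fun A B => nrm α (c (comp α)) (ω + 1) (A + 2) f B
        + nrm α (c (comp (3 - α))) (ω + 1) (A + 1) f (B + 1)) A B) := by
  have hhalf := bulk_half α ω A k hf B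
  have hq := bulk_q α ω A k f B
  have ha := bulk_a α ω A k f B
  have hw := bulk_w α ω A k f B
  have hX := X_bulk hα ω A k f B
  have hf1 := factorial_of_le_one hf
  unfold bigF0
  simp only [fac_bulk hα, hhalf, ha, hX.1, hX.2]
  rw [sum_Icc_one, Int.toNat_natCast, lapPow_eq_reflect, Finset.mul_sum, Finset.mul_sum]
  refine Finset.sum_congr rfl fun n hn => ?_
  rw [Finset.mem_range] at hn
  rw [sg_eq (n := k + 1) (by simp), bin_eq (n := k) (m := n) (by push_cast; ring) (by ring),
    fac_eq (n := A + 2 * n + 2) (by push_cast; ring),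
    fac_eq (n := B + 2 * (k - n)) (by omega),
    fac_eq (n := A + 2 * n + 1) (by push_cast; ring),
    fac_eq (n := B + 2 * (k - n) + 1) (by omega),
    ← uZ_idxOf c (α := α) (A := A + 2 * n + 2) (B := B + 2 * (k - n)) (q := f) (w := ω + 1)
      (β := α) (s := ⟨(bulk α ω A k f B).w,
        (bulk α ω A k f B).p + sg (α + 1) * (2 * (n + 1)) + (α - 1) * (2 * (k + 1 : ℕ)),
        (bulk α ω A k f B).q - 2 * (k + 1 : ℕ),
        (bulk α ω A k f B).r + sg α * (2 * (n + 1)) + 2 * (2 - α) * (k + 1 : ℕ), α⟩)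
      (by rcases hα with rfl | rfl <;> simp [bulk, idxOf, sg] <;> omega),
    ← uZ_idxOf c (α := α) (A := A + 2 * n + 1) (B := B + 2 * (k - n) + 1) (q := f) (w := ω + 1)
      (β := 3 - α) (s := ⟨(bulk α ω A k f B).w,
        (bulk α ω A k f B).p + sg (α + 1) * (2 * (n + 1) - 1) + (α - 1) * (2 * (k + 1 : ℕ)),
        (bulk α ω A k f B).q - 2 * (k + 1 : ℕ),
        (bulk α ω A k f B).r + sg α * (2 * (n + 1) - 1) + 2 * (2 - α) * (k + 1 : ℕ), 3 - α⟩)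
      (by rcases hα with rfl | rfl <;> simp [bulk, idxOf, sg] <;> omega), hf1]
  push_cast
  ring

/-- The part of the coefficient of the zeroth term that comes from the body acceleration. -/
theorem bigF0t_bulk (g : Fin 3 → Coeffs) {α : ℤ} (hα : α = 1 ∨ α = 2) (ω A k : ℕ) {f : ℕ}
    (hf : f ≤ 1) (B : ℕ) :
    bigF0t g (bulk α ω A k f B) =
      1 / ((ω + 1 : ℝ) * (A.factorial * (f + 2 * (k + 1)).factorial * B.factorial : ℝ)) *
      source k (nrm α (g (comp α)) ω) (nrm α (g 0) ω) (nrm α (g (comp (3 - α))) ω) A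
        (f + 2 * (k + 1)) B := by
  have hhalf := bulk_half α ω A k hf B
  have hq := bulk_q α ω A k f B
  have ha := bulk_a α ω A k f B
  have hw := bulk_w α ω A k f B
  have hX := X_bulk hα ω A k f B
  have hfac := fac_bulk hα ω A k f B
  have hB : (B.factorial : ℝ) ≠ 0 := by positivity
  unfold bigF0t
  simp only [hfac, hhalf, ha, hX.1, hX.2]
  have hwR : (((bulk α ω A k f B).w : ℤ) : ℝ) = (ω + 1 : ℝ) := by rw [hw]; push_cast; ring
  have eN : ((k + 1 : ℕ) : ℤ).toNat = k + 1 := rfl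
  have eN1 : (((k + 1 : ℕ) : ℤ) - 1).toNat = k := by simp
  have eN2 : (((k + 1 : ℕ) : ℤ) - 2).toNat = k - 1 := by omega
  have eM : ∀ n : ℕ, ((n : ℤ) + 1).toNat = n + 1 := fun n => by omega
  have dist : ∀ x y a b c : ℝ, x * y * (a + b + c) = x * (y * a) + x * (y * b) + x * (y * c) := by
    intros; ring
  rw [source_eq_sums, ← one_div_mul_one_div, dist, hwR]
  refine congrArg₂ (· + ·) (congrArg₂ (· + ·) ?_ ?_) ?_
  · congr 1
    rw [sum_Icc_one, eN, Finset.mul_sum]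
    refine Finset.sum_congr rfl fun n hn => ?_
    rw [Finset.mem_range] at hn
    rw [sg_eq (n := n) (by omega),
      fac_eq (x := (bulk α ω A k f B).q - 2 * ((n : ℤ) + 1) + 2)
        (n := f + 2 * (k + 1) - 2 * n) (by rw [hq]; omega),
      fac_eq (x := (bulk α ω A k f B).q - 2 * ((n : ℤ) + 1) + 1)
        (n := f + 2 * (k + 1) - 2 * n - 1) (by rw [hq]; omega),
      fac_eq (x := (A : ℤ) + 2 * ((n : ℤ) + 1) - 2) (n := A + 2 * n) (by push_cast; ring),
      fac_eq (x := (A : ℤ) + 2 * ((n : ℤ) + 1) - 1) (n := A + 2 * n + 1) (by push_cast; ring),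
      fac_natCast, fac_eq hq,
      ← gZ_idxOf g (α := α) (β := α) (w := ω) (A := A + 2 * n) (q := f + 2 * (k + 1) - 2 * n)
        (B := B) (s := ⟨(bulk α ω A k f B).w - 1,
          (bulk α ω A k f B).p + (2 - α) * (2 * (n + 1) - 2),
          (bulk α ω A k f B).q - 2 * (n + 1) + 2,
          (bulk α ω A k f B).r + (α - 1) * (2 * (n + 1) - 2), α⟩)
        (by rcases hα with rfl | rfl <;> simp [bulk, idxOf] <;> omega),
      ← comp_zero,
      ← gZ_idxOf g (α := α) (β := 0) (w := ω) (A := A + 2 * n + 1)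
        (q := f + 2 * (k + 1) - 2 * n - 1) (B := B) (s := ⟨(bulk α ω A k f B).w - 1,
          (bulk α ω A k f B).p + (2 - α) * (2 * (n + 1) - 1),
          (bulk α ω A k f B).q - 2 * (n + 1) + 1,
          (bulk α ω A k f B).r + (α - 1) * (2 * (n + 1) - 1), 0⟩)
        (by rcases hα with rfl | rfl <;> simp [bulk, idxOf] <;> omega)]
    field_simp
  · congr 1
    rw [sum_Icc_one, eN1, Finset.mul_sum]
    refine Finset.sum_congr rfl fun n hn => ?_
    rw [Finset.mem_range] at hn
    rw [sum_Icc_one, eM, Finset.mul_sum]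
    refine Finset.sum_congr rfl fun m hm => ?_
    rw [Finset.mem_range] at hm
    rw [sg_eq (n := n + 1) (by push_cast; omega),
      bin_eq (n := n) (m := m) (by ring) (by ring),
      bin_eq (n := n + 1) (m := m + 1) (by push_cast; ring) (by push_cast; ring),
      fac_eq (x := (B : ℤ) + 2 * ((m : ℤ) + 1) - 1) (n := B + 2 * m + 1) (by push_cast; ring),
      fac_eq (x := (B : ℤ) + 2 * ((m : ℤ) + 1)) (n := B + 2 * (m + 1)) (by push_cast; ring),
      fac_eq (x := (bulk α ω A k f B).q - 2 * ((n : ℤ) + 1))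
        (n := f + 2 * (k + 1) - 2 * (n + 1)) (by rw [hq]; omega),
      fac_eq (x := (bulk α ω A k f B).q - 1 - 2 * ((n : ℤ) + 1))
        (n := f + 2 * (k + 1) - 2 * (n + 1) - 1) (by rw [hq]; omega),
      fac_eq (x := (A : ℤ) - 2 * ((m : ℤ) + 1) + 2 * ((n : ℤ) + 1) + 1)
        (n := A + 2 * (n - m) + 1) (by omega),
      ← gZ_idxOf g (α := α) (β := 3 - α) (w := ω) (A := A + 2 * (n - m) + 1)
        (q := f + 2 * (k + 1) - 2 * (n + 1))
        (B := B + 2 * m + 1) (s := ⟨(bulk α ω A k f B).w - 1,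
          (bulk α ω A k f B).p + sg α * (2 * (m + 1) - 1) + 2 * (n + 1) * (2 - α),
          (bulk α ω A k f B).q - 2 * (n + 1),
          (bulk α ω A k f B).r + sg (α + 1) * (2 * (m + 1) - 1) + 2 * (α - 1) * (n + 1), 3 - α⟩)
        (by rcases hα with rfl | rfl <;> simp [bulk, idxOf, sg] <;> omega),
      ← comp_zero,
      ← gZ_idxOf g (α := α) (β := 0) (w := ω) (A := A + 2 * (n - m) + 1)
        (q := f + 2 * (k + 1) - 2 * (n + 1) - 1) (B := B + 2 * (m + 1))
        (s := ⟨(bulk α ω A k f B).w - 1,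
          (bulk α ω A k f B).p + 2 * (m + 1) * sg α + (2 - α) * (2 * (n + 1) + 1),
          (bulk α ω A k f B).q - 1 - 2 * (n + 1),
          (bulk α ω A k f B).r + 2 * (m + 1) * sg (α + 1) + (α - 1) * (2 * (n + 1) + 1), 0⟩)
        (by rcases hα with rfl | rfl <;> simp [bulk, idxOf, sg] <;> omega)]
    ring
  · congr 1
    rw [sum_Icc_one, eN2, Finset.mul_sum]
    refine Finset.sum_congr rfl fun n hn => ?_
    rw [Finset.mem_range] at hn
    rw [sum_Icc_one, eM, Finset.mul_sum]
    refine Finset.sum_congr rfl fun m hm => ?_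
    rw [Finset.mem_range] at hm
    rw [sg_eq (n := n) (by omega),
      bin_eq (n := n + 1) (m := m + 1) (by push_cast; ring) (by push_cast; ring),
      fac_eq (x := (B : ℤ) + 2 * ((m : ℤ) + 1)) (n := B + 2 * (m + 1)) (by push_cast; ring),
      fac_eq (x := (bulk α ω A k f B).q - 2 - 2 * ((n : ℤ) + 1))
        (n := f + 2 * (k + 1) - 2 * (n + 2)) (by rw [hq]; omega),
      fac_eq (x := (A : ℤ) - 2 * ((m : ℤ) + 1) + 2 * ((n : ℤ) + 1) + 2)
        (n := A + 2 * (n - m) + 2) (by omega),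
      ← gZ_idxOf g (α := α) (β := α) (w := ω) (A := A + 2 * (n - m) + 2)
        (q := f + 2 * (k + 1) - 2 * (n + 2)) (B := B + 2 * (m + 1))
        (s := ⟨(bulk α ω A k f B).w - 1,
          (bulk α ω A k f B).p + 2 * (m + 1) * sg α + (2 - α) * (2 * (n + 1) + 2),
          (bulk α ω A k f B).q - 2 - 2 * (n + 1),
          (bulk α ω A k f B).r + 2 * (m + 1) * sg (α + 1) + (α - 1) * (2 * (n + 1) + 2), α⟩)
        (by rcases hα with rfl | rfl <;> simp [bulk, idxOf, sg] <;> omega)]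
    ring

/-- The viscous term with the numbers `z` and `n`. -/
def viscTerm (ν : ℝ) (g c u : Fin 3 → Coeffs) (s : Idx) (z n : ℤ) : ℝ :=
  bigF ν g c z s n * uZ u ⟨s.w - 1, xi z s n, Del z s.q, eps z s n, kap z s.a⟩

theorem heav_bulk (α : ℤ) (ω A k : ℕ) {f : ℕ} (hf : f ≤ 1) (B : ℕ) :
    heav (((bulk α ω A k f B).q : ℚ) - 4) = if k = 0 then 0 else 1 := by
  rw [bulk_q]
  unfold heav
  have : (0 : ℚ) ≤ ((f + 2 * (k + 1) : ℕ) : ℤ) - 4 ↔ ¬ k = 0 := by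
    rw [sub_nonneg, show (4 : ℚ) = ((4 : ℤ) : ℚ) by norm_num, Int.cast_le]; omega
  simp only [this]
  split_ifs <;> simp_all

theorem factorial_two_of_le_one {f : ℕ} (hf : f ≤ 1) :
    ((f + 2).factorial : ℝ) = 2 * (1 + 2 * f) := by
  interval_cases f <;> norm_num [Nat.factorial]

theorem factorial_one_of_le_one {f : ℕ} (hf : f ≤ 1) : ((f + 1).factorial : ℝ) = f + 1 := by
  rw [Nat.factorial_succ, factorial_of_le_one hf]; push_cast; ring

theorem p_mul_r_bulk {α : ℤ} (hα : α = 1 ∨ α = 2) (ω A k f B : ℕ) :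
    (((bulk α ω A k f B).p : ℝ) + 1) * ((bulk α ω A k f B).r + 1) = (A + 1) * (B + 1) := by
  rcases hα with rfl | rfl
  · simp [bulk, idxOf]
  · simp [bulk, idxOf]; ring

theorem bigF_five (ν : ℝ) (g c : Fin 3 → Coeffs) (s : Idx) : bigF ν g c 5 s 1 =
    ν / s.w * sg (s.q / 2) *
      (fac (X s s.a + 2 * (s.q / 2) + 1) * (s.q - 2 * (s.q / 2 : ℤ) + 1) / (fac (X s s.a) * fac s.q)) := by
  unfold bigF
  rw [if_neg (by norm_num), if_neg (by norm_num), if_neg (by norm_num), if_neg (by norm_num), if_neg (by norm_num), if_pos (by norm_num)]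

theorem bigF_six (ν : ℝ) (g c : Fin 3 → Coeffs) (s : Idx) (n : ℤ) : bigF ν g c 6 s n =
    ν / s.w * sg (s.q / 2) * bin (s.q / 2) (n - 1) *
      (fac (X s s.a + 2 * n - 1) * fac (X s (3 - s.a) + 2 * (s.q / 2) - 2 * n + 2)
        * (1 + s.q - 2 * (s.q / 2 : ℤ)) / (fac s.p * fac s.q * fac s.r)) := by
  unfold bigF
  rw [if_neg (by norm_num), if_neg (by norm_num), if_neg (by norm_num), if_neg (by norm_num), if_neg (by norm_num), if_neg (by norm_num), if_pos (by norm_num)]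

theorem bigF_seven (ν : ℝ) (g c : Fin 3 → Coeffs) (s : Idx) (n : ℤ) : bigF ν g c 7 s n =
    2 * (ν / s.w) * sg (s.q / 2 + 1) * bin (s.q / 2 - 1) (n - 1) *
      (fac (X s s.a + 2 * n) * fac (X s (3 - s.a) + 2 * (s.q / 2) - 2 * n)
        * (1 + 2 * s.q - 4 * (s.q / 2 : ℤ)) / (fac s.p * fac s.q * fac s.r)) := by
  unfold bigF
  rw [if_neg (by norm_num), if_neg (by norm_num), if_neg (by norm_num), if_neg (by norm_num), if_neg (by norm_num), if_neg (by norm_num), if_neg (by norm_num), if_pos (by norm_num)]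

theorem bigF_eight (ν : ℝ) (g c : Fin 3 → Coeffs) (s : Idx) (n : ℤ) : bigF ν g c 8 s n =
    2 * heav (s.q - 4) * (ν / s.w) * sg (s.q / 2 + 1) *
      bin (s.q / 2 - 1) (n - 1) *
      (fac (X s s.a + 2 * n - 1) * fac (X s (3 - s.a) + 2 * (s.q / 2) - 2 * n + 1)
        * (1 + 2 * s.q - 4 * (s.q / 2 : ℤ)) / (fac s.p * fac s.q * fac s.r)) := by
  unfold bigF
  rw [if_neg (by norm_num), if_neg (by norm_num), if_neg (by norm_num), if_neg (by norm_num), if_neg (by norm_num), if_neg (by norm_num), if_neg (by norm_num), if_neg (by norm_num), if_pos (by norm_num)]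

theorem viscTerm_eq_zero (ν : ℝ) (g c u : Fin 3 → Coeffs) {z n : ℤ} (h1 : 1 ≤ z) (h5 : z ≤ 5) (hn : n ≠ 1) (s : Idx) :
    viscTerm ν g c u s z n = 0 := by
  unfold viscTerm bigF
  simp only [hn, and_false, if_false]
  rw [if_neg (by omega), if_neg (by omega), if_neg (by omega), if_neg (by omega), zero_mul]

theorem viscTerm_one (ν : ℝ) (g c u : Fin 3 → Coeffs) {α : ℤ} (hα : α = 1 ∨ α = 2)
    (ω A k f B : ℕ) :
    viscTerm ν g c u (bulk α ω A k f B) 1 1 =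
    ν / ((ω + 1) * (A.factorial * (f + 2 * (k + 1)).factorial * B.factorial : ℝ)) *
      nrm α (u (comp α)) ω A (f + 2 * (k + 1)) (B + 2) := by
  have hX := X_bulk hα ω A k f B
  unfold viscTerm bigF
  simp only [bulk_w, bulk_a, hX.1, hX.2]
  rw [← uZ_idxOf u (α := α) (β := α) (w := ω) (A := A) (q := f + 2 * (k + 1)) (B := B + 2)
    (s := ⟨((ω + 1 : ℕ) : ℤ) - 1, xi 1 (bulk α ω A k f B) 1, Del 1 (bulk α ω A k f B).q,
      eps 1 (bulk α ω A k f B) 1, kap 1 α⟩)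
    (by rcases hα with rfl | rfl <;> simp [bulk, idxOf, xi, Del, eps, kap])]
  rw [Nat.factorial_succ, Nat.factorial_succ]
  norm_num
  field_simp
  ring

theorem viscTerm_two (ν : ℝ) (g c u : Fin 3 → Coeffs) {α : ℤ} (hα : α = 1 ∨ α = 2)
    (ω A k f B : ℕ) :
    viscTerm ν g c u (bulk α ω A k f B) 2 1 =
    ν / ((ω + 1) * (A.factorial * (f + 2 * (k + 1)).factorial * B.factorial : ℝ)) *
      nrm α (u (comp α)) ω A (f + 2 * (k + 1) + 2) B := by
  have hX := X_bulk hα ω A k f B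
  unfold viscTerm bigF
  simp only [bulk_w, bulk_a, bulk_q, hX.1, hX.2]
  rw [← uZ_idxOf u (α := α) (β := α) (w := ω) (A := A) (q := f + 2 * (k + 1) + 2) (B := B)
    (s := ⟨((ω + 1 : ℕ) : ℤ) - 1, xi 2 (bulk α ω A k f B) 1, Del 2 (f + 2 * (k + 1) : ℕ),
      eps 2 (bulk α ω A k f B) 1, kap 2 α⟩)
    (by rcases hα with rfl | rfl <;> simp [bulk, idxOf, xi, Del, eps, kap])]
  rw [Nat.factorial_succ (_ + 1), Nat.factorial_succ]
  generalize f + 2 * (k + 1) = q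
  norm_num
  field_simp
  ring

theorem viscTerm_three (ν : ℝ) (g c u : Fin 3 → Coeffs) {α : ℤ} (hα : α = 1 ∨ α = 2)
    (ω A k f B : ℕ) :
    viscTerm ν g c u (bulk α ω A k f B) 3 1 =
    ν / ((ω + 1) * (A.factorial * (f + 2 * (k + 1)).factorial * B.factorial : ℝ)) *
      -nrm α (u 0) ω (A + 1) (f + 2 * (k + 1) + 1) B := by
  have hX := X_bulk hα ω A k f B
  unfold viscTerm bigF
  simp only [bulk_w, bulk_a, bulk_q, hX.1, hX.2]
  rw [← comp_zero, ← uZ_idxOf u (α := α) (β := 0) (w := ω) (A := A + 1)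
    (q := f + 2 * (k + 1) + 1) (B := B)
    (s := ⟨((ω + 1 : ℕ) : ℤ) - 1, xi 3 (bulk α ω A k f B) 1, Del 3 (f + 2 * (k + 1) : ℕ),
      eps 3 (bulk α ω A k f B) 1, kap 3 α⟩)
    (by rcases hα with rfl | rfl <;> simp [bulk, idxOf, xi, Del, eps, kap] <;> ring)]
  rw [Nat.factorial_succ (_ + 2 * _), Nat.factorial_succ A]
  generalize f + 2 * (k + 1) = q
  norm_num
  field_simp

theorem viscTerm_four (ν : ℝ) (g c u : Fin 3 → Coeffs) {α : ℤ} (hα : α = 1 ∨ α = 2)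
    (ω A k f B : ℕ) :
    viscTerm ν g c u (bulk α ω A k f B) 4 1 =
    ν / ((ω + 1) * (A.factorial * (f + 2 * (k + 1)).factorial * B.factorial : ℝ)) *
      -(heav (((bulk α ω A k f B).q : ℚ) - 4) *
        nrm α (u (comp (3 - α))) ω (A + 1) (f + 2 * (k + 1)) (B + 1)) := by
  have hX := X_bulk hα ω A k f B
  have hpr := p_mul_r_bulk hα ω A k f B
  unfold viscTerm bigF
  simp only [bulk_w, bulk_a, hX.1, hX.2, mul_assoc, hpr]
  rw [← uZ_idxOf u (α := α) (β := 3 - α) (w := ω) (A := A + 1)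
    (q := f + 2 * (k + 1)) (B := B + 1)
    (s := ⟨((ω + 1 : ℕ) : ℤ) - 1, xi 4 (bulk α ω A k f B) 1, Del 4 (bulk α ω A k f B).q,
      eps 4 (bulk α ω A k f B) 1, kap 4 α⟩)
    (by rcases hα with rfl | rfl <;> simp [bulk, idxOf, xi, Del, eps, kap])]
  rw [Nat.factorial_succ B, Nat.factorial_succ A]
  generalize f + 2 * (k + 1) = q
  norm_num
  field_simp

theorem viscTerm_five (ν : ℝ) (g c u : Fin 3 → Coeffs) {α : ℤ} (hα : α = 1 ∨ α = 2)
    (ω A k : ℕ) {f : ℕ} (hf : f ≤ 1) (B : ℕ) :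
    viscTerm ν g c u (bulk α ω A k f B) 5 1 =
    ν / ((ω + 1) * (A.factorial * (f + 2 * (k + 1)).factorial * B.factorial : ℝ)) *
      ((-1) ^ (k + 1) * nrm α (u 0) ω (A + 2 * (k + 1) + 1) (f + 1) B) := by
  have hq := bulk_q α ω A k f B
  have hX := X_bulk hα ω A k f B
  rw [viscTerm, bigF_five]
  simp only [bulk_w, bulk_a, bulk_half α ω A k hf B, hX.1]
  rw [← comp_zero, ← uZ_idxOf u (α := α) (β := 0) (w := ω) (A := A + 2 * (k + 1) + 1)
    (q := f + 1) (B := B)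
    (s := ⟨((ω + 1 : ℕ) : ℤ) - 1, xi 5 (bulk α ω A k f B) 1, Del 5 (bulk α ω A k f B).q,
      eps 5 (bulk α ω A k f B) 1, kap 5 α⟩)
    (by
      unfold xi Del eps kap
      rw [bulk_half α ω A k hf B, bulk_a, bulk_q]
      rcases hα with rfl | rfl <;> simp [bulk, idxOf] <;> omega)]
  rw [sg_eq (n := k + 1) (by simp), fac_eq (n := A + 2 * (k + 1) + 1) (by push_cast; ring),
    hq, fac_natCast, fac_natCast, factorial_one_of_le_one hf]
  norm_num
  field_simp

theorem viscTerm_six (ν : ℝ) (g c u : Fin 3 → Coeffs) {α : ℤ} (hα : α = 1 ∨ α = 2)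
    (ω A k : ℕ) {f : ℕ} (hf : f ≤ 1) (B : ℕ) {n : ℕ} (hn : n ≤ k) :
    viscTerm ν g c u (bulk α ω A k f B) 6 (n + 1) =
    ν / ((ω + 1) * (A.factorial * (f + 2 * (k + 1)).factorial * B.factorial : ℝ)) *
      ((-1) ^ (k + 1) * ((k + 1).choose n *
        nrm α (u 0) ω (A + 2 * n + 1) (f + 1) (B + 2 * (k + 1 - n)))) := by
  have hq := bulk_q α ω A k f B
  have hX := X_bulk hα ω A k f B
  rw [viscTerm, bigF_six]
  simp only [bulk_w, bulk_a, bulk_half α ω A k hf B, hX.1, hX.2, fac_bulk hα]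
  rw [← comp_zero, ← uZ_idxOf u (α := α) (β := 0) (w := ω) (A := A + 2 * n + 1)
    (q := f + 1) (B := B + 2 * (k + 1 - n))
    (s := ⟨((ω + 1 : ℕ) : ℤ) - 1, xi 6 (bulk α ω A k f B) (n + 1), Del 6 (bulk α ω A k f B).q,
      eps 6 (bulk α ω A k f B) (n + 1), kap 6 α⟩)
    (by
      unfold xi Del eps kap
      rw [bulk_half α ω A k hf B, bulk_a, bulk_q]
      rcases hα with rfl | rfl <;> simp [bulk, idxOf, sg] <;> omega)]
  rw [sg_eq (n := k + 1) (by simp), fac_eq (n := A + 2 * n + 1) (by push_cast; ring),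
    fac_eq (x := (B : ℤ) + 2 * (k + 1 : ℕ) - 2 * (n + 1) + 2) (n := B + 2 * (k + 1 - n)) (by omega),
    hq, bin_eq (n := k + 1) (m := n) (by simp) (by ring), factorial_one_of_le_one hf]
  norm_num
  field_simp
  ring

theorem viscTerm_seven (ν : ℝ) (g c u : Fin 3 → Coeffs) {α : ℤ} (hα : α = 1 ∨ α = 2)
    (ω A k : ℕ) {f : ℕ} (hf : f ≤ 1) (B : ℕ) {n : ℕ} (hn : n ≤ k) :
    viscTerm ν g c u (bulk α ω A k f B) 7 (n + 1) =
    ν / ((ω + 1) * (A.factorial * (f + 2 * (k + 1)).factorial * B.factorial : ℝ)) *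
      -((-1) ^ (k + 1) * (k.choose n *
        nrm α (u (comp α)) ω (A + 2 * n + 2) (f + 2) (B + 2 * (k - n)))) := by
  have hq := bulk_q α ω A k f B
  have hX := X_bulk hα ω A k f B
  rw [viscTerm, bigF_seven]
  simp only [bulk_w, bulk_a, bulk_half α ω A k hf B, hX.1, hX.2, fac_bulk hα]
  rw [← uZ_idxOf u (α := α) (β := α) (w := ω) (A := A + 2 * n + 2)
    (q := f + 2) (B := B + 2 * (k - n))
    (s := ⟨((ω + 1 : ℕ) : ℤ) - 1, xi 7 (bulk α ω A k f B) (n + 1), Del 7 (bulk α ω A k f B).q,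
      eps 7 (bulk α ω A k f B) (n + 1), kap 7 α⟩)
    (by
      unfold xi Del eps kap
      rw [bulk_half α ω A k hf B, bulk_a, bulk_q]
      rcases hα with rfl | rfl <;> simp [bulk, idxOf, sg] <;> omega)]
  rw [sg_eq (n := k + 1 + 1) (by simp), fac_eq (n := A + 2 * n + 2) (by push_cast; ring),
    fac_eq (x := (B : ℤ) + 2 * (k + 1 : ℕ) - 2 * (n + 1)) (n := B + 2 * (k - n)) (by omega),
    hq, bin_eq (n := k) (m := n) (by simp) (by ring), factorial_two_of_le_one hf]
  norm_num
  field_simp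
  ring

theorem viscTerm_eight (ν : ℝ) (g c u : Fin 3 → Coeffs) {α : ℤ} (hα : α = 1 ∨ α = 2)
    (ω A k : ℕ) {f : ℕ} (hf : f ≤ 1) (B : ℕ) {n : ℕ} (hn : n ≤ k) :
    viscTerm ν g c u (bulk α ω A k f B) 8 (n + 1) =
    ν / ((ω + 1) * (A.factorial * (f + 2 * (k + 1)).factorial * B.factorial : ℝ)) *
      -((-1) ^ (k + 1) * (k.choose n * (heav (((bulk α ω A k f B).q : ℚ) - 4) *
        nrm α (u (comp (3 - α))) ω (A + 2 * n + 1) (f + 2) (B + 2 * (k - n) + 1)))) := by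
  have hq := bulk_q α ω A k f B
  have hX := X_bulk hα ω A k f B
  rw [viscTerm, bigF_eight]
  simp only [bulk_w, bulk_a, bulk_half α ω A k hf B, hX.1, hX.2, fac_bulk hα]
  rw [← uZ_idxOf u (α := α) (β := 3 - α) (w := ω) (A := A + 2 * n + 1)
    (q := f + 2) (B := B + 2 * (k - n) + 1)
    (s := ⟨((ω + 1 : ℕ) : ℤ) - 1, xi 8 (bulk α ω A k f B) (n + 1), Del 8 (bulk α ω A k f B).q,
      eps 8 (bulk α ω A k f B) (n + 1), kap 8 α⟩)
    (by
      unfold xi Del eps kap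
      rw [bulk_half α ω A k hf B, bulk_a, bulk_q]
      rcases hα with rfl | rfl <;> simp [bulk, idxOf, sg] <;> omega)]
  generalize heav (((bulk α ω A k f B).q : ℚ) - 4) = h
  rw [sg_eq (n := k + 1 + 1) (by simp), fac_eq (n := A + 2 * n + 1) (by push_cast; ring),
    fac_eq (x := (B : ℤ) + 2 * (k + 1 : ℕ) - 2 * (n + 1) + 1) (n := B + 2 * (k - n) + 1) (by omega),
    hq, bin_eq (n := k) (m := n) (by simp) (by ring), factorial_two_of_le_one hf]
  norm_num
  field_simp
  ring

/-- The viscous terms form the source of the Laplacian of the velocity. -/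
theorem sum_viscTerm (ν : ℝ) (g c u : Fin 3 → Coeffs) {α : ℤ} (hα : α = 1 ∨ α = 2)
    (ω A k : ℕ) {f : ℕ} (hf : f ≤ 1) (B : ℕ)
    (hdiv : ∀ A q B, nrm α (u (comp α)) ω (A + 1) q B + nrm α (u 0) ω A (q + 1) B
      + nrm α (u (comp (3 - α))) ω A q (B + 1) = 0) :
    ∑ n ∈ Finset.range (k + 1), ∑ y ∈ Finset.range 8,
      viscTerm ν g c u (bulk α ω A k f B) (y + 1) (n + 1) =
    ν / ((ω + 1) * (A.factorial * (f + 2 * (k + 1)).factorial * B.factorial : ℝ)) *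
      source k
        (fun A q B => nrm α (u (comp α)) ω (A + 2) q B + nrm α (u (comp α)) ω A (q + 2) B
          + nrm α (u (comp α)) ω A q (B + 2))
        (fun A q B => nrm α (u 0) ω (A + 2) q B + nrm α (u 0) ω A (q + 2) B
          + nrm α (u 0) ω A q (B + 2))
        (fun A q B => nrm α (u (comp (3 - α))) ω (A + 2) q B
          + nrm α (u (comp (3 - α))) ω A (q + 2) B + nrm α (u (comp (3 - α))) ω A q (B + 2))
        A (f + 2 * (k + 1)) B := by
  have once : ∀ z : ℤ, 1 ≤ z → z ≤ 5 → ∑ n ∈ Finset.range (k + 1),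
      viscTerm ν g c u (bulk α ω A k f B) z (n + 1) =
        viscTerm ν g c u (bulk α ω A k f B) z 1 := by
    intro z h1 h5
    rw [Finset.sum_eq_single 0]
    · norm_num
    · intro n _ hn
      exact viscTerm_eq_zero ν g c u h1 h5 (by omega) _
    · intro h; simp at h
  rw [source_laplacian hdiv, lapPow_eq_reflect, lapPow_eq_reflect,
    Finset.sum_range_succ _ (k + 1), Finset.sum_comm]
  simp only [Finset.sum_range_succ _ 7, Finset.sum_range_succ _ 6, Finset.sum_range_succ _ 5,
    Finset.sum_range_succ _ 4, Finset.sum_range_succ _ 3, Finset.sum_range_succ _ 2,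
    Finset.sum_range_succ _ 1, Finset.sum_range_one]
  norm_num only
  rw [once 1 (by norm_num) (by norm_num), once 2 (by norm_num) (by norm_num),
    once 3 (by norm_num) (by norm_num), once 4 (by norm_num) (by norm_num),
    once 5 (by norm_num) (by norm_num), viscTerm_one ν g c u hα, viscTerm_two ν g c u hα,
    viscTerm_three ν g c u hα, viscTerm_four ν g c u hα, viscTerm_five ν g c u hα ω A k hf]
  rw [Finset.sum_congr rfl fun n hn => viscTerm_six ν g c u hα ω A k hf B
      (Nat.lt_succ_iff.1 (Finset.mem_range.1 hn)),
    Finset.sum_congr rfl fun n hn => viscTerm_seven ν g c u hα ω A k hf B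
      (Nat.lt_succ_iff.1 (Finset.mem_range.1 hn)),
    Finset.sum_congr rfl fun n hn => viscTerm_eight ν g c u hα ω A k hf B
      (Nat.lt_succ_iff.1 (Finset.mem_range.1 hn))]
  simp only [Nat.succ_eq_add_one, ← Finset.mul_sum, Finset.sum_neg_distrib, heav_bulk α ω A k hf B, mul_add,
    Finset.sum_add_distrib, Nat.choose_self, Nat.sub_self]
  rcases Nat.eq_zero_or_pos k with rfl | hk
  · simp
    ring
  · rw [if_neg (by omega)]
    push_cast
    ring_nf

/-! ### The recurrence for the components `1` and `2` -/

theorem fS_one (F : Coeffs) (ω p q r : ℕ) : fS 1 F ω p q r = (p + 1) * F ω (p + 1) q r := if_pos rfl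

theorem fS_zero (F : Coeffs) (ω p q r : ℕ) : fS 0 F ω p q r = (q + 1) * F ω p (q + 1) r := by
  simp [fS]

theorem fS_two (F : Coeffs) (ω p q r : ℕ) : fS 2 F ω p q r = (r + 1) * F ω p q (r + 1) := by
  simp [fS]

theorem comp_one : comp 1 = 1 := rfl

theorem comp_two : comp 2 = 2 := rfl

theorem nrm_fS {α : ℤ} (hα : α = 1 ∨ α = 2) (F : Coeffs) (ω A q B : ℕ) :
    nrm α (fS (comp α) F) ω A q B = nrm α F ω (A + 1) q B ∧
    nrm α (fS 0 F) ω A q B = nrm α F ω A (q + 1) B ∧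
    nrm α (fS (comp (3 - α)) F) ω A q B = nrm α F ω A q (B + 1) := by
  rcases hα with rfl | rfl <;>
    simp only [show (3 : ℤ) - 1 = 2 by norm_num, show (3 : ℤ) - 2 = 1 by norm_num,
      comp_one, comp_two, nrm, fS_one, fS_zero, fS_two, Nat.factorial_succ] <;>
    push_cast <;> refine ⟨?_, ?_, ?_⟩ <;> ring

theorem sum_comp {M : Type*} [AddCommMonoid M] {α : ℤ} (hα : α = 1 ∨ α = 2) (F : Fin 3 → M) :
    ∑ β, F β = F (comp α) + F 0 + F (comp (3 - α)) := by
  rw [Fin.sum_univ_three]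
  rcases hα with rfl | rfl
  · change F 0 + F 1 + F 2 = F 1 + F 0 + F 2
    rw [add_comm (F 0)]
  · change F 0 + F 1 + F 2 = F 2 + F 0 + F 1
    rw [add_comm, ← add_assoc]

/-- The coefficients of the Laplacian. -/
def flap (F : Coeffs) : Coeffs := fun ω p q r => ∑ β, fS β (fS β F) ω p q r

theorem nrm_flap {α : ℤ} (hα : α = 1 ∨ α = 2) (F : Coeffs) (ω A q B : ℕ) :
    nrm α (flap F) ω A q B =
      nrm α F ω (A + 2) q B + nrm α F ω A (q + 2) B + nrm α F ω A q (B + 2) := by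
  rw [← (nrm_fS hα F ω (A + 1) q B).1, ← (nrm_fS hα (fS (comp α) F) ω A q B).1,
    ← (nrm_fS hα F ω A (q + 1) B).2.1, ← (nrm_fS hα (fS 0 F) ω A q B).2.1,
    ← (nrm_fS hα F ω A q (B + 1)).2.2, ← (nrm_fS hα (fS (comp (3 - α)) F) ω A q B).2.2]
  unfold nrm flap
  simp only [sum_comp hα]
  split_ifs <;> ring

theorem IsFormalSolution.nrm_div {ρ μ : ℝ} {g u : Fin 3 → Coeffs} {P : Coeffs}
    (h : IsFormalSolution ρ μ g u P) {α : ℤ} (hα : α = 1 ∨ α = 2) (ω A q B : ℕ) :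
    nrm α (u (comp α)) ω (A + 1) q B + nrm α (u 0) ω A (q + 1) B
      + nrm α (u (comp (3 - α))) ω A q (B + 1) = 0 := by
  rw [← (nrm_fS hα _ ω A q B).1, ← (nrm_fS hα _ ω A q B).2.1, ← (nrm_fS hα _ ω A q B).2.2]
  unfold nrm
  rw [← mul_add, ← mul_add]
  split_ifs
  · have := (h ω A q B).1
    rw [sum_comp hα] at this
    rw [this, mul_zero]
  · have := (h ω B q A).1
    rw [sum_comp hα] at this
    rw [this, mul_zero]

/-- The momentum relation, solved for the time derivative. -/
theorem IsFormalSolution.momentum {ρ μ : ℝ} (hρ : ρ ≠ 0) {g u : Fin 3 → Coeffs} {P : Coeffs}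
    (h : IsFormalSolution ρ μ g u P) (β : Fin 3) (ω p q r : ℕ) :
    (ω + 1) * u β (ω + 1) p q r = -conv u β ω p q r + μ / ρ * flap (u β) ω p q r + g β ω p q r
      + -(1 / ρ) * fS β P ω p q r := by
  have := (h ω p q r).2 β
  unfold conv flap
  unfold fT at this
  field_simp
  linarith

theorem IsFormalSolution.nrm_momentum {ρ μ : ℝ} (hρ : ρ ≠ 0) {g u : Fin 3 → Coeffs} {P : Coeffs}
    (h : IsFormalSolution ρ μ g u P) (α : ℤ) (β : Fin 3) (ω A q B : ℕ) :
    (ω + 1) * nrm α (u β) (ω + 1) A q B = -1 * nrm α (conv u β) ω A q B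
      + μ / ρ * nrm α (flap (u β)) ω A q B + nrm α (g β) ω A q B
      + -(1 / ρ) * nrm α (fS β P) ω A q B := by
  unfold nrm
  split_ifs
  · have := h.momentum hρ β ω A q B
    linear_combination (A.factorial * q.factorial * B.factorial : ℝ) * this
  · have := h.momentum hρ β ω B q A
    linear_combination (A.factorial * q.factorial * B.factorial : ℝ) * this

/-- The velocity coefficients with a large middle index in terms of sources. -/
theorem IsFormalSolution.velocity_eq_source {ρ μ : ℝ} (hρ : ρ ≠ 0) {g u : Fin 3 → Coeffs}
    {P : Coeffs} (h : IsFormalSolution ρ μ g u P) {α : ℤ} (hα : α = 1 ∨ α = 2) (ω A k f B : ℕ) :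
    (ω + 1) * nrm α (u (comp α)) (ω + 1) A (f + 2 * (k + 1)) B =
      (ω + 1) * ((-1) ^ (k + 1) * lapPow k (fun A B => nrm α (u (comp α)) (ω + 1) (A + 2) f B
        + nrm α (u (comp (3 - α))) (ω + 1) (A + 1) f (B + 1)) A B)
      - source k (nrm α (conv u (comp α)) ω) (nrm α (conv u 0) ω) (nrm α (conv u (comp (3 - α))) ω)
        A (f + 2 * (k + 1)) B
      + μ / ρ * source k (nrm α (flap (u (comp α))) ω) (nrm α (flap (u 0)) ω)
        (nrm α (flap (u (comp (3 - α)))) ω) A (f + 2 * (k + 1)) B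
      + source k (nrm α (g (comp α)) ω) (nrm α (g 0) ω) (nrm α (g (comp (3 - α))) ω)
        A (f + 2 * (k + 1)) B := by
  have key := solenoidal_eq_source
    (Va := fun A q B => (ω + 1) * nrm α (u (comp α)) (ω + 1) A q B)
    (V0 := fun A q B => (ω + 1) * nrm α (u 0) (ω + 1) A q B)
    (Vb := fun A q B => (ω + 1) * nrm α (u (comp (3 - α))) (ω + 1) A q B)
    (φ := fun A q B => -(1 / ρ) * nrm α P ω A q B)
    (fun A q B => by
      rw [← mul_add, ← mul_add, h.nrm_div hα, mul_zero])
    (fun A q B => by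
      rw [h.nrm_momentum hρ, (nrm_fS hα P ω A q B).1])
    (fun A q B => by
      rw [h.nrm_momentum hρ, (nrm_fS hα P ω A q B).2.1])
    (fun A q B => by
      rw [h.nrm_momentum hρ, (nrm_fS hα P ω A q B).2.2]) k f A B
  rw [source_add, source_add, source_smul, source_smul] at key
  simp only [← mul_add] at key
  rw [lapPow_smul] at key
  linear_combination key

/-- Beyond the convective terms the time index of the second factor is negative, so that this
factor is the number `1`. -/
theorem childZ12_of_le {s : Idx} (hl : ¬ IsLeaf s) (hσ : 0 < sigma s) {i : ℤ}
    (hi : sigma s * s.w ≤ i) : P2 (childZ12 s i) := by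
  rw [childZ12_eq hl]
  left
  have : s.w ≤ i / sigma s := Int.le_ediv_of_mul_le hσ (by linarith)
  simp only
  omega

theorem Gam12_mul_of_le (ν : ℝ) (g c u : Fin 3 → Coeffs) {s : Idx} (hl : ¬ IsLeaf s)
    (hσ : 0 < sigma s) {i : ℤ} (hi : sigma s * s.w ≤ i) :
    Gam12 ν g c s i * (uZ u (childT12 s i) * uZ u (childZ12 s i)) =
      viscTerm ν g c u s (zz s i) (nn s i) := by
  rw [uZ_of_P2 u (childZ12_of_le hl hσ hi), mul_one]
  unfold Gam12 childT12 viscTerm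
  rw [if_neg hl, if_neg (by omega), if_neg fun h => hl (Or.inl h), if_neg fun h => hl (Or.inr h),
    if_neg (by omega)]

/-- The terms of an inner index of the component `1` or `2`: the convective ones, the one of the
data and of the body acceleration, and the viscous ones in groups of eight. -/
theorem sum_terms (ν : ℝ) (g c u : Fin 3 → Coeffs) {s : Idx} (hα : s.a = 1 ∨ s.a = 2)
    (hl : ¬ IsLeaf s) (hw : 0 < s.w) (hp : 1 < s.p) (hq : 1 < s.q) (hr : 1 < s.r) :
    ∑ i ∈ Finset.Ico 0 (sigma s * s.w + 8 * (s.q / 2) + 1),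
      Gam12 ν g c s i * (uZ u (childT12 s i) * uZ u (childZ12 s i)) =
    ∑ i ∈ Finset.Ico 0 (sigma s * s.w),
      Gam12 ν g c s i * (uZ u (childT12 s i) * uZ u (childZ12 s i))
    + (bigF0 c s + bigF0t g s
    + ∑ n ∈ Finset.range (s.q / 2).toNat, ∑ y ∈ Finset.range 8,
        viscTerm ν g c u s (y + 1) (n + 1)) := by
  have hσ := sigma_pos hα hp hq hr
  have hσw : 0 ≤ sigma s * s.w := by positivity
  have he : 0 ≤ s.q / 2 := by omega
  rw [show sigma s * s.w + 8 * (s.q / 2) + 1 = sigma s * s.w + (1 + s.q / 2 * 8) by ring,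
    sum_Ico_add _ hσw (by omega), sum_Ico_add _ (by norm_num) (by omega),
    sum_Ico_mul _ he (by norm_num), show Finset.Ico (0 : ℤ) 1 = {0} from rfl,
    Finset.sum_singleton]
  congr 2
  · rw [Gam12_mul_of_le ν g c u hl hσ (by omega)]
    have hχ : chi s (sigma s * s.w + 0) = 0 := by unfold chi; ring
    have hz : zz s (sigma s * s.w + 0) = 0 := by unfold zz; rw [hχ]; rfl
    rw [hz]
    unfold viscTerm bigF
    rw [if_pos rfl, if_pos ⟨hw, hp, hq, hr⟩, uZ_of_P2, mul_one]
    refine Or.inr (Or.inl ?_)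
    simp [xi]
  · rw [← Int.toNat_of_nonneg he, sum_Ico_natCast, Int.toNat_natCast]
    refine Finset.sum_congr rfl fun n _ => ?_
    rw [show (8 : ℤ) = (8 : ℕ) from rfl, sum_Ico_natCast]
    refine Finset.sum_congr rfl fun y hy => ?_
    rw [Finset.mem_range] at hy
    rw [Gam12_mul_of_le ν g c u hl hσ (by push_cast; omega)]
    have hχ : chi s (sigma s * s.w + (1 + (n * (8 : ℕ) + y))) = 8 * n + y + 1 := by
      unfold chi; push_cast; ring
    have hz : zz s (sigma s * s.w + (1 + (n * (8 : ℕ) + y))) = y + 1 := by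
      unfold zz; rw [hχ]; omega
    have hn : nn s (sigma s * s.w + (1 + (n * (8 : ℕ) + y))) = n + 1 := by
      unfold nn; rw [hχ]; omega
    rw [hz, hn]

/-- The values of the coefficients `c` and `u` agree where the data are prescribed. -/
def SameData (c u : Fin 3 → Coeffs) : Prop :=
  ∀ α ω p q r, (ω = 0 ∨ p ≤ 1 ∨ q ≤ 1 ∨ r ≤ 1) → u α ω p q r = c α ω p q r

theorem SameData.nrm_eq {c u : Fin 3 → Coeffs} (h : SameData c u) (α : ℤ) (β : Fin 3)
    (ω A : ℕ) {f : ℕ} (hf : f ≤ 1) (B : ℕ) : nrm α (c β) ω A f B = nrm α (u β) ω A f B := by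
  unfold nrm
  rw [h _ _ _ _ _ (by omega), h _ _ _ _ _ (by omega)]

/-- Every inner index has the form `bulk`, with `q = f + 2 (k + 1)` and `f` the parity of `q`. -/
theorem exists_bulk {s : Idx} (hα : s.a = 1 ∨ s.a = 2) (hw : 0 < s.w) (hp : 1 < s.p)
    (hq : 1 < s.q) (hr : 1 < s.r) : ∃ ω A k f B : ℕ, f ≤ 1 ∧ s = bulk s.a ω A k f B := by
  refine ⟨(s.w - 1).toNat, (X s s.a).toNat, (s.q / 2 - 1).toNat, (s.q % 2).toNat,
    (X s (3 - s.a)).toNat, by omega, ?_⟩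
  obtain ⟨w, p, q, r, a⟩ := s
  rcases hα with h | h <;> simp only at h <;> subst h <;> simp [bulk, idxOf, X] at * <;> omega

/-- The recurrence for the components `1` and `2` of a solution. -/
theorem IsFormalSolution.sum_eq {ρ μ : ℝ} (hρ : ρ ≠ 0) {g u c : Fin 3 → Coeffs} {P : Coeffs}
    (h : IsFormalSolution ρ μ g u P) (hc : SameData c u) {s : Idx} (hα : s.a = 1 ∨ s.a = 2)
    (hl : ¬ IsLeaf s) (hw : 0 < s.w) (hp : 1 < s.p) (hq : 1 < s.q) (hr : 1 < s.r) :
    ∑ i ∈ Finset.Ico 0 (sigma s * s.w + 8 * (s.q / 2) + 1),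
      Gam12 (μ / ρ) g c s i * (uZ u (childT12 s i) * uZ u (childZ12 s i)) = uZ u s := by
  rw [sum_terms _ g c u hα hl hw hp hq hr, sum_convective_eq_blocks _ g c u hα hl hw hp hq hr]
  obtain ⟨ω, A, k, f, B, hf, hs⟩ := exists_bulk hα hw hp hq hr
  obtain ⟨α, hα'⟩ : ∃ α, α = s.a := ⟨_, rfl⟩
  rw [← hα'] at hα hs
  subst hs
  rw [sum_convBlock u hα ω A k hf B, bigF0_bulk c hα ω A k hf B, bigF0t_bulk g hα ω A k hf B,
    bulk_half α ω A k hf B, Int.toNat_natCast,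
    sum_viscTerm (μ / ρ) g c u hα ω A k hf B (h.nrm_div hα ω), bulk_w, fac_bulk hα]
  simp only [hc.nrm_eq α _ _ _ hf, ← nrm_flap hα]
  have key := h.velocity_eq_source hρ hα ω A k f B
  rw [← uZ_idxOf u (α := α) (β := α) (w := ω + 1) (A := A) (q := f + 2 * (k + 1)) (B := B)
    (s := bulk α ω A k f B) rfl] at key
  have hω : (ω + 1 : ℝ) ≠ 0 := by positivity
  have hD : (A.factorial * (f + 2 * (k + 1)).factorial * B.factorial : ℝ) ≠ 0 := by positivity
  generalize (A.factorial * (f + 2 * (k + 1)).factorial * B.factorial : ℝ) = D at *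
  generalize μ / ρ = ν at *
  push_cast
  field_simp
  linear_combination -key

/-! ### The velocity coefficients -/

theorem not_isLeaf_iff {s : Idx} : ¬ IsLeaf s ↔ 0 < s.w ∧ 1 < s.p ∧ 1 < s.q ∧ 1 < s.r := by
  simp only [IsLeaf, P2, P3]
  omega

theorem fF_of_one_two {s : Idx} (hα : s.a = 1 ∨ s.a = 2) (hl : ¬ IsLeaf s) :
    fF s = sigma s * s.w + 8 * (s.q / 2) := by
  rw [not_isLeaf_iff] at hl
  unfold fF
  rw [if_neg (by omega), if_neg (by omega), if_pos (by omega)]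

theorem fF_of_zero {s : Idx} (hα : s.a = 0) (hl : ¬ IsLeaf s) :
    fF s + 1 = (fF (toX s) + 1) + (fF (toZ s) + 1) := by
  have hl' := not_isLeaf_iff.1 hl
  by_cases hq : s.q = 2
  · rw [fF_of_isLeaf (s := toX s), fF_of_isLeaf (s := toZ s)]
    · unfold fF
      rw [if_neg (by omega), if_pos ⟨hα, hq⟩]
      norm_num
    · right; simp only [toZ, P3]; omega
    · right; simp only [toX, P3]; omega
  · rw [fF_of_one_two (s := toX s) (Or.inl rfl) (not_isLeaf_iff.2 (by simp only [toX]; omega)),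
      fF_of_one_two (s := toZ s) (Or.inr rfl) (not_isLeaf_iff.2 (by simp only [toZ]; omega))]
    unfold fF
    rw [if_neg (by omega), if_neg (by omega), if_neg (by omega)]
    simp only [toX, toZ]
    ring

theorem fF_nonneg_of_one_two {s : Idx} (hα : s.a = 1 ∨ s.a = 2) : 0 ≤ fF s := by
  by_cases hl : IsLeaf s
  · rw [fF_of_isLeaf hl]
  · rw [fF_of_one_two hα hl]
    have hl' := not_isLeaf_iff.1 hl
    have := sigma_pos hα hl'.2.1 hl'.2.2.1 hl'.2.2.2
    have h1 := mul_pos this hl'.1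
    omega

theorem fF_nonneg {s : Idx} (hs : IsNode s) : 0 ≤ fF s := by
  rcases hs with hl | h0 | hα
  · rw [fF_of_isLeaf hl]
  · by_cases hl : IsLeaf s
    · rw [fF_of_isLeaf hl]
    · have h1 := fF_of_zero h0 hl
      have h2 := fF_nonneg_of_one_two (s := toX s) (Or.inl rfl)
      have h3 := fF_nonneg_of_one_two (s := toZ s) (Or.inr rfl)
      omega
  · exact fF_nonneg_of_one_two hα

theorem childT12_node {s : Idx} (hα : s.a = 1 ∨ s.a = 2) (hl : ¬ IsLeaf s) {i : ℤ} (hi : 0 ≤ i) :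
    IsNode (childT12 s i) ∧ (IsLeaf (childT12 s i) ∨ (childT12 s i).w < s.w) := by
  obtain ⟨hw, hp, hq, hr⟩ := not_isLeaf_iff.1 hl
  have hσ := sigma_pos hα hp hq hr
  by_cases hi' : i < sigma s * s.w
  · rw [childT12_of_lt hl hi']
    have hd := dD_mem hα hw hp hq hr hi hi'
    obtain ⟨-, -, hb, -, ha⟩ := block_ranges hα hp hq hr hd.1 hd.2
    refine ⟨Or.inr ?_, Or.inr (Int.ediv_lt_of_lt_mul hσ (by linarith))⟩
    simp only
    rcases hb with hb | hb <;> rcases ha with ha | ha | ha <;> rcases hα with hα | hα <;>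
      rw [hb, ha, hα] <;> norm_num
  · have hT : childT12 s i = ⟨s.w - 1, xi (zz s i) s (nn s i), Del (zz s i) s.q,
        eps (zz s i) s (nn s i), kap (zz s i) s.a⟩ := by
      unfold childT12
      rw [if_neg fun h => hl (Or.inl h), if_neg fun h => hl (Or.inr h), if_neg hi']
    rw [hT]
    refine ⟨?_, Or.inr (by simp only; omega)⟩
    by_cases hz : zz s i = 0
    · left; left; right; left
      simp [hz, xi]
    · right
      simp only [kap, if_neg hz]
      split_ifs <;> omega

theorem childZ12_node {s : Idx} (hα : s.a = 1 ∨ s.a = 2) (hl : ¬ IsLeaf s) {i : ℤ} (hi : 0 ≤ i) :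
    IsNode (childZ12 s i) ∧ (IsLeaf (childZ12 s i) ∨ (childZ12 s i).w < s.w) := by
  obtain ⟨hw, hp, hq, hr⟩ := not_isLeaf_iff.1 hl
  have hσ := sigma_pos hα hp hq hr
  by_cases hi' : i < sigma s * s.w
  · rw [childZ12_eq hl]
    have hd := dD_mem hα hw hp hq hr hi hi'
    obtain ⟨-, -, -, hφ, -⟩ := block_ranges hα hp hq hr hd.1 hd.2
    refine ⟨Or.inr hφ, Or.inr ?_⟩
    have := Int.ediv_nonneg hi hσ.le
    simp only
    omega
  · have := childZ12_of_le hl hσ (not_lt.1 hi')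
    exact ⟨Or.inl (Or.inl this), Or.inl (Or.inl this)⟩

theorem child_node {s : Idx} (hs : IsNode s) (hl : ¬ IsLeaf s) {i : ℤ} (hi : 0 ≤ i) :
    (IsNode (childT s i) ∧ (IsLeaf (childT s i) ∨ (childT s i).w < s.w)) ∧
    (IsNode (childZ s i) ∧ (IsLeaf (childZ s i) ∨ (childZ s i).w < s.w)) := by
  rcases hs.resolve_left hl with h0 | hα
  · by_cases hq : s.q = 2
    · have := isLeaf_children_of_zero_two hl ⟨h0, hq⟩ i
      exact ⟨⟨Or.inl this.1, Or.inl this.1⟩, Or.inl this.2, Or.inl this.2⟩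
    · have hl' := not_isLeaf_iff.1 hl
      have hX : ¬ IsLeaf (toX s) := not_isLeaf_iff.2 (by simp only [toX]; omega)
      have hZ : ¬ IsLeaf (toZ s) := not_isLeaf_iff.2 (by simp only [toZ]; omega)
      have hn : ¬ (P2 s ∨ P3 s ∨ s.a = 1 ∨ s.a = 2) := by
        rintro (h | h | h | h)
        · exact hl (Or.inl h)
        · exact hl (Or.inr h)
        · omega
        · omega
      unfold childT childZ
      rw [if_neg hn, if_neg hn]
      split_ifs with h
      · exact ⟨childT12_node (Or.inl rfl) hX hi, childZ12_node (Or.inl rfl) hX hi⟩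
      · exact ⟨childT12_node (Or.inr rfl) hZ (by omega), childZ12_node (Or.inr rfl) hZ (by omega)⟩
  · unfold childT childZ
    rw [if_pos (Or.inr (Or.inr hα)), if_pos (Or.inr (Or.inr hα))]
    exact ⟨childT12_node hα hl hi, childZ12_node hα hl hi⟩

/-- The expansion of a coefficient of the component `1` or `2`, which is trivial for a leaf. -/
theorem IsFormalSolution.expand_one_two {ρ μ : ℝ} (hρ : ρ ≠ 0) {g u c : Fin 3 → Coeffs}
    {P : Coeffs} (h : IsFormalSolution ρ μ g u P) (hc : SameData c u) {s : Idx}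
    (hα : s.a = 1 ∨ s.a = 2) :
    ∑ i ∈ Finset.Ico 0 (fF s + 1),
      Gam12 (μ / ρ) g c s i * (uZ u (childT12 s i) * uZ u (childZ12 s i)) = uZ u s := by
  by_cases hl : IsLeaf s
  · have h1 := uZ_mul_of_isLeaf u hl 0 0
    have h2 := Gam_of_isLeaf (μ / ρ) g c hl 0
    unfold childT childZ at h1
    unfold Gam at h2
    rw [if_pos (by tauto), if_pos (by tauto)] at h1
    rw [if_pos (by tauto)] at h2
    rw [fF_of_isLeaf hl, show Finset.Ico (0 : ℤ) (0 + 1) = {0} from rfl, Finset.sum_singleton, h1,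
      h2, one_mul]
  · obtain ⟨hw, hp, hq, hr⟩ := not_isLeaf_iff.1 hl
    rw [fF_of_one_two hα hl]
    exact h.sum_eq hρ hc hα hl hw hp hq hr

/-- The recurrence for the component `0`: the divergence relation expresses it by a coefficient of
the component `1` and one of the component `2`, whose recurrences are put one after the other. -/
theorem IsFormalSolution.expand_zero {ρ μ : ℝ} (hρ : ρ ≠ 0) {g u c : Fin 3 → Coeffs}
    {P : Coeffs} (h : IsFormalSolution ρ μ g u P) (hc : SameData c u) {s : Idx}
    (h0 : s.a = 0) (hl : ¬ IsLeaf s) :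
    ∑ i ∈ Finset.Ico 0 (fF s + 1),
      Gam (μ / ρ) g c s i * (uZ u (childT s i) * uZ u (childZ s i)) = uZ u s := by
  have hX := fF_nonneg_of_one_two (s := toX s) (Or.inl rfl)
  have hZ := fF_nonneg_of_one_two (s := toZ s) (Or.inr rfl)
  have hn : ¬ (P2 s ∨ P3 s ∨ s.a = 1 ∨ s.a = 2) := by
    rintro (h | h | h | h)
    · exact hl (Or.inl h)
    · exact hl (Or.inr h)
    · omega
    · omega
  rw [fF_of_zero h0 hl, sum_Ico_add _ (by omega) (by omega)]
  unfold Gam childT childZ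
  simp only [if_neg hn]
  have e1 : ∀ i ∈ Finset.Ico 0 (fF (toX s) + 1),
      ((if i ≤ fF (toX s) then -((s.p + 1) / (s.q : ℝ)) * Gam12 (μ / ρ) g c (toX s) i
        else -((s.r + 1) / (s.q : ℝ)) * Gam12 (μ / ρ) g c (toZ s) (i - fF (toX s) - 1)) *
      (uZ u (if i ≤ fF (toX s) then childT12 (toX s) i
          else childT12 (toZ s) (i - fF (toX s) - 1)) *
        uZ u (if i ≤ fF (toX s) then childZ12 (toX s) i
          else childZ12 (toZ s) (i - fF (toX s) - 1)))) =
      -((s.p + 1) / (s.q : ℝ)) * (Gam12 (μ / ρ) g c (toX s) i *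
        (uZ u (childT12 (toX s) i) * uZ u (childZ12 (toX s) i))) := by
    intro i hi
    rw [Finset.mem_Ico] at hi
    have : i ≤ fF (toX s) := by omega
    rw [if_pos this, if_pos this, if_pos this, mul_assoc]
  have e2 : ∀ i ∈ Finset.Ico 0 (fF (toZ s) + 1),
      ((if fF (toX s) + 1 + i ≤ fF (toX s) then
          -((s.p + 1) / (s.q : ℝ)) * Gam12 (μ / ρ) g c (toX s) (fF (toX s) + 1 + i)
        else -((s.r + 1) / (s.q : ℝ)) *
          Gam12 (μ / ρ) g c (toZ s) (fF (toX s) + 1 + i - fF (toX s) - 1)) *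
      (uZ u (if fF (toX s) + 1 + i ≤ fF (toX s) then childT12 (toX s) (fF (toX s) + 1 + i)
          else childT12 (toZ s) (fF (toX s) + 1 + i - fF (toX s) - 1)) *
        uZ u (if fF (toX s) + 1 + i ≤ fF (toX s) then childZ12 (toX s) (fF (toX s) + 1 + i)
          else childZ12 (toZ s) (fF (toX s) + 1 + i - fF (toX s) - 1)))) =
      -((s.r + 1) / (s.q : ℝ)) * (Gam12 (μ / ρ) g c (toZ s) i *
        (uZ u (childT12 (toZ s) i) * uZ u (childZ12 (toZ s) i))) := by
    intro i hi
    rw [Finset.mem_Ico] at hi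
    have : ¬ fF (toX s) + 1 + i ≤ fF (toX s) := by omega
    rw [if_neg this, if_neg this, if_neg this,
      show fF (toX s) + 1 + i - fF (toX s) - 1 = i by ring, mul_assoc]
  rw [Finset.sum_congr rfl e1, Finset.sum_congr rfl e2, ← Finset.mul_sum, ← Finset.mul_sum,
    h.expand_one_two hρ hc (s := toX s) (Or.inl rfl),
    h.expand_one_two hρ hc (s := toZ s) (Or.inr rfl)]
  obtain ⟨hw, hp, hq, hr⟩ := not_isLeaf_iff.1 hl
  obtain ⟨w, p, q, r, a⟩ := s
  simp only at h0 hw hp hq hr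
  subst h0
  lift w to ℕ using hw.le
  lift p to ℕ using by omega
  lift r to ℕ using by omega
  obtain ⟨q, rfl⟩ : ∃ q' : ℕ, q = q' + 1 := ⟨(q - 1).toNat, by omega⟩
  have hd := (h w p q r).1
  rw [Fin.sum_univ_three, fS_zero, fS_one, fS_two] at hd
  unfold toX toZ
  simp only
  rw [uZ_of_eq u (w := w) (p := p + 1) (q := q) (r := r) rfl rfl (by simp) rfl,
    uZ_of_eq u (w := w) (p := p) (q := q) (r := r + 1) rfl rfl (by simp) rfl,
    uZ_of_eq u (w := w) (p := p) (q := q + 1) (r := r) rfl rfl rfl rfl]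
  simp only [comp_zero, comp_one, comp_two]
  push_cast
  field_simp
  linear_combination -hd

theorem IsFormalSolution.hasExpansion {ρ μ : ℝ} (hρ : ρ ≠ 0) {g u c : Fin 3 → Coeffs}
    {P : Coeffs} (h : IsFormalSolution ρ μ g u P) (hc : SameData c u) :
    HasExpansion (μ / ρ) g c (uZ u) where
  leaf s hs := by
    unfold uZ
    split_ifs with h2
    · rfl
    · have h3 := hs.resolve_left h2
      exact hc _ _ _ _ _ (by simp only [P2, P3] at h2 h3; omega)
  fF_nonneg _ := fF_nonneg
  expand s hs hl := by
    rcases hs.resolve_left hl with h0 | hα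
    · exact (h.expand_zero hρ hc h0 hl).symm
    · rw [← h.expand_one_two hρ hc hα]
      unfold Gam childT childZ
      simp only [if_pos (show P2 s ∨ P3 s ∨ s.a = 1 ∨ s.a = 2 from Or.inr (Or.inr hα))]
  childT_node s hs hl i hi _ := (child_node hs hl hi).1
  childZ_node s hs hl i hi _ := (child_node hs hl hi).2

/-- The velocity coefficients of a formal solution are given by the explicit expression. -/
theorem IsFormalSolution.velocity_eq {ρ μ : ℝ} (hρ : ρ ≠ 0) {g u c : Fin 3 → Coeffs}
    {P : Coeffs} (h : IsFormalSolution ρ μ g u P) (hc : SameData c u) (α : Fin 3)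
    (ω p q r : ℕ) : u α ω p q r = velocityFormula (μ / ρ) g c α ω p q r := by
  rw [velocityFormula_eq (h.hasExpansion hρ hc), uZ_of_eq u rfl rfl rfl rfl]
  congr
  fin_cases α <;> rfl

/-- The pressure coefficients of a formal solution are given by the `x`-momentum relation. -/
theorem IsFormalSolution.pressure_eq {ρ μ : ℝ} (hρ : ρ ≠ 0) {g u : Fin 3 → Coeffs}
    {P : Coeffs} (h : IsFormalSolution ρ μ g u P) {π₀ : ℕ → ℕ → ℕ → ℝ}
    (hπ : ∀ ω q r, P ω 0 q r = π₀ ω q r) (ω p q r : ℕ) :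
    P ω p q r = pressureFormula ρ (μ / ρ) g u π₀ ω p q r := by
  cases p with
  | zero => exact hπ ω q r
  | succ p =>
    have := (h ω p q r).2 1
    rw [Fin.sum_univ_three, Fin.sum_univ_three] at this
    simp only [fT, fS_one, fS_zero, fS_two, fMul] at this
    unfold pressureFormula
    simp only [Finset.sum_add_distrib]
    have hp : (p + 1 : ℝ) ≠ 0 := by positivity
    have e : ∀ a b c : ℝ, a * (b * c) = b * a * c := fun a b c => by ring
    simp only [e] at this
    push_cast at this
    field_simp
    linear_combination this

/-! ### Differentiation of power series -/

/-- The open box of half sides `R` around the origin. -/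
def box (R : SpaceTime) : Set SpaceTime :=
  Set.Ioo (-R.1) R.1 ×ˢ (Set.Ioo (-R.2.1) R.2.1 ×ˢ
    (Set.Ioo (-R.2.2.1) R.2.2.1 ×ˢ Set.Ioo (-R.2.2.2) R.2.2.2))

theorem mem_box {X R : SpaceTime} : X ∈ box R ↔
    |X.1| < R.1 ∧ |X.2.1| < R.2.1 ∧ |X.2.2.1| < R.2.2.1 ∧ |X.2.2.2| < R.2.2.2 := by
  simp only [box, Set.mem_prod, Set.mem_Ioo, abs_lt]

theorem isOpen_box (R : SpaceTime) : IsOpen (box R) :=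
  isOpen_Ioo.prod (isOpen_Ioo.prod (isOpen_Ioo.prod isOpen_Ioo))

theorem convex_box (R : SpaceTime) : Convex ℝ (box R) :=
  (convex_Ioo _ _).prod ((convex_Ioo _ _).prod ((convex_Ioo _ _).prod (convex_Ioo _ _)))

theorem abs_term (a : Coeffs) (X : SpaceTime) (n : ℕ × ℕ × ℕ × ℕ) :
    |term a X n| = |a n.1 n.2.1 n.2.2.1 n.2.2.2| * |X.1| ^ n.1 * |X.2.1| ^ n.2.1
      * |X.2.2.1| ^ n.2.2.1 * |X.2.2.2| ^ n.2.2.2 := by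
  simp only [term, abs_mul, abs_pow]

theorem summable_term_of_mem_box {a : Coeffs} {X R : SpaceTime} (h : X ∈ box R)
    (hR : Summable (term a R)) : Summable (term a X) := by
  rw [mem_box] at h
  refine Summable.of_norm_bounded hR.abs fun n => ?_
  rw [Real.norm_eq_abs, abs_term, abs_term]
  have h1 := h.1.le.trans (le_abs_self _)
  have h2 := h.2.1.le.trans (le_abs_self _)
  have h3 := h.2.2.1.le.trans (le_abs_self _)
  have h4 := h.2.2.2.le.trans (le_abs_self _)
  gcongr

/-- The domain of convergence is a union of boxes. -/
theorem mem_convDomain_iff {a : Coeffs} {X : SpaceTime} :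
    X ∈ convDomain a ↔ ∃ R, X ∈ box R ∧ Summable (term a R) := by
  constructor
  · intro h
    rw [convDomain, mem_interior_iff_mem_nhds] at h
    -- the point `X`, moved away from the origin in every coordinate
    obtain ⟨σ, hσ⟩ : ∃ σ : ℝ → ℝ, ∀ x ε : ℝ, 0 < ε → |x + ε * σ x| = |x| + ε := by
      refine ⟨fun x => if 0 ≤ x then 1 else -1, fun x ε hε => ?_⟩
      dsimp only
      split_ifs with hx
      · rw [abs_of_nonneg (by linarith), abs_of_nonneg hx]; ring
      · rw [abs_of_neg (by linarith), abs_of_neg (not_le.1 hx)]; ring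
    have hc : Filter.Tendsto (fun ε : ℝ => ((X.1 + ε * σ X.1, X.2.1 + ε * σ X.2.1,
        X.2.2.1 + ε * σ X.2.2.1, X.2.2.2 + ε * σ X.2.2.2) : SpaceTime)) (nhds 0) (nhds X) := by
      have : Continuous (fun ε : ℝ => ((X.1 + ε * σ X.1, X.2.1 + ε * σ X.2.1,
        X.2.2.1 + ε * σ X.2.2.1, X.2.2.2 + ε * σ X.2.2.2) : SpaceTime)) := by fun_prop
      simpa using this.tendsto 0
    obtain ⟨δ, hδ, hb⟩ := Metric.eventually_nhds_iff.1 (hc.eventually h)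
    have hS := @hb (δ / 2) (by rw [Real.dist_eq, sub_zero, abs_of_pos] <;> linarith)
    have h2 : 0 < δ / 2 := by linarith
    refine ⟨(|X.1| + δ / 2, |X.2.1| + δ / 2, |X.2.2.1| + δ / 2, |X.2.2.2| + δ / 2),
      mem_box.2 ⟨?_, ?_, ?_, ?_⟩, ?_⟩
    iterate 4 (simp only; linarith)
    · refine Summable.of_norm_bounded (Summable.abs hS) fun n => le_of_eq ?_
      have hp : ∀ x : ℝ, |(|x| + δ / 2)| = |x| + δ / 2 := fun x => abs_of_nonneg (by positivity)
      rw [Real.norm_eq_abs, abs_term, abs_term]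
      simp only [hσ _ _ h2, hp]
  · rintro ⟨R, hX, hR⟩
    exact mem_interior.2 ⟨box R, fun Y hY => summable_term_of_mem_box hY hR, isOpen_box R, hX⟩

theorem exists_between_box {X R : SpaceTime} (h : X ∈ box R) : ∃ r, X ∈ box r ∧
    (0 ≤ r.1 ∧ 0 ≤ r.2.1 ∧ 0 ≤ r.2.2.1 ∧ 0 ≤ r.2.2.2) ∧
    (r.1 < R.1 ∧ r.2.1 < R.2.1 ∧ r.2.2.1 < R.2.2.1 ∧ r.2.2.2 < R.2.2.2) := by
  rw [mem_box] at h
  obtain ⟨r1, h1⟩ := exists_between h.1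
  obtain ⟨r2, h2⟩ := exists_between h.2.1
  obtain ⟨r3, h3⟩ := exists_between h.2.2.1
  obtain ⟨r4, h4⟩ := exists_between h.2.2.2
  exact ⟨(r1, r2, r3, r4), mem_box.2 ⟨h1.1, h2.1, h3.1, h4.1⟩,
    ⟨(abs_nonneg _).trans h1.1.le, (abs_nonneg _).trans h2.1.le, (abs_nonneg _).trans h3.1.le,
      (abs_nonneg _).trans h4.1.le⟩, h1.2, h2.2, h3.2, h4.2⟩

theorem isOpen_convDomain (a : Coeffs) : IsOpen (convDomain a) := isOpen_interior

theorem summable_of_mem_convDomain {a : Coeffs} {X : SpaceTime} (h : X ∈ convDomain a) :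
    Summable (term a X) := by
  have := interior_subset h
  exact this

theorem zero_mem_convDomain {a : Coeffs} {X : SpaceTime} (h : X ∈ convDomain a) :
    (0 : SpaceTime) ∈ convDomain a := by
  obtain ⟨R, hX, hR⟩ := mem_convDomain_iff.1 h
  rw [mem_box] at hX
  refine mem_convDomain_iff.2 ⟨R, mem_box.2 ?_, hR⟩
  simp only [Prod.fst_zero, Prod.snd_zero, abs_zero]
  exact ⟨(abs_nonneg _).trans_lt hX.1, (abs_nonneg _).trans_lt hX.2.1,
    (abs_nonneg _).trans_lt hX.2.2.1, (abs_nonneg _).trans_lt hX.2.2.2⟩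

/-- The four partial derivatives of the term of index `n`. -/
def dterm (a : Coeffs) (X : SpaceTime) (n : ℕ × ℕ × ℕ × ℕ) : Fin 4 → ℝ
  | 0 => a n.1 n.2.1 n.2.2.1 n.2.2.2 * (n.1 * X.1 ^ (n.1 - 1)) * X.2.1 ^ n.2.1
      * X.2.2.1 ^ n.2.2.1 * X.2.2.2 ^ n.2.2.2
  | 1 => a n.1 n.2.1 n.2.2.1 n.2.2.2 * X.1 ^ n.1 * (n.2.1 * X.2.1 ^ (n.2.1 - 1))
      * X.2.2.1 ^ n.2.2.1 * X.2.2.2 ^ n.2.2.2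
  | 2 => a n.1 n.2.1 n.2.2.1 n.2.2.2 * X.1 ^ n.1 * X.2.1 ^ n.2.1
      * (n.2.2.1 * X.2.2.1 ^ (n.2.2.1 - 1)) * X.2.2.2 ^ n.2.2.2
  | 3 => a n.1 n.2.1 n.2.2.1 n.2.2.2 * X.1 ^ n.1 * X.2.1 ^ n.2.1 * X.2.2.1 ^ n.2.2.1
      * (n.2.2.2 * X.2.2.2 ^ (n.2.2.2 - 1))

/-- The four coordinates, as linear forms. -/
def coord : Fin 4 → SpaceTime →L[ℝ] ℝ
  | 0 => ContinuousLinearMap.fst ℝ ℝ (ℝ × ℝ × ℝ)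
  | 1 => (ContinuousLinearMap.fst ℝ ℝ (ℝ × ℝ)).comp (ContinuousLinearMap.snd ℝ ℝ (ℝ × ℝ × ℝ))
  | 2 => ((ContinuousLinearMap.fst ℝ ℝ ℝ).comp (ContinuousLinearMap.snd ℝ ℝ (ℝ × ℝ))).comp
      (ContinuousLinearMap.snd ℝ ℝ (ℝ × ℝ × ℝ))
  | 3 => ((ContinuousLinearMap.snd ℝ ℝ ℝ).comp (ContinuousLinearMap.snd ℝ ℝ (ℝ × ℝ))).comp
      (ContinuousLinearMap.snd ℝ ℝ (ℝ × ℝ × ℝ))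

theorem norm_coord_le (i : Fin 4) : ‖coord i‖ ≤ 1 := by
  refine ContinuousLinearMap.opNorm_le_bound _ zero_le_one fun v => ?_
  have h1 := norm_fst_le v
  have h2 := norm_snd_le v
  have h3 := norm_fst_le v.2
  have h4 := norm_snd_le v.2
  have h5 := norm_fst_le v.2.2
  have h6 := norm_snd_le v.2.2
  rw [one_mul]
  fin_cases i <;> simp [coord] <;> simp only [Real.norm_eq_abs] at * <;> linarith

theorem hasFDerivAt_term (a : Coeffs) (X : SpaceTime) (n : ℕ × ℕ × ℕ × ℕ) :
    HasFDerivAt (fun X => term a X n) (∑ i, dterm a X n i • coord i) X := by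
  have h0 := (coord 0).hasFDerivAt (x := X)
  have h1 := (coord 1).hasFDerivAt (x := X)
  have h2 := (coord 2).hasFDerivAt (x := X)
  have h3 := (coord 3).hasFDerivAt (x := X)
  have := (((h0.pow n.1).const_mul (a n.1 n.2.1 n.2.2.1 n.2.2.2)).mul (h1.pow n.2.1)).mul
    (h2.pow n.2.2.1) |>.mul (h3.pow n.2.2.2)
  refine this.congr_fderiv ?_
  ext <;> simp [Fin.sum_univ_four, coord, dterm] <;> ring_nf

theorem mul_pow_pred_le {r R : ℝ} (hr : 0 ≤ r) (h : r < R) (n : ℕ) :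
    n * r ^ (n - 1) ≤ (R - r)⁻¹ * R ^ n := by
  have hd : 0 < R - r := by linarith
  rw [inv_mul_eq_div, le_div_iff₀ hd]
  have h1 : (∑ i ∈ Finset.range n, R ^ i * r ^ (n - 1 - i)) * (R - r) = R ^ n - r ^ n :=
    Commute.geom_sum₂_mul (Commute.all R r) n
  have h2 : ∑ i ∈ Finset.range n, r ^ (n - 1) ≤ ∑ i ∈ Finset.range n, R ^ i * r ^ (n - 1 - i) := by
    refine Finset.sum_le_sum fun i hi => ?_
    rw [Finset.mem_range] at hi
    rw [show r ^ (n - 1) = r ^ i * r ^ (n - 1 - i) by rw [← pow_add]; congr 1; omega]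
    gcongr
  rw [Finset.sum_const, Finset.card_range, nsmul_eq_mul] at h2
  have h3 : 0 ≤ r ^ n := by positivity
  nlinarith

/-- A constant for the estimate of derivatives on a box. -/
theorem exists_abs_dterm_le {r R : SpaceTime}
    (h0 : 0 ≤ r.1 ∧ 0 ≤ r.2.1 ∧ 0 ≤ r.2.2.1 ∧ 0 ≤ r.2.2.2)
    (h : r.1 < R.1 ∧ r.2.1 < R.2.1 ∧ r.2.2.1 < R.2.2.1 ∧ r.2.2.2 < R.2.2.2) :
    ∃ C : Fin 4 → ℝ, ∀ a n i X, (|X.1| ≤ r.1 ∧ |X.2.1| ≤ r.2.1 ∧ |X.2.2.1| ≤ r.2.2.1 ∧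
      |X.2.2.2| ≤ r.2.2.2) → |dterm a X n i| ≤ C i * |term a R n| := by
  obtain ⟨h1, h2, h3, h4⟩ := h
  obtain ⟨p1, p2, p3, p4⟩ := h0
  refine ⟨![(R.1 - r.1)⁻¹, (R.2.1 - r.2.1)⁻¹, (R.2.2.1 - r.2.2.1)⁻¹, (R.2.2.2 - r.2.2.2)⁻¹], ?_⟩
  rintro a n i X ⟨x1, x2, x3, x4⟩
  rw [abs_term, abs_of_pos (p1.trans_lt h1), abs_of_pos (p2.trans_lt h2),
    abs_of_pos (p3.trans_lt h3), abs_of_pos (p4.trans_lt h4)]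
  have k1 := mul_pow_pred_le p1 h1 n.1
  have k2 := mul_pow_pred_le p2 h2 n.2.1
  have k3 := mul_pow_pred_le p3 h3 n.2.2.1
  have k4 := mul_pow_pred_le p4 h4 n.2.2.2
  have q1 : n.1 * |X.1| ^ (n.1 - 1) ≤ (R.1 - r.1)⁻¹ * R.1 ^ n.1 := le_trans (by gcongr) k1
  have q2 : n.2.1 * |X.2.1| ^ (n.2.1 - 1) ≤ (R.2.1 - r.2.1)⁻¹ * R.2.1 ^ n.2.1 :=
    le_trans (by gcongr) k2
  have q3 : n.2.2.1 * |X.2.2.1| ^ (n.2.2.1 - 1) ≤ (R.2.2.1 - r.2.2.1)⁻¹ * R.2.2.1 ^ n.2.2.1 :=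
    le_trans (by gcongr) k3
  have q4 : n.2.2.2 * |X.2.2.2| ^ (n.2.2.2 - 1) ≤ (R.2.2.2 - r.2.2.2)⁻¹ * R.2.2.2 ^ n.2.2.2 :=
    le_trans (by gcongr) k4
  have y1 := x1.trans h1.le
  have y2 := x2.trans h2.le
  have y3 := x3.trans h3.le
  have y4 := x4.trans h4.le
  have z1 := p1.trans h1.le
  have z2 := p2.trans h2.le
  have z3 := p3.trans h3.le
  have z4 := p4.trans h4.le
  have i1 : 0 ≤ (R.1 - r.1)⁻¹ := inv_nonneg.2 (by linarith)
  have i2 : 0 ≤ (R.2.1 - r.2.1)⁻¹ := inv_nonneg.2 (by linarith)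
  have i3 : 0 ≤ (R.2.2.1 - r.2.2.1)⁻¹ := inv_nonneg.2 (by linarith)
  fin_cases i <;> simp only [dterm, abs_mul, abs_pow, Nat.abs_cast]
  · calc _ ≤ |a n.1 n.2.1 n.2.2.1 n.2.2.2| * ((R.1 - r.1)⁻¹ * R.1 ^ n.1) * R.2.1 ^ n.2.1
          * R.2.2.1 ^ n.2.2.1 * R.2.2.2 ^ n.2.2.2 := by gcongr
      _ = _ := by simp; ring
  · calc _ ≤ |a n.1 n.2.1 n.2.2.1 n.2.2.2| * R.1 ^ n.1 * ((R.2.1 - r.2.1)⁻¹ * R.2.1 ^ n.2.1)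
          * R.2.2.1 ^ n.2.2.1 * R.2.2.2 ^ n.2.2.2 := by gcongr
      _ = _ := by simp; ring
  · calc _ ≤ |a n.1 n.2.1 n.2.2.1 n.2.2.2| * R.1 ^ n.1 * R.2.1 ^ n.2.1
          * ((R.2.2.1 - r.2.2.1)⁻¹ * R.2.2.1 ^ n.2.2.1) * R.2.2.2 ^ n.2.2.2 := by gcongr
      _ = _ := by simp; ring
  · calc _ ≤ |a n.1 n.2.1 n.2.2.1 n.2.2.2| * R.1 ^ n.1 * R.2.1 ^ n.2.1 * R.2.2.1 ^ n.2.2.1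
          * ((R.2.2.2 - r.2.2.2)⁻¹ * R.2.2.2 ^ n.2.2.2) := by gcongr
      _ = _ := by simp; ring

/-- The coefficients of the partial derivatives. -/
def fD (a : Coeffs) : Fin 4 → Coeffs
  | 0 => fT a
  | 1 => fS 1 a
  | 2 => fS 0 a
  | 3 => fS 2 a

/-- The exponents after the multiplication by a coordinate. -/
def raise (n : ℕ × ℕ × ℕ × ℕ) : Fin 4 → ℕ × ℕ × ℕ × ℕ
  | 0 => (n.1 + 1, n.2.1, n.2.2.1, n.2.2.2)
  | 1 => (n.1, n.2.1 + 1, n.2.2.1, n.2.2.2)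
  | 2 => (n.1, n.2.1, n.2.2.1 + 1, n.2.2.2)
  | 3 => (n.1, n.2.1, n.2.2.1, n.2.2.2 + 1)

theorem raise_injective (i : Fin 4) : Function.Injective fun n => raise n i := by
  rintro ⟨a, b, c, d⟩ ⟨a', b', c', d'⟩ h
  fin_cases i <;> simpa [raise] using h

theorem dterm_raise (a : Coeffs) (X : SpaceTime) (n : ℕ × ℕ × ℕ × ℕ) (i : Fin 4) :
    dterm a X (raise n i) i = term (fD a i) X n := by
  fin_cases i <;>
    simp only [dterm, raise, term, fD, fT, fS_one, fS_zero, fS_two, Nat.add_sub_cancel,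
      Nat.cast_add, Nat.cast_one] <;> ring

theorem dterm_of_notMem (a : Coeffs) (X : SpaceTime) (n : ℕ × ℕ × ℕ × ℕ) (i : Fin 4)
    (h : n ∉ Set.range fun n => raise n i) : dterm a X n i = 0 := by
  obtain ⟨n1, n2, n3, n4⟩ := n
  fin_cases i
  · cases n1 with
    | zero => simp [dterm]
    | succ k => exact absurd ⟨(k, n2, n3, n4), rfl⟩ h
  · cases n2 with
    | zero => simp [dterm]
    | succ k => exact absurd ⟨(n1, k, n3, n4), rfl⟩ h
  · cases n3 with
    | zero => simp [dterm]
    | succ k => exact absurd ⟨(n1, n2, k, n4), rfl⟩ h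
  · cases n4 with
    | zero => simp [dterm]
    | succ k => exact absurd ⟨(n1, n2, n3, k), rfl⟩ h

theorem hasSum_dterm_iff {a : Coeffs} {X : SpaceTime} {i : Fin 4} {S : ℝ} :
    HasSum (fun n => dterm a X n i) S ↔ HasSum (term (fD a i) X) S := by
  rw [← (raise_injective i).hasSum_iff fun n h => dterm_of_notMem a X n i h]
  simp only [Function.comp_def, dterm_raise]

theorem mem_convDomain_fD {a : Coeffs} {X : SpaceTime} (hX : X ∈ convDomain a) (i : Fin 4) :
    X ∈ convDomain (fD a i) := by
  obtain ⟨R, hXR, hR⟩ := mem_convDomain_iff.1 hX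
  obtain ⟨r, hr, h0, hrR⟩ := exists_between_box hXR
  obtain ⟨C, hC⟩ := exists_abs_dterm_le h0 hrR
  refine mem_convDomain_iff.2 ⟨r, hr, ?_⟩
  have : Summable fun n => dterm a r n i :=
    Summable.of_norm_bounded (hR.abs.mul_left (C i)) fun n =>
      hC a n i r ⟨(abs_of_nonneg h0.1).le, (abs_of_nonneg h0.2.1).le, (abs_of_nonneg h0.2.2.1).le,
        (abs_of_nonneg h0.2.2.2).le⟩
  exact (hasSum_dterm_iff.1 this.hasSum).summable

/-- Power series are differentiated term by term. -/
theorem hasFDerivAt_series {a : Coeffs} {X : SpaceTime} (hX : X ∈ convDomain a) :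
    HasFDerivAt (series a) (∑ i, series (fD a i) X • coord i) X := by
  obtain ⟨R, hXR, hR⟩ := mem_convDomain_iff.1 hX
  obtain ⟨r, hr, h0, hrR⟩ := exists_between_box hXR
  obtain ⟨C, hC⟩ := exists_abs_dterm_le h0 hrR
  have hu : Summable fun n => ∑ i, C i * |term a R n| :=
    summable_sum fun i _ => hR.abs.mul_left (C i)
  have := hasFDerivAt_tsum_of_isPreconnected hu (isOpen_box r) (convex_box r).isPreconnected
    (f := fun n X => term a X n) (f' := fun n X => ∑ i, dterm a X n i • coord i)
    (fun n Y _ => hasFDerivAt_term a Y n)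
    (fun n Y hY => by
      refine norm_sum_le_of_le _ fun i _ => ?_
      rw [norm_smul]
      have hb := hC a n i Y (by
        rw [mem_box] at hY
        exact ⟨hY.1.le, hY.2.1.le, hY.2.2.1.le, hY.2.2.2.le⟩)
      calc _ ≤ ‖dterm a Y n i‖ * 1 := by gcongr; exact norm_coord_le i
        _ ≤ _ := by rw [mul_one]; exact hb)
    hr (summable_of_mem_convDomain hX) hr
  refine this.congr_fderiv (HasSum.tsum_eq ?_)
  refine hasSum_sum fun i _ => HasSum.smul_const ?_ _
  exact hasSum_dterm_iff.2 (summable_of_mem_convDomain (mem_convDomain_fD hX i)).hasSum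

theorem contDiffOn_series (a : Coeffs) : ContDiffOn ℝ (⊤ : ℕ∞) (series a) (convDomain a) := by
  rw [contDiffOn_infty]
  intro n
  induction n generalizing a with
  | zero =>
    exact contDiffOn_zero.2 fun X hX =>
      (hasFDerivAt_series hX).continuousAt.continuousWithinAt
  | succ n ih =>
    rw [Nat.cast_succ, contDiffOn_succ_iff_fderiv_of_isOpen (isOpen_convDomain a)]
    refine ⟨fun X hX => (hasFDerivAt_series hX).differentiableAt.differentiableWithinAt,
      by simp, ?_⟩
    refine ContDiffOn.congr (f := fun X => ∑ i, series (fD a i) X • coord i) ?_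
      fun X hX => (hasFDerivAt_series hX).fderiv
    exact ContDiffOn.sum fun i _ =>
      ((ih (fD a i)).mono fun X hX => mem_convDomain_fD hX i).smul contDiffOn_const

theorem dT_series {a : Coeffs} {X : SpaceTime} (hX : X ∈ convDomain a) :
    dT (series a) X = series (fT a) X := by
  have := (hasFDerivAt_series hX).comp_hasDerivAt X.1
    ((hasDerivAt_id X.1).prodMk (hasDerivAt_const X.1 X.2))
  refine this.deriv.trans ?_
  simp [Fin.sum_univ_four, coord, fD]

theorem dS_series {a : Coeffs} {X : SpaceTime} (hX : X ∈ convDomain a) (β : Fin 3) :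
    dS β (series a) X = series (fS β a) X := by
  have h1 : HasDerivAt (fun s => ((X.1, s, X.2.2.1, X.2.2.2) : SpaceTime)) (0, 1, 0, 0) X.2.1 :=
    (hasDerivAt_const _ _).prodMk ((hasDerivAt_id _).prodMk (hasDerivAt_const _ X.2.2))
  have h0 : HasDerivAt (fun s => ((X.1, X.2.1, s, X.2.2.2) : SpaceTime)) (0, 0, 1, 0) X.2.2.1 :=
    (hasDerivAt_const _ _).prodMk ((hasDerivAt_const _ _).prodMk
      ((hasDerivAt_id _).prodMk (hasDerivAt_const _ _)))
  have h2 : HasDerivAt (fun s => ((X.1, X.2.1, X.2.2.1, s) : SpaceTime)) (0, 0, 0, 1) X.2.2.2 :=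
    (hasDerivAt_const _ _).prodMk ((hasDerivAt_const _ _).prodMk
      ((hasDerivAt_const _ _).prodMk (hasDerivAt_id _)))
  have h := hasFDerivAt_series hX
  fin_cases β
  · refine (HasFDerivAt.comp_hasDerivAt X.2.2.1 h h0).deriv.trans ?_
    simp [Fin.sum_univ_four, coord, fD]
  · refine (HasFDerivAt.comp_hasDerivAt X.2.1 h h1).deriv.trans ?_
    simp [Fin.sum_univ_four, coord, fD]
  · refine (HasFDerivAt.comp_hasDerivAt X.2.2.2 h h2).deriv.trans ?_
    simp [Fin.sum_univ_four, coord, fD]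

theorem mem_convDomain_fT {a : Coeffs} {X : SpaceTime} (hX : X ∈ convDomain a) :
    X ∈ convDomain (fT a) := mem_convDomain_fD hX 0

theorem mem_convDomain_fS {a : Coeffs} {X : SpaceTime} (hX : X ∈ convDomain a) (β : Fin 3) :
    X ∈ convDomain (fS β a) := by
  fin_cases β
  · exact mem_convDomain_fD hX 2
  · exact mem_convDomain_fD hX 1
  · exact mem_convDomain_fD hX 3

/-! ### Functions represented by power series -/

/-- On the set `D`, the function `f` is the sum of the power series `a`. -/
def RepOn (D : Set SpaceTime) (a : Coeffs) (f : SpaceTime → ℝ) : Prop :=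
  ∀ X ∈ D, HasSum (term a X) (f X)

namespace RepOn

variable {D : Set SpaceTime} {a b : Coeffs} {f f' : SpaceTime → ℝ}

theorem of_subset (h : D ⊆ convDomain a) : RepOn D a (series a) :=
  fun _ hX => (summable_of_mem_convDomain (h hX)).hasSum

theorem subset (hD : IsOpen D) (h : RepOn D a f) : D ⊆ convDomain a :=
  interior_maximal (fun X hX => (h X hX).summable) hD

theorem eq (h : RepOn D a f) {X : SpaceTime} (hX : X ∈ D) : f X = series a X :=
  (h X hX).tsum_eq.symm

theorem congr (h : RepOn D a f) (hf : ∀ X ∈ D, f X = f' X) : RepOn D a f' :=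
  fun X hX => hf X hX ▸ h X hX

theorem zero : RepOn D (fun _ _ _ _ => 0) fun _ => 0 := by
  intro X _
  rw [show term (fun _ _ _ _ => 0) X = fun _ => 0 by funext n; simp [term]]
  exact hasSum_zero

theorem add (ha : RepOn D a f) (hb : RepOn D b f') :
    RepOn D (fun ω p q r => a ω p q r + b ω p q r) (fun X => f X + f' X) := by
  intro X hX
  refine ((ha X hX).add (hb X hX)).congr_fun fun n => ?_
  simp only [term]
  ring

theorem const_mul (ha : RepOn D a f) (x : ℝ) :
    RepOn D (fun ω p q r => x * a ω p q r) (fun X => x * f X) := by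
  intro X hX
  refine ((ha X hX).mul_left x).congr_fun fun n => ?_
  simp only [term]
  ring

theorem sum {a : Fin 3 → Coeffs} {f : Fin 3 → SpaceTime → ℝ} (h : ∀ β, RepOn D (a β) (f β)) :
    RepOn D (fun ω p q r => ∑ β, a β ω p q r) (fun X => ∑ β, f β X) := by
  simp only [Fin.sum_univ_three]
  exact ((h 0).add (h 1)).add (h 2)

/-- The decompositions of a multi-index into two summands. -/
abbrev antidiagonalMultiIndex : Finset.HasAntidiagonal (ℕ × ℕ × ℕ × ℕ) where
  antidiagonal n := (Finset.range (n.1 + 1) ×ˢ (Finset.range (n.2.1 + 1) ×ˢ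
    (Finset.range (n.2.2.1 + 1) ×ˢ Finset.range (n.2.2.2 + 1)))).image fun k => (n - k, k)
  mem_antidiagonal := by
    rintro ⟨n1, n2, n3, n4⟩ ⟨⟨a1, a2, a3, a4⟩, ⟨b1, b2, b3, b4⟩⟩
    simp only [Finset.mem_image, Finset.mem_product, Finset.mem_range, Prod.mk.injEq, Prod.exists,
      Prod.mk_sub_mk, Prod.mk_add_mk]
    constructor
    · rintro ⟨c1, c2, c3, c4, h⟩; omega
    · rintro h; exact ⟨b1, b2, b3, b4, by omega⟩

theorem mul (ha : RepOn D a f) (hb : RepOn D b f') :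
    RepOn D (fMul a b) (fun X => f X * f' X) := by
  intro X hX
  let := antidiagonalMultiIndex
  have h1 : Summable (fun x => ‖term a X x‖) := (ha X hX).summable.norm
  have h2 : Summable (fun x => ‖term b X x‖) := (hb X hX).summable.norm
  have hs := summable_mul_of_summable_norm h1 h2
  have h3 := h1.of_norm.tsum_mul_tsum_eq_tsum_sum_antidiagonal h2.of_norm hs
  have h4 := summable_sum_mul_antidiagonal_of_summable_mul hs
  rw [(ha X hX).tsum_eq, (hb X hX).tsum_eq] at h3
  change HasSum _ (f X * f' X)
  rw [h3]
  refine h4.hasSum.congr_fun fun n => ?_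
  change term (fMul a b) X n = ∑ kl ∈ Finset.image (fun k => (n - k, k)) _, _
  rw [Finset.sum_image fun x _ y _ h => (Prod.mk.inj h).2]
  simp only [Finset.sum_product, term, fMul, Finset.sum_mul]
  refine Finset.sum_congr rfl fun k hk => Finset.sum_congr rfl fun i hi =>
    Finset.sum_congr rfl fun j hj => Finset.sum_congr rfl fun l hl => ?_
  rw [Finset.mem_range, Nat.lt_succ_iff] at hk hi hj hl
  simp only [Prod.fst_sub, Prod.snd_sub]
  rw [← pow_sub_mul_pow X.1 hk, ← pow_sub_mul_pow X.2.1 hi, ← pow_sub_mul_pow X.2.2.1 hj,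
    ← pow_sub_mul_pow X.2.2.2 hl]
  ring

theorem eventuallyEq (hD : IsOpen D) (h : RepOn D a f) {X : SpaceTime} (hX : X ∈ D) :
    f =ᶠ[nhds X] series a :=
  Filter.eventuallyEq_of_mem (hD.mem_nhds hX) fun _ hY => h.eq hY

theorem dT (hD : IsOpen D) (h : RepOn D a f) : RepOn D (fT a) (dT f) := by
  intro X hX
  have hX' := h.subset hD hX
  have hc : Filter.Tendsto (fun s => ((s, X.2.1, X.2.2.1, X.2.2.2) : SpaceTime)) (nhds X.1)
      (nhds X) := Continuous.tendsto (by fun_prop) X.1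
  have : NSSeries.dT f X = NSSeries.dT (series a) X :=
    Filter.EventuallyEq.deriv_eq (hc.eventually (h.eventuallyEq hD hX))
  rw [this, dT_series hX']
  exact (summable_of_mem_convDomain (mem_convDomain_fT hX')).hasSum

theorem dS (hD : IsOpen D) (h : RepOn D a f) (β : Fin 3) : RepOn D (fS β a) (dS β f) := by
  intro X hX
  have hX' := h.subset hD hX
  have h1 : Filter.Tendsto (fun s => ((X.1, s, X.2.2.1, X.2.2.2) : SpaceTime)) (nhds X.2.1)
      (nhds X) := Continuous.tendsto (by fun_prop) X.2.1
  have h0 : Filter.Tendsto (fun s => ((X.1, X.2.1, s, X.2.2.2) : SpaceTime)) (nhds X.2.2.1)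
      (nhds X) := Continuous.tendsto (by fun_prop) X.2.2.1
  have h2 : Filter.Tendsto (fun s => ((X.1, X.2.1, X.2.2.1, s) : SpaceTime)) (nhds X.2.2.2)
      (nhds X) := Continuous.tendsto (by fun_prop) X.2.2.2
  have : NSSeries.dS β f X = NSSeries.dS β (series a) X := by
    have he := h.eventuallyEq hD hX
    unfold NSSeries.dS
    split_ifs
    · exact Filter.EventuallyEq.deriv_eq (h1.eventually he)
    · exact Filter.EventuallyEq.deriv_eq (h0.eventually he)
    · exact Filter.EventuallyEq.deriv_eq (h2.eventually he)
  rw [this, dS_series hX' β]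
  exact (summable_of_mem_convDomain (mem_convDomain_fS hX' β)).hasSum

theorem apply_zero (h : RepOn D a f) (h0 : (0 : SpaceTime) ∈ D) : f 0 = a 0 0 0 0 := by
  have h1 : HasSum (term a 0) (term a 0 (0, 0, 0, 0)) := by
    refine hasSum_single _ fun n hn => ?_
    obtain ⟨n1, n2, n3, n4⟩ := n
    simp only [ne_eq, Prod.mk.injEq, not_and_or] at hn
    simp only [term, Prod.fst_zero, Prod.snd_zero, mul_eq_zero, zero_pow_eq_zero]
    omega
  rw [(h 0 h0).unique h1]
  simp [term]

/-- The coefficients are determined by the sum near the origin. -/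
theorem unique (hD : IsOpen D) (h0 : (0 : SpaceTime) ∈ D) (ha : RepOn D a f) (hb : RepOn D b f) :
    a = b := by
  have key : ∀ ω p q r : ℕ, ∀ (a b : Coeffs) (f : SpaceTime → ℝ), RepOn D a f → RepOn D b f →
      a ω p q r = b ω p q r := by
    intro ω
    induction ω with
    | succ ω ih =>
      intro p q r a b f ha hb
      have := ih p q r _ _ _ (ha.dT hD) (hb.dT hD)
      exact mul_left_cancel₀ (by positivity) this
    | zero =>
    intro p
    induction p with
    | succ p ih =>
      intro q r a b f ha hb
      have := ih q r _ _ _ (ha.dS hD 1) (hb.dS hD 1)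
      rw [fS_one, fS_one] at this
      exact mul_left_cancel₀ (by positivity) this
    | zero =>
    intro q
    induction q with
    | succ q ih =>
      intro r a b f ha hb
      have := ih r _ _ _ (ha.dS hD 0) (hb.dS hD 0)
      rw [fS_zero, fS_zero] at this
      exact mul_left_cancel₀ (by positivity) this
    | zero =>
    intro r
    induction r with
    | succ r ih =>
      intro a b f ha hb
      have := ih _ _ _ (ha.dS hD 2) (hb.dS hD 2)
      rw [fS_two, fS_two] at this
      exact mul_left_cancel₀ (by positivity) this
    | zero =>
      intro a b f ha hb
      rw [← ha.apply_zero h0, ← hb.apply_zero h0]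
  funext ω p q r
  exact key ω p q r a b f ha hb

end RepOn

/-! ### Convergent and formal solutions -/

theorem isOpen_flowDomain (u : Fin 3 → Coeffs) (P : Coeffs) : IsOpen (flowDomain u P) :=
  (isOpen_iInter_of_finite fun _ => isOpen_convDomain _).inter (isOpen_convDomain _)

theorem zero_mem_iInter_convDomain {a : Fin 3 → Coeffs} {X : SpaceTime}
    (h : X ∈ ⋂ α, convDomain (a α)) : (0 : SpaceTime) ∈ ⋂ α, convDomain (a α) :=
  Set.mem_iInter.2 fun α => zero_mem_convDomain (Set.mem_iInter.1 h α)

theorem IsConvergentSolution.isFormalSolution {ρ μ : ℝ} {g u : Fin 3 → Coeffs} {P : Coeffs}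
    (h : IsConvergentSolution ρ μ g u P) : IsFormalSolution ρ μ g u P := by
  obtain ⟨⟨X₀, h₀⟩, -, -, hNS⟩ := h
  obtain ⟨D, hDdef⟩ : ∃ D, D = flowDomain u P ∩ ⋂ α, convDomain (g α) := ⟨_, rfl⟩
  rw [← hDdef] at hNS
  have hD : IsOpen D := by
    rw [hDdef]
    exact (isOpen_flowDomain u P).inter (isOpen_iInter_of_finite fun _ => isOpen_convDomain _)
  have h0 : (0 : SpaceTime) ∈ D := by
    rw [hDdef]
    exact ⟨⟨zero_mem_iInter_convDomain h₀.1.1, zero_mem_convDomain h₀.1.2⟩,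
      zero_mem_iInter_convDomain h₀.2⟩
  have hu : ∀ α, RepOn D (u α) (series (u α)) := fun α => RepOn.of_subset fun X hX => by
    rw [hDdef] at hX; exact Set.mem_iInter.1 hX.1.1 α
  have hP : RepOn D P (series P) := RepOn.of_subset fun X hX => by
    rw [hDdef] at hX; exact hX.1.2
  have hg : ∀ α, RepOn D (g α) (series (g α)) := fun α => RepOn.of_subset fun X hX => by
    rw [hDdef] at hX; exact Set.mem_iInter.1 hX.2 α
  have hdiv := RepOn.sum fun β => (hu β).dS hD β
  have hl := fun α => (((hu α).dT hD).add (RepOn.sum fun β => (hu β).mul ((hu α).dS hD β))).const_mul ρ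
  have hr := fun α => (((hP.dS hD α).const_mul (-1)).add
    ((RepOn.sum fun β => ((hu α).dS hD β).dS hD β).const_mul μ)).add ((hg α).const_mul ρ)
  intro ω p q r
  refine ⟨?_, fun α => ?_⟩
  · have := RepOn.unique hD h0 hdiv (RepOn.zero.congr fun X hX => ((hNS X hX).1).symm)
    exact congrFun (congrFun (congrFun (congrFun this ω) p) q) r
  · have := RepOn.unique hD h0 (hl α) ((hr α).congr fun X hX => by
      rw [(hNS X hX).2 α]; ring)
    have := congrFun (congrFun (congrFun (congrFun this ω) p) q) r
    rw [this]
    ring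

/-- The sums of a formal solution solve the equations wherever the series of the velocity and of
the pressure converge. There the series of the body acceleration converges as well, since the
momentum relation expresses its coefficients by the others. -/
theorem IsFormalSolution.isNSSolutionOn {ρ μ : ℝ} (hρ : ρ ≠ 0) {g u : Fin 3 → Coeffs} {P : Coeffs}
    (h : IsFormalSolution ρ μ g u P) :
    IsNSSolutionOn (flowDomain u P) ρ μ (fun α => series (g α)) (fun α => series (u α))
      (series P) := by
  have hsu : ∀ α, flowDomain u P ⊆ convDomain (u α) := fun α X hX => Set.mem_iInter.1 hX.1 α
  have hsP : flowDomain u P ⊆ convDomain P := fun X hX => hX.2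
  refine ⟨fun α => (contDiffOn_series _).mono (hsu α), (contDiffOn_series _).mono hsP, ?_⟩
  have hD := isOpen_flowDomain u P
  have hu : ∀ α, RepOn (flowDomain u P) (u α) (series (u α)) := fun α => RepOn.of_subset (hsu α)
  have hP : RepOn (flowDomain u P) P (series P) := RepOn.of_subset hsP
  have hdiv := RepOn.sum fun β => (hu β).dS hD β
  have hg := fun α =>
    (((((hu α).dT hD).add (RepOn.sum fun β => (hu β).mul ((hu α).dS hD β))).const_mul ρ).add
      ((hP.dS hD α).add
        ((RepOn.sum fun β => ((hu α).dS hD β).dS hD β).const_mul (-μ)))).const_mul ρ⁻¹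
  intro X hX
  refine ⟨?_, fun α => ?_⟩
  · refine (hdiv X hX).unique ?_
    have : (fun ω p q r => ∑ β, fS β (u β) ω p q r) = fun _ _ _ _ => 0 := by
      funext ω p q r; exact (h ω p q r).1
    rw [this]
    exact RepOn.zero X hX
  · have e := (hg α).eq hX
    have : (fun ω p q r => ρ⁻¹ * (ρ * (fT (u α) ω p q r + ∑ β, fMul (u β) (fS β (u α)) ω p q r)
        + (fS α P ω p q r + -μ * ∑ β, fS β (fS β (u α)) ω p q r))) = g α := by
      funext ω p q r
      rw [(h ω p q r).2 α]
      field_simp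
      ring
    rw [this] at e
    simp only
    rw [← e, mul_inv_cancel_left₀ hρ]
    ring

end NSSeries

end

theorem theorem3p3 (ρ μ : ℝ) (hρ : ρ ≠ 0) (g c : Fin 3 → Coeffs) (π₀ : ℕ → ℕ → ℕ → ℝ) :
    (∀ (u : Fin 3 → Coeffs) (P : Coeffs), HasData c π₀ u P →
      (IsConvergentSolution ρ μ g u P ∨ IsFormalSolution ρ μ g u P) →
        (∀ α ω p q r, u α ω p q r = velocityFormula (μ / ρ) g c α ω p q r) ∧
        (∀ ω p q r, P ω p q r = pressureFormula ρ (μ / ρ) g u π₀ ω p q r)) ∧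
    ((∃ (u : Fin 3 → Coeffs) (P : Coeffs), HasData c π₀ u P ∧
        (IsConvergentSolution ρ μ g u P ∨ IsFormalSolution ρ μ g u P)) →
      ∀ (u : Fin 3 → Coeffs) (P : Coeffs), u = velocityFormula (μ / ρ) g c →
        P = pressureFormula ρ (μ / ρ) g u π₀ →
        IsNSSolutionOn (flowDomain u P) ρ μ
          (fun α => series (g α)) (fun α => series (u α)) (series P)) := by
  have formal : ∀ (u : Fin 3 → Coeffs) (P : Coeffs),
      IsConvergentSolution ρ μ g u P ∨ IsFormalSolution ρ μ g u P → IsFormalSolution ρ μ g u P :=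
    fun u P h => h.elim (fun h => h.isFormalSolution) id
  have coeffs : ∀ (u : Fin 3 → Coeffs) (P : Coeffs), HasData c π₀ u P →
      (IsConvergentSolution ρ μ g u P ∨ IsFormalSolution ρ μ g u P) →
        (∀ α ω p q r, u α ω p q r = velocityFormula (μ / ρ) g c α ω p q r) ∧
        (∀ ω p q r, P ω p q r = pressureFormula ρ (μ / ρ) g u π₀ ω p q r) :=
    fun u P hdata h => ⟨(formal u P h).velocity_eq hρ hdata.1, (formal u P h).pressure_eq hρ hdata.2⟩
  refine ⟨coeffs, ?_⟩
  rintro ⟨u, P, hdata, h⟩ u' P' hu' hP'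
  obtain ⟨hu, hP⟩ := coeffs u P hdata h
  have eu : u' = u := by
    rw [hu']
    funext α ω p q r
    exact (hu α ω p q r).symm
  have eP : P' = P := by
    rw [hP', eu]
    funext ω p q r
    exact (hP ω p q r).symm
  rw [eu, eP]
  exact (formal u P h).isNSSolutionOn hρ
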